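/- Let $L,m>0$, $\mathbb T^2=\mathbb R^2/L\mathbb Z^2$, let $\|\cdot\|_{a}$ be the norm of $C^a=B^a_{\infty,\infty}(\mathbb T^2)$ (defined with a fixed dyadic partition of unity evaluated at the frequencies $2\pi k/L$, $k\in\mathbb Z^2$), $H_t$ the heat kernel of $\partial_t-\Delta+m$ on $\mathbb T^2$, and $c_{t,\infty}=2\int_t^\infty H_{2r}(0)\,dr$. Let $\xi$ be space-time white noise. For $0\le s\le t$ let $Z^{(1)}_{s,t}$ be the solution of $(\partial_t-\Delta+m)Z^{(1)}=\sqrt2\,\xi$ with $Z^{(1)}_{s,s}=0$, i.e. $Z^{(1)}_{s,t}(\varphi)=\sqrt2\,\xi(\mathbf 1_{[s,t)}H_{t-\cdot}*\varphi)$, and let $Z^{(2)}_{s,t}$, $Z^{(3)}_{s,t}$ be its Wick powers, i.e. the limits (in probability, in $C^{-a}$ for every $a>0$) as $\delta\downarrow0$ of $(Z^{(1),\delta}_{s,t})^2-c^{\delta}_{s,t}$ and $(Z^{(1),\delta}_{s,t})^3-3c^{\delta}_{s,t}Z^{(1),\delta}_{s,t}$, where $\delta$ denotes spatial mollification and $c^\delta_{s,t}=\mathbb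 E[(Z^{(1),\delta}_{s,t}(0))^2]$. Versions are taken for which, almost surely, $t\mapsto Z^{(k)}_{s,t}$ belongs to $C([s,\infty);C^{-a})$ for all $s\ge 0$, $a>0$, $k=1,2,3$. Fix $\alpha_0,\beta,\gamma$ with $\alpha_0,\beta>0$ and $\frac{\alpha_0+\beta}2<\gamma<\frac13$. For $f\in C^{-\alpha_0}$ and $s\ge0$ let $v_{s,t}$, $t>s$, be the mild solution, in the class of $w\in C((s,\infty);C^\beta)$ with $\sup_{s<t\le T}((t-s)\wedge1)^\gamma\|w_t\|_\beta<\infty$ for all $T$, of $$(\partial_t-\Delta+m)v_{s,t}=-v_{s,t}^3-3v_{s,t}^2Z^{(1)}_{s,t}-3v_{s,t}Z^{(2)}_{s,t}-Z^{(3)}_{s,t}+3c_{t-s,\infty}\big(Z^{(1)}_{s,t}+v_{s,t}\big),\qquad v_{s,t}|_{t=s}=u_s,$$ where $u_0=f$ and $u_s=Z^{(1)}_{0,s}+v_{0,s}$ for $s>0$. For $h\in C^\infty(\mathbb T^2)$ let $J_{s,t}h$ be the mild solution, in the same class, of $$(\partial_t-\Delta+m)J_{s,t}h=-3\big(v_{s,t}^2+2v_{s,t}Z^{(1)}_{s,t}+Z^{(2)}_{s,t}\big)J_{s,t}h+3c_{t-s,\infty}J_{s,t}h,\qquad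 J_{s,t}h|_{t=s}=h.$$ **Proposition.** For every $\alpha\in(0,1)$ there is a deterministic constant $c=c(\alpha)\in(0,\infty)$, independent of all other data, such that, with $$g(s,t)=c\Big(\|Z^{(1)}_{s,t}\|_{-\alpha}^2+\|Z^{(1)}_{s,t}\|_{-\alpha}^{\frac2{1+\alpha}}\|\nabla v_{s,t}\|_\infty^{\frac{2\alpha}{1+\alpha}}+\|Z^{(1)}_{s,t}\|_{-\alpha}^{\frac2{1-\alpha}}+\|Z^{(2)}_{s,t}\|_{-\alpha}+\|Z^{(2)}_{s,t}\|_{-\alpha}^{\frac2{2-\alpha}}+c_{t-s,\infty}\Big),$$ the following holds almost surely, for all $f$ and $h$ as above and all $0\le s\le t'\le t$. For $r>s$ the functions $v_{s,r}$ and $J_{s,r}h$ are of class $C^1$; the functions $r\mapsto g(s,r)$, $r\mapsto\|\nabla J_{s,r}h\|_{L^2}^2$ and $r\mapsto\|v_{s,r}J_{s,r}h\|_{L^2}^2$ are integrable on $[s,t]$; and $$\|J_{s,t}h\|_{L^2}^2+\int_{t'}^te^{-2m(t-r)+2\int_r^tg(s,r')dr'}\|\nabla J_{s,r}h\|_{L^2}^2\,dr+\int_{t'}^te^{-2m(t-r)+2\int_r^tg(s,r')dr'}\|v_{s,r}J_{s,r}h\|_{L^2}^2\,dr\le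 e^{-2m(t-t')+2\int_{t'}^tg(s,r)dr}\|J_{s,t'}h\|_{L^2}^2 .$$ In particular $\|J_{s,t}h\|_{L^2}^2\le e^{-2m(t-s)+2\int_s^tg(s,r)dr}\|h\|_{L^2}^2$. -/

import Mathlib

open MeasureTheory ProbabilityTheory Filter Topology
open scoped ENNReal NNReal

noncomputable section

namespace Phi42

/-- The two-dimensional torus `ℝ² / Lℤ²`. Its `volume` is Lebesgue measure, of total mass `L²`. -/
abbrev Torus (L : ℝ) : Type := Fin 2 → AddCircle L

/-- Frequencies: `k ∈ ℤ²` stands for the wave vector `2πk/L`. -/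
abbrev Freq : Type := Fin 2 → ℤ

/-- Formal Fourier series `∑ₖ u k · eₖ` on the torus; a distribution is represented by its Fourier
coefficients. The distributions used below are those of some Hölder–Besov space, see `MemC`. -/
abbrev TDist : Type := Freq → ℂ

section Fourier

variable (L : ℝ)

/-- The character `eₖ(x) = exp(2πi k·x/L)`. -/
def torusChar (k : Freq) (x : Torus L) : ℂ := ∏ i, fourier (k i) (x i)

/-- `|2πk/L|²`. -/
def freqSq (k : Freq) : ℝ := ∑ i, (2 * Real.pi * (k i : ℝ) / L) ^ 2

/-- Smooth radial frequency cutoff: `1` on `|ξ| ≤ 1`, and `0` for `|ξ| ≥ 4/3`. -/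
def cutoff (ρ : ℝ) : ℝ := Real.smoothTransition (4 - 3 * ρ)

/-- Mollification of `u` at spatial scale `δ > 0`, i.e. convolution with the rescaled Schwartz kernel
`δ⁻² η(·/δ)` whose Fourier transform is the cutoff (a finite sum). -/
def mollify (δ : ℝ) (u : TDist) (x : Torus L) : ℂ :=
  ∑' k : Freq, (cutoff (δ * Real.sqrt (freqSq L k)) : ℂ) * u k * torusChar L k x

/-- Littlewood–Paley blocks. `lpBlock L n u` is the usual block `Δ_{n-1} u`: the multiplier is
`cutoff |ξ|` for `n = 0`, and `cutoff (2^{-n}|ξ|) - cutoff (2^{-(n-1)}|ξ|)`, supported in the annulus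
`2^{n-1} ≤ |ξ| ≤ (8/3) 2^{n-1}`, for `n ≥ 1`. -/
def lpBlock : ℕ → TDist → Torus L → ℂ
  | 0, u, x => mollify L 1 u x
  | n + 1, u, x => mollify L ((2 : ℝ)⁻¹ ^ (n + 1)) u x - mollify L ((2 : ℝ)⁻¹ ^ n) u x

/-- The norm `‖u‖_a` of `C^a = B^a_{∞,∞}`, that is `sup_{j ≥ -1} 2^{ja} ‖Δ_j u‖_∞`. -/
def besov (a : ℝ) (u : TDist) : ℝ≥0∞ :=
  ⨆ n : ℕ, ENNReal.ofReal ((2 : ℝ) ^ (((n : ℝ) - 1) * a)) * ⨆ x : Torus L, ‖lpBlock L n u x‖ₑ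

/-- `u` is a real distribution in `C^a`. -/
def MemC (a : ℝ) (u : TDist) : Prop :=
  (∀ k, u (-k) = (starRingEnd ℂ) (u k)) ∧ besov L a u < ∞

variable [Fact (0 < L)]

/-- Fourier coefficients of a function on the torus. -/
def fcoef (w : Torus L → ℂ) : TDist :=
  fun k => ((L ^ 2)⁻¹ : ℝ) * ∫ x, w x * (starRingEnd ℂ) (torusChar L k x)

/-- Fourier coefficients of a real function on the torus. -/
def fcoefR (w : Torus L → ℝ) : TDist := fcoef L (fun x => (w x : ℂ))

/-- Product of a distribution `u` with a function `w`: the limit, as `δ ↓ 0`, of the products of the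
mollifications of `u` with `w`. The limit exists whenever `u ∈ C^{-a}`, `w ∈ C^b` and `b > a > 0`. -/
def mulDist (u : TDist) (w : Torus L → ℝ) : TDist :=
  fun k => limUnder (𝓝[>] (0 : ℝ)) (fun δ => fcoef L (fun x => mollify L δ u x * (w x : ℂ)) k)

end Fourier

section Functions

variable {L : ℝ}

/-- A function on the torus lifted to a periodic function on the plane. -/
def torusLift (w : Torus L → ℝ) (y : Fin 2 → ℝ) : ℝ := w (fun i => (y i : AddCircle L))

/-- `C^n` functions on the torus. -/
def IsC (n : WithTop ℕ∞) (w : Torus L → ℝ) : Prop := ContDiff ℝ n (torusLift w)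

/-- Partial derivative in direction `i`. -/
def pderiv (i : Fin 2) (w : Torus L → ℝ) (x : Torus L) : ℝ :=
  deriv (fun τ : ℝ => w (x + Pi.single i (τ : AddCircle L))) 0

/-- `|∇w(x)|²`. -/
def gradSq (w : Torus L → ℝ) (x : Torus L) : ℝ := ∑ i, pderiv i w x ^ 2

/-- `‖∇w‖_∞`, for `w` of class `C¹`. -/
def supGrad (w : Torus L → ℝ) : ℝ := ⨆ x, Real.sqrt (gradSq w x)

variable [Fact (0 < L)]

/-- `‖w‖²` in `L²` of the torus. -/
def l2Sq (w : Torus L → ℝ) : ℝ := ∫ x, w x ^ 2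

/-- `‖∇w‖²` in `L²` of the torus. -/
def l2GradSq (w : Torus L → ℝ) : ℝ := ∫ x, gradSq w x

end Functions

section Heat

variable (L m : ℝ)

/-- Heat kernel `H_t(x)` of `∂_t - Δ + m` on the torus. -/
def heatKernel (t : ℝ) (x : Torus L) : ℝ :=
  (∑' k : Freq, (((L ^ 2)⁻¹ * Real.exp (-t * (m + freqSq L k)) : ℝ) : ℂ) * torusChar L k x).re

/-- `c_{t,∞} = 2 ∫_t^∞ H_{2r}(0) dr`, for `t > 0`. -/
def cInf (t : ℝ) : ℝ := 2 * ∫ r in Set.Ioi t, heatKernel L m (2 * r) 0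

end Heat

section Noise

variable (L : ℝ) [Fact (0 < L)] {Ω : Type*} [MeasurableSpace Ω]

/-- Space-time white noise on `ℝ × ℝ²/Lℤ²`: a linear family of centred Gaussian variables `ξ(φ)`
indexed by the square integrable functions, with variance `‖φ‖²_{L²}`. -/
structure IsWhiteNoise (P : Measure Ω) (ξ : (ℝ × Torus L → ℝ) → Ω → ℝ) : Prop where
  measurable : ∀ φ, MemLp φ 2 volume → Measurable (ξ φ)
  law : ∀ φ, MemLp φ 2 volume → P.map (ξ φ) = gaussianReal 0 (∫ z, φ z ^ 2).toNNReal
  linear : ∀ (a b : ℝ) (φ ψ), MemLp φ 2 volume → MemLp ψ 2 volume →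
    ξ (fun z => a * φ z + b * ψ z) =ᵐ[P] fun ω => a * ξ φ ω + b * ξ ψ ω

/-- `√2 ξ(1_{[s,t)} H_{t-·} ∗ φ)`: the solution at time `t` of the stochastic heat equation started
from `0` at time `s`, tested against `φ`. -/
def stochConv (m : ℝ) (ξ : (ℝ × Torus L → ℝ) → Ω → ℝ) (s t : ℝ) (φ : Torus L → ℝ) : Ω → ℝ :=
  fun ω => Real.sqrt 2 *
    ξ (fun z => (Set.Ico s t).indicator
      (fun r => ∫ y, heatKernel L m (t - r) (z.2 - y) * φ y) z.1) ω

/-- `c_{s,t}^{(δ)} = E[(u^{(δ)}_{s,t}(0))²]`, where `u^{(δ)}` is the mollification of `u`. -/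
def wickConst (P : Measure Ω) (u : ℝ → ℝ → Ω → TDist) (δ s t : ℝ) : ℝ :=
  ∫ ω, (mollify L δ (u s t ω) 0).re ^ 2 ∂P

/-- `t ↦ w t` belongs to `C([s,∞); C^a)`. -/
def ContPath (a s : ℝ) (w : ℝ → TDist) : Prop :=
  (∀ t, s ≤ t → MemC L a (w t)) ∧
  ∀ t₀, s ≤ t₀ → Tendsto (fun t => besov L a (w t - w t₀)) (𝓝[Set.Ici s] t₀) (𝓝 0)

/-- `one`, `two`, `three` are (the continuous versions of) the solution of the stochastic heat equation
restarted from `0` at time `s` and its second and third Wick powers. -/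
structure IsWickSystem (m : ℝ) (P : Measure Ω) (ξ : (ℝ × Torus L → ℝ) → Ω → ℝ)
    (one two three : ℝ → ℝ → Ω → TDist) : Prop where
  one_eq : ∀ s t, 0 ≤ s → s ≤ t → ∀ k : Freq, ∀ᵐ ω ∂P,
    one s t ω k = ((L ^ 2)⁻¹ : ℝ) *
      ((stochConv L m ξ s t (fun x => (torusChar L k x).re) ω : ℂ) -
        Complex.I * (stochConv L m ξ s t (fun x => (torusChar L k x).im) ω : ℂ))
  two_lim : ∀ s t, 0 ≤ s → s ≤ t → ∀ a : ℝ, 0 < a → ∀ ε : ℝ≥0∞, 0 < ε →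
    Tendsto (fun δ : ℝ => P {ω | ε < besov L (-a)
      (fcoef L (fun x => mollify L δ (one s t ω) x ^ 2 - (wickConst L P one δ s t : ℂ))
        - two s t ω)}) (𝓝[>] 0) (𝓝 0)
  three_lim : ∀ s t, 0 ≤ s → s ≤ t → ∀ a : ℝ, 0 < a → ∀ ε : ℝ≥0∞, 0 < ε →
    Tendsto (fun δ : ℝ => P {ω | ε < besov L (-a)
      (fcoef L (fun x => mollify L δ (one s t ω) x ^ 3
          - 3 * (wickConst L P one δ s t : ℂ) * mollify L δ (one s t ω) x)
        - three s t ω)}) (𝓝[>] 0) (𝓝 0)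
  paths : ∀ᵐ ω ∂P, ∀ a : ℝ, 0 < a → ∀ s, 0 ≤ s →
    ContPath L (-a) s (fun t => one s t ω) ∧ ContPath L (-a) s (fun t => two s t ω) ∧
      ContPath L (-a) s (fun t => three s t ω)

end Noise

section Equations

variable (L : ℝ) [Fact (0 < L)] (m β γ : ℝ)

/-- The solution class: `w ∈ C((s,∞); C^β)` and `sup_{s < t ≤ T} ((t-s) ∧ 1)^γ ‖w_t‖_β < ∞` for
every `T`. -/
structure InClass (s : ℝ) (w : ℝ → Torus L → ℝ) : Prop where
  cont : ∀ t, s < t → Continuous (w t)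
  time_cont : ∀ t₀, s < t₀ →
    Tendsto (fun t => besov L β (fcoefR L (w t) - fcoefR L (w t₀))) (𝓝 t₀) (𝓝 0)
  bound : ∀ T, ∃ K : ℝ, ∀ t, s < t → t ≤ T →
    ENNReal.ofReal (min (t - s) 1 ^ γ) * besov L β (fcoefR L (w t)) ≤ ENNReal.ofReal K

/-- Mild solution on `(s,∞)` of `(∂_t - Δ + m) w = F`, `w|_{t=s} = u₀`:
`w_t = S_{t-s} u₀ + ∫_s^t S_{t-r} F_r dr`, where `S_t = e^{t(Δ-m)}` acts diagonally on Fourier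
coefficients. -/
def IsMild (s : ℝ) (u₀ : TDist) (F : ℝ → TDist) (w : ℝ → Torus L → ℝ) : Prop :=
  ∀ t, s < t → ∀ k : Freq,
    IntervalIntegrable (fun r => F r k) volume s t ∧
    fcoefR L (w t) k = (Real.exp (-(t - s) * (m + freqSq L k)) : ℂ) * u₀ k +
      ∫ r in s..t, (Real.exp (-(t - r) * (m + freqSq L k)) : ℂ) * F r k

/-- `v` solves `(∂_t - Δ + m) v = -v³ - 3v²·one - 3v·two - three + 3c_{t-s,∞}(one + v)` for `t > s`,
with `v|_{t=s} = u₀`. -/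
structure IsRemainder (s : ℝ) (one two three : ℝ → TDist) (u₀ : TDist)
    (v : ℝ → Torus L → ℝ) : Prop where
  inClass : InClass L β γ s v
  mild : IsMild L m s u₀
    (fun r => - fcoefR L (fun x => v r x ^ 3) - (3 : ℂ) • mulDist L (one r) (fun x => v r x ^ 2)
      - (3 : ℂ) • mulDist L (two r) (v r) - three r
      + (3 * cInf L m (r - s) : ℂ) • (one r + fcoefR L (v r))) v

/-- `u_s`: equal to `f` for `s = 0`, and to `one_{0,s} + v_{0,s}` for `s > 0`. -/
def uAt (one : ℝ → ℝ → TDist) (f : TDist) (v : ℝ → ℝ → Torus L → ℝ) (s : ℝ) : TDist :=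
  if s = 0 then f else one 0 s + fcoefR L (v 0 s)

/-- `J` solves `(∂_t - Δ + m) J = -3(v² + 2v·one + two) J + 3c_{t-s,∞} J` for `t > s`, with
`J|_{t=s} = h`. -/
structure IsLinearized (s : ℝ) (one two : ℝ → TDist) (v : ℝ → Torus L → ℝ)
    (h : Torus L → ℝ) (J : ℝ → Torus L → ℝ) : Prop where
  inClass : InClass L β γ s J
  initial : J s = h
  mild : IsMild L m s (fcoefR L h)
    (fun r => - (3 : ℂ) • (fcoefR L (fun x => v r x ^ 2 * J r x)
        + mulDist L (one r) (fun x => 2 * v r x * J r x) + mulDist L (two r) (J r))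
      + (3 * cInf L m (r - s) : ℂ) • fcoefR L (J r)) J

/-- The error term `g`, at one time, in terms of `one`, `two`, `v` at that time and the value `cc` of
the renormalization constant. -/
def errorTerm (c α : ℝ) (one two : TDist) (v : Torus L → ℝ) (cc : ℝ) : ℝ :=
  c * ((besov L (-α) one).toReal ^ (2 : ℝ)
    + (besov L (-α) one).toReal ^ (2 / (1 + α)) * supGrad v ^ (2 * α / (1 + α))
    + (besov L (-α) one).toReal ^ (2 / (1 - α))
    + (besov L (-α) two).toReal + (besov L (-α) two).toReal ^ (2 / (2 - α)) + cc)

end Equations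

/-- The weight `exp(-2m(t-r) + 2 ∫_r^t g)`. -/
def expWeight (m : ℝ) (g : ℝ → ℝ) (r t : ℝ) : ℝ :=
  Real.exp (-2 * m * (t - r) + 2 * ∫ r' in r..t, g r')

end Phi42

end

open Phi42

/-! The bound is an energy estimate for the linearized equation, carried out path by path. Let X, Y,
Z be the L² norms of ∇J, J and vJ, let G = ‖∇v‖_∞, and let cc be the renormalization constant.
Testing the equation with J gives formally d/dt Y² = -2X² - 2mY² - 6Z² - 12⟨one, vJ²⟩ - 6⟨two, J²⟩ +
6 cc Y². The term -6Z², due to the sign of the cubic nonlinearity, is a second dissipation beside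
-2X². The two pairings are controlled by the interpolated duality |⟨u, W⟩| ≤ C ‖u‖_{-α} (‖W‖_1 +
‖W‖_1^{1-α} ‖∇W‖_1^α) of `exists_pairing_le`. By Cauchy-Schwarz, ‖vJ²‖_1 ≤ ZY, ‖∇(vJ²)‖_1 ≤ GY² +
2ZX, ‖J²‖_1 = Y² and ‖∇(J²)‖_1 ≤ 2YX. Young's inequality (`exists_absorption`) then spends X² + 5Z²
of the dissipation and leaves a multiple of Y²; the powers in `errorTerm` are the ones it produces.
So `exists_reaction_le` gives d/dt Y² ≤ -X² - Z² - 2mY² + 2gY², and an integrating factor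
(`IsPrimitive.gronwall`) concludes.

The constant must not depend on the torus. Fourier multipliers are therefore realized by integrable
kernels on the plane acting through translations (`conv`): their L^∞ bounds are L¹ norms on the
plane, invariant under dilation and blind to L.

The rest justifies the formal identity. Schauder estimates for mild solutions (`IsMild.blockBound`)
show that v and J become C¹ at once, that ∇v blows up at most like (r-s)^{-1}, and that ∇J blows up
like (r-s)^{-q} with q < 1/2, while J stays bounded in a Hölder space down to time s
(`exists_regularity`). Hence every term is integrable in time; in particular G^{2α/(1+α)} is,
because 2α/(1+α) < 1. The energy balance itself (`IsLinearized.isPrimitive_l2Sq`) is proved mode by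
mode: each |Ĵ_k|² is absolutely continuous by Duhamel's formula, and the frequency-truncated sums
pass to the limit by dominated convergence. -/

noncomputable section

namespace Phi42

open scoped FourierTransform RealInnerProductSpace

/-- The Euclidean plane, the universal cover of the torus. -/
abbrev Pln : Type := EuclideanSpace ℝ (Fin 2)

/-! ### Characters, wave vectors and integration on the torus. -/

section Characters

variable (L : ℝ)

/-- The wave vector `2πk/L`. -/
def fvec (k : Freq) : Pln := WithLp.toLp 2 (fun i => 2 * Real.pi * (k i : ℝ) / L)

/-- The covering map from the plane to the torus. -/
def proj (y : Pln) : Torus L := fun i => (y i : AddCircle L)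

lemma fvec_apply (k : Freq) (i : Fin 2) : fvec L k i = 2 * Real.pi * (k i : ℝ) / L := rfl

lemma freqSq_eq (k : Freq) : freqSq L k = ‖fvec L k‖ ^ 2 := by
  rw [EuclideanSpace.norm_sq_eq]
  simp only [freqSq, fvec_apply, Real.norm_eq_abs, sq_abs]

lemma sqrt_freqSq (k : Freq) : Real.sqrt (freqSq L k) = ‖fvec L k‖ := by
  rw [freqSq_eq, Real.sqrt_sq (norm_nonneg _)]

lemma freqSq_nonneg (k : Freq) : 0 ≤ freqSq L k := by
  rw [freqSq_eq]; positivity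

@[simp] lemma proj_add (y z : Pln) : proj L (y + z) = proj L y + proj L z := by
  ext i; simp [proj]

@[simp] lemma proj_zero : proj L 0 = 0 := by
  ext i; simp [proj]

@[simp] lemma proj_neg (y : Pln) : proj L (-y) = -proj L y := by
  ext i; simp [proj]

lemma continuous_proj : Continuous (proj L) := by
  refine continuous_pi fun i => ?_
  exact (AddCircle.continuous_mk' L).comp (by fun_prop)

lemma continuous_torusChar (k : Freq) : Continuous (torusChar L k) := by
  unfold torusChar
  refine continuous_finsetProd _ fun i _ => ?_
  exact (fourier (k i)).continuous.comp (continuous_apply i)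

@[simp] lemma norm_torusChar (k : Freq) (x : Torus L) : ‖torusChar L k x‖ = 1 := by
  rw [torusChar, norm_prod]
  exact Finset.prod_eq_one fun i _ => Circle.norm_coe _

lemma torusChar_add_apply (k : Freq) (x y : Torus L) :
    torusChar L k (x + y) = torusChar L k x * torusChar L k y := by
  simp only [torusChar, ← Finset.prod_mul_distrib, Pi.add_apply]
  refine Finset.prod_congr rfl fun i _ => ?_
  simp [fourier_apply, smul_add, AddCircle.toCircle_add]

lemma torusChar_add (j k : Freq) (x : Torus L) :
    torusChar L (j + k) x = torusChar L j x * torusChar L k x := by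
  simp only [torusChar, ← Finset.prod_mul_distrib, Pi.add_apply, fourier_add]

lemma torusChar_neg (k : Freq) (x : Torus L) :
    torusChar L (-k) x = (starRingEnd ℂ) (torusChar L k x) := by
  simp only [torusChar, map_prod, Pi.neg_apply, fourier_neg]

@[simp] lemma torusChar_zero (x : Torus L) : torusChar L 0 x = 1 := by
  simp [torusChar]

lemma torusChar_proj (k : Freq) (y : Pln) :
    torusChar L k (proj L y) = Complex.exp (Complex.I * (⟪y, fvec L k⟫ : ℝ)) := by
  simp only [torusChar, proj, fourier_coe_apply, PiLp.inner_apply, fvec_apply]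
  rw [← Complex.exp_sum]
  congr 1
  simp only [Fin.sum_univ_two, RCLike.inner_apply, conj_trivial]
  push_cast
  ring

lemma torusChar_shift (k : Freq) (x : Torus L) (y : Pln) :
    torusChar L k (x + proj L y)
      = torusChar L k x * Complex.exp (Complex.I * (⟪y, fvec L k⟫ : ℝ)) := by
  rw [torusChar_add_apply, torusChar_proj]

lemma isOpenQuotientMap_proj :
    IsOpenQuotientMap (fun y : Fin 2 → ℝ => (fun i => (y i : AddCircle L) : Torus L)) :=
  IsOpenQuotientMap.piMap (f := fun (_ : Fin 2) (t : ℝ) => (t : AddCircle L))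
    fun _ => QuotientAddGroup.isOpenQuotientMap_mk

lemma proj_surjective : Function.Surjective (proj L) := by
  intro x
  obtain ⟨y, hy⟩ := (isOpenQuotientMap_proj L).surjective x
  exact ⟨WithLp.toLp 2 y, hy⟩

/-- Functions on the torus are continuous as soon as their lifts are. -/
lemma continuous_of_comp_proj {X : Type*} [TopologicalSpace X] {w : Torus L → X}
    (h : Continuous fun y : Pln => w (proj L y)) : Continuous w := by
  refine (isOpenQuotientMap_proj L).continuous_comp_iff.1 ?_
  exact h.comp (PiLp.continuous_toLp 2 _)

variable [hL : Fact (0 < L)]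

lemma fvec_eq_zero {k : Freq} (h : fvec L k = 0) : k = 0 := by
  ext i
  have h1 : fvec L k i = 0 := by rw [h]; rfl
  have hL' := hL.out.ne'
  rw [fvec_apply, div_eq_zero_iff] at h1
  rcases h1 with h1 | h1
  · have := Real.pi_ne_zero
    simpa [this] using h1
  · exact absurd h1 hL'

lemma finite_norm_fvec_le (R : ℝ) : {k : Freq | ‖fvec L k‖ ≤ R}.Finite := by
  have hLp := hL.out
  obtain ⟨N, hN⟩ := exists_nat_ge (R * L)
  refine (Set.finite_Icc (fun _ : Fin 2 => -(N : ℤ)) (fun _ => (N : ℤ))).subset ?_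
  intro k hk
  have key : ∀ i, |(k i : ℝ)| ≤ N := by
    intro i
    have h1 : |fvec L k i| ≤ R := by
      have := PiLp.norm_apply_le (fvec L k) i
      simpa using this.trans hk
    rw [fvec_apply, abs_div, abs_of_pos hLp, div_le_iff₀ hLp, abs_mul] at h1
    have h3 : (1 : ℝ) ≤ |2 * Real.pi| := by
      rw [abs_of_pos (by positivity)]; linarith [Real.pi_gt_three]
    nlinarith [abs_nonneg (k i : ℝ)]
  constructor
  · intro i
    have := (abs_le.1 (key i)).1
    show -(N : ℤ) ≤ k i
    exact_mod_cast this
  · intro i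
    have := (abs_le.1 (key i)).2
    show k i ≤ (N : ℤ)
    exact_mod_cast this

lemma volume_torus : (volume : Measure (Torus L)).real Set.univ = L ^ 2 := by
  rw [measureReal_def, volume_pi, Measure.pi_univ]
  simp [AddCircle.measure_univ, ENNReal.toReal_ofReal hL.out.le]

lemma integrable_of_cont {E : Type*} [NormedAddCommGroup E] {f : Torus L → E}
    (hf : Continuous f) : Integrable f :=
  hf.integrable_of_hasCompactSupport (HasCompactSupport.of_compactSpace f)

lemma integral_shift {E : Type*} [NormedAddCommGroup E] [NormedSpace ℝ E] (f : Torus L → E)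
    (y : Torus L) : ∫ x, f (x + y) = ∫ x, f x :=
  integral_add_right_eq_self f y

/-- For k ≠ 0 a translation by half a wavelength along the wave vector multiplies the character by
exp(iπ) = -1, while the integral is translation invariant. -/
lemma integral_torusChar (k : Freq) :
    ∫ x, torusChar L k x = if k = 0 then ((L ^ 2 : ℝ) : ℂ) else 0 := by
  split_ifs with h
  · subst h
    simp [volume_torus]
  · have h0 : fvec L k ≠ 0 := fun h' => h (fvec_eq_zero L h')
    have h1 : 0 < ‖fvec L k‖ ^ 2 := by positivity
    set y : Pln := (Real.pi / ‖fvec L k‖ ^ 2) • fvec L k with hy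
    have h2 : (⟪y, fvec L k⟫ : ℝ) = Real.pi := by
      rw [hy, real_inner_smul_left, real_inner_self_eq_norm_sq]
      field_simp
    have h3 := integral_shift L (torusChar L k) (proj L y)
    simp only [torusChar_shift, h2] at h3
    rw [integral_mul_const, mul_comm Complex.I, Complex.exp_pi_mul_I] at h3
    have h4 : (2 : ℂ) * ∫ x, torusChar L k x = 0 := by linear_combination -h3
    simpa using h4

lemma fcoef_torusChar (j k : Freq) :
    fcoef L (torusChar L j) k = if j = k then 1 else 0 := by
  have hL' : (L : ℂ) ≠ 0 := by exact_mod_cast hL.out.ne'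
  simp only [fcoef, ← torusChar_neg, ← torusChar_add, integral_torusChar]
  by_cases h : j = k
  · simp [h, hL']
  · have : j + -k ≠ 0 := by rwa [← sub_eq_add_neg, sub_ne_zero]
    simp [h, this]

/-- Trigonometric polynomials are dense in the continuous functions on the torus. -/
lemma span_torusChar_closure_eq_top :
    (Submodule.span ℂ (Set.range fun k : Freq =>
      (⟨torusChar L k, continuous_torusChar L k⟩ : C(Torus L, ℂ)))).topologicalClosure = ⊤ := by
  set e : Freq → C(Torus L, ℂ) := fun k => ⟨torusChar L k, continuous_torusChar L k⟩ with he
  let S : StarSubalgebra ℂ C(Torus L, ℂ) :=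
    { Algebra.adjoin ℂ (Set.range e) with
      star_mem' := by
        show Algebra.adjoin ℂ (Set.range e) ≤ star (Algebra.adjoin ℂ (Set.range e))
        refine Algebra.adjoin_le ?_
        rintro - ⟨n, rfl⟩
        refine Algebra.subset_adjoin ⟨-n, ?_⟩
        ext x
        simp [he, torusChar_neg] }
  have hspan : S.toSubalgebra.toSubmodule = Submodule.span ℂ (Set.range e) := by
    apply Algebra.adjoin_eq_span_of_subset
    refine .trans (fun x => Submonoid.closure_induction (fun _ => id) ⟨0, ?_⟩ ?_)
      Submodule.subset_span
    · ext z
      simp [he]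
    · rintro _ _ _ _ ⟨m, rfl⟩ ⟨n, rfl⟩
      refine ⟨m + n, ?_⟩
      ext z
      simp [he, torusChar_add]
  -- Stone-Weierstrass: points differing in coordinate i are separated by the lowest character in
  -- that coordinate, since `AddCircle.toCircle` is injective.
  have hsep : S.SeparatesPoints := by
    intro x y hxy
    rw [Ne, funext_iff, not_forall] at hxy
    obtain ⟨i, hi⟩ := hxy
    refine ⟨_, ⟨e (Pi.single i 1), Algebra.subset_adjoin ⟨Pi.single i 1, rfl⟩, rfl⟩, ?_⟩
    have hs : ∀ z : Torus L, torusChar L (Pi.single i 1) z = fourier 1 (z i) := by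
      intro z
      rw [torusChar, Finset.prod_eq_single i]
      · simp
      · intro j _ hj
        simp [Pi.single_eq_of_ne hj]
      · simp
    show torusChar L _ x ≠ torusChar L _ y
    rw [hs, hs, fourier_one, fourier_one]
    contrapose! hi
    replace hi := Circle.ext hi
    exact AddCircle.injective_toCircle hL.out.ne' hi
  rw [← hspan]
  exact congr_arg (Subalgebra.toSubmodule <| StarSubalgebra.toSubalgebra ·)
    (ContinuousMap.starSubalgebra_topologicalClosure_eq_top_of_separatesPoints _ hsep)

end Characters

end Phi42

end

/-! ### Integrable convolution kernels of Fourier multipliers on the plane. -/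

noncomputable section

namespace Phi42

open scoped FourierTransform RealInnerProductSpace ContDiff

/-- `κ` is the integrable convolution kernel of the Fourier multiplier `ψ` on the plane. -/
structure IsKernel (ψ κ : Pln → ℂ) : Prop where
  int : Integrable κ
  eq : ∀ ξ, ∫ y, κ y * Complex.exp (Complex.I * (⟪y, ξ⟫ : ℝ)) = ψ ξ

lemma IsKernel.const_mul {ψ κ : Pln → ℂ} (h : IsKernel ψ κ) (c : ℂ) :
    IsKernel (fun ξ => c * ψ ξ) (fun y => c * κ y) := by
  refine ⟨h.int.const_mul c, fun ξ => ?_⟩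
  simp_rw [mul_assoc]
  rw [integral_const_mul, h.eq]

lemma norm_exp_I_mul (r : ℝ) : ‖Complex.exp (Complex.I * (r : ℂ))‖ = 1 := by
  rw [mul_comm]; exact Complex.norm_exp_ofReal_mul_I r

/-- Smooth compactly supported multipliers have an integrable kernel with a first moment. -/
lemma exists_isKernel {ψ : Pln → ℂ} (hc : HasCompactSupport ψ) (hs : ContDiff ℝ ∞ ψ) :
    ∃ κ, IsKernel ψ κ ∧ Integrable (fun y => ‖y‖ * ‖κ y‖) := by
  have h2 : (2 * Real.pi : ℝ) ≠ 0 := by positivity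
  -- The dilation by 2π reconciles the phase exp(i y·ξ) of `IsKernel` with the phase exp(2πi y·ξ) of
  -- the Fourier transform; the kernel is then the Schwartz function 𝓕 f, by Fourier inversion.
  let f : SchwartzMap Pln ℂ := HasCompactSupport.toSchwartzMap
    (f := fun ζ => ψ ((2 * Real.pi) • ζ)) (hc.comp_smul h2) (hs.comp (contDiff_const_smul _))
  have hf : ∀ ζ, f ζ = ψ ((2 * Real.pi) • ζ) := fun ζ => rfl
  refine ⟨⇑(𝓕 f : SchwartzMap Pln ℂ), ⟨(𝓕 f).integrable, fun ξ => ?_⟩, ?_⟩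
  · have h3 : 𝓕⁻ (𝓕 f) ((2 * Real.pi)⁻¹ • ξ) = ψ ξ := by
      rw [FourierPair.fourierInv_fourier_eq, hf, smul_smul, mul_inv_cancel₀ h2, one_smul]
    rw [SchwartzMap.fourierInv_coe, Real.fourierInv_eq'] at h3
    rw [← h3]
    refine integral_congr_ae (Eventually.of_forall fun y => ?_)
    simp only [real_inner_smul_right, smul_eq_mul]
    rw [mul_comm, mul_comm Complex.I]
    congr 4
    field_simp
  · exact ((𝓕 f).integrable_pow_mul volume 1).congr (Eventually.of_forall fun y => by
      simp only [pow_one])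

/-- Multiplying the kernel by a coordinate differentiates the multiplier. -/
lemma IsKernel.deriv {ψ κ : Pln → ℂ} (h : IsKernel ψ κ)
    (h1 : Integrable (fun y => ‖y‖ * ‖κ y‖)) (e : Pln) {ψ' : Pln → ℂ}
    (hd : ∀ ξ, HasDerivAt (fun t : ℝ => ψ (ξ + t • e)) (ψ' ξ) 0) :
    IsKernel ψ' (fun y => κ y * (Complex.I * (⟪y, e⟫ : ℝ))) := by
  have hm : AEStronglyMeasurable (fun y : Pln => κ y * (Complex.I * (⟪y, e⟫ : ℝ))) :=
    h.int.aestronglyMeasurable.mul (by fun_prop)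
  refine ⟨(h1.mul_const ‖e‖).mono' hm (Eventually.of_forall fun y => ?_), fun ξ => ?_⟩
  · have := abs_real_inner_le_norm y e
    simp only [norm_mul, Complex.norm_I, one_mul, Complex.norm_real, Real.norm_eq_abs]
    nlinarith [norm_nonneg (κ y)]
  · have hexp : ∀ (y : Pln) (t : ℝ), HasDerivAt
        (fun t : ℝ => κ y * Complex.exp (Complex.I * (⟪y, ξ + t • e⟫ : ℝ)))
        (κ y * (Complex.I * (⟪y, e⟫ : ℝ)) * Complex.exp (Complex.I * (⟪y, ξ + t • e⟫ : ℝ))) t := by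
      intro y t
      have h3 : HasDerivAt (fun t : ℝ => (((⟪y, ξ + t • e⟫ : ℝ)) : ℂ)) ((⟪y, e⟫ : ℝ) : ℂ) t := by
        apply HasDerivAt.ofReal_comp
        simp only [inner_add_right, real_inner_smul_right]
        simpa using ((hasDerivAt_id t).mul_const (⟪y, e⟫ : ℝ)).const_add (⟪y, ξ⟫ : ℝ)
      refine (((h3.const_mul Complex.I).cexp).const_mul (κ y)).congr_deriv ?_
      ring
    -- Differentiation under the integral along ξ + te, dominated by the first moment of κ.
    have h4 := hasDerivAt_integral_of_dominated_loc_of_deriv_le (μ := (volume : Measure Pln))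
      (F := fun (t : ℝ) y => κ y * Complex.exp (Complex.I * (⟪y, ξ + t • e⟫ : ℝ)))
      (F' := fun t y => κ y * (Complex.I * (⟪y, e⟫ : ℝ)) *
        Complex.exp (Complex.I * (⟪y, ξ + t • e⟫ : ℝ)))
      (x₀ := 0) (s := Set.univ) (bound := fun y => ‖y‖ * ‖κ y‖ * ‖e‖) univ_mem
      (Eventually.of_forall fun t => h.int.aestronglyMeasurable.mul (by fun_prop))
      (by
        refine h.int.norm.mono' (h.int.aestronglyMeasurable.mul (by fun_prop))
          (Eventually.of_forall fun y => ?_)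
        rw [norm_mul, norm_exp_I_mul, mul_one])
      (hm.mul (by fun_prop))
      (Eventually.of_forall fun y t _ => by
        have := abs_real_inner_le_norm y e
        simp only [norm_mul, norm_exp_I_mul, Complex.norm_I, one_mul, Complex.norm_real,
          Real.norm_eq_abs, mul_one]
        nlinarith [norm_nonneg (κ y)])
      (h1.mul_const ‖e‖)
      (Eventually.of_forall fun y t _ => hexp y t)
    have h5 := h4.2
    simp only [h.eq] at h5
    have h6 := h5.unique (hd ξ)
    simpa using h6

lemma integrable_gaussian (b : ℝ) (hb : 0 < b) :
    Integrable (fun y : Pln => Real.exp (-b * ‖y‖ ^ 2)) := by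
  have h := GaussianFourier.integrable_cexp_neg_mul_sq_norm_add (V := Pln) (b := (b : ℂ))
    (by simpa using hb) 0 0
  refine h.norm.congr (Eventually.of_forall fun y => ?_)
  simp only [Complex.norm_exp]
  congr 1
  norm_cast
  simp

/-- The heat kernel on the plane. -/
lemma exists_isKernel_gaussian :
    ∃ κ, IsKernel (fun ξ => (Real.exp (-‖ξ‖ ^ 2) : ℂ)) κ ∧
      Integrable (fun y => ‖y‖ * ‖κ y‖) := by
  have hi : Integrable (fun y : Pln => (Real.exp (-(1 / 4) * ‖y‖ ^ 2) : ℂ)) :=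
    (integrable_gaussian (1 / 4) (by norm_num)).ofReal
  have hK : IsKernel (fun ξ => ((4 * Real.pi : ℝ) : ℂ) * (Real.exp (-‖ξ‖ ^ 2) : ℂ))
      (fun y => (Real.exp (-(1 / 4) * ‖y‖ ^ 2) : ℂ)) := by
    refine ⟨hi, fun ξ => ?_⟩
    have h := GaussianFourier.integral_cexp_neg_mul_sq_norm_add (V := Pln) (b := (1 / 4 : ℂ))
      (by norm_num) Complex.I ξ
    have hd : (Module.finrank ℝ Pln : ℂ) / 2 = 1 := by simp
    rw [hd, Complex.cpow_one] at h
    have e2 : Complex.exp (Complex.I ^ 2 * (‖ξ‖ : ℂ) ^ 2 / (4 * (1 / 4)))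
        = (Real.exp (-‖ξ‖ ^ 2) : ℂ) := by
      push_cast
      congr 1
      rw [Complex.I_sq]; ring
    rw [e2] at h
    convert h using 1
    · refine integral_congr_ae (Eventually.of_forall fun y => ?_)
      simp only
      rw [Complex.ofReal_exp, ← Complex.exp_add, real_inner_comm]
      congr 1
      push_cast
      ring
    · push_cast; ring
  refine ⟨fun y => ((4 * Real.pi : ℝ) : ℂ)⁻¹ * (Real.exp (-(1 / 4) * ‖y‖ ^ 2) : ℂ), ?_, ?_⟩
  · convert hK.const_mul (((4 * Real.pi : ℝ) : ℂ)⁻¹) using 2 with ξ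
    rw [← mul_assoc, inv_mul_cancel₀, one_mul]
    exact_mod_cast (by positivity : (4 * Real.pi : ℝ) ≠ 0)
  · refine ((integrable_gaussian (1 / 8) (by norm_num)).const_mul
      (2 * ‖((4 * Real.pi : ℝ) : ℂ)⁻¹‖)).mono' (by fun_prop) (Eventually.of_forall fun y => ?_)
    simp only [norm_mul, norm_norm, Complex.norm_real]
    -- Half of the Gaussian decay absorbs the weight ‖y‖; the other half keeps the function
    -- integrable.
    have h1 : ‖y‖ ≤ 2 * Real.exp (1 / 8 * ‖y‖ ^ 2) := by
      nlinarith [Real.add_one_le_exp (1 / 8 * ‖y‖ ^ 2), sq_nonneg (‖y‖ - 2)]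
    have h2 : Real.exp (-(1 / 4) * ‖y‖ ^ 2)
        = Real.exp (-(1 / 8) * ‖y‖ ^ 2) * Real.exp (-(1 / 8) * ‖y‖ ^ 2) := by
      rw [← Real.exp_add]; ring_nf
    have h3 : Real.exp (1 / 8 * ‖y‖ ^ 2) * Real.exp (-(1 / 8) * ‖y‖ ^ 2) = 1 := by
      rw [← Real.exp_add]; simp
    have h4 : ‖y‖ * Real.exp (-(1 / 8) * ‖y‖ ^ 2) ≤ 2 := by
      calc _ ≤ 2 * Real.exp (1 / 8 * ‖y‖ ^ 2) * Real.exp (-(1 / 8) * ‖y‖ ^ 2) := by gcongr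
        _ = 2 := by rw [mul_assoc, h3, mul_one]
    rw [Real.norm_eq_abs (Real.exp _), abs_of_pos (Real.exp_pos _), h2]
    set E := Real.exp (-(1 / 8) * ‖y‖ ^ 2)
    have hE : 0 < E := Real.exp_pos _
    have hN := norm_nonneg ((((4 * Real.pi : ℝ) : ℂ))⁻¹)
    calc _ = (‖y‖ * E) * (‖(((4 * Real.pi : ℝ) : ℂ))⁻¹‖ * E) := by ring
      _ ≤ 2 * (‖(((4 * Real.pi : ℝ) : ℂ))⁻¹‖ * E) := by gcongr
      _ = _ := by ring

/-- Up to the factor -2 this symbol is the j-th derivative of the Gaussian, so `IsKernel.deriv`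
supplies the kernel. It is the factor through which the heat semigroup gains a negative power of the
frequency in `exists_heat_block`. -/
lemma exists_isKernel_coord_gaussian (j : Fin 2) :
    ∃ κ, IsKernel (fun ξ => ((ξ j * Real.exp (-‖ξ‖ ^ 2) : ℝ) : ℂ)) κ := by
  obtain ⟨κ, h, h1⟩ := exists_isKernel_gaussian
  have h2 := h.deriv h1 (EuclideanSpace.single j 1)
    (ψ' := fun ξ => ((-2 * (ξ j * Real.exp (-‖ξ‖ ^ 2)) : ℝ) : ℂ)) (fun ξ => by
      apply HasDerivAt.ofReal_comp
      have h3 : ∀ t : ℝ, ‖ξ + t • EuclideanSpace.single j (1 : ℝ)‖ ^ 2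
          = ‖ξ‖ ^ 2 + 2 * ξ j * t + t ^ 2 := by
        intro t
        rw [norm_add_sq_real, real_inner_smul_right, norm_smul]
        have hj : (⟪ξ, EuclideanSpace.single j (1 : ℝ)⟫ : ℝ) = ξ j := by
          rw [EuclideanSpace.inner_single_right]; simp
        rw [hj, EuclideanSpace.single, PiLp.norm_single]
        simp
        ring
      simp only [h3]
      have h4 : HasDerivAt (fun t : ℝ => -(‖ξ‖ ^ 2 + 2 * ξ j * t + t ^ 2)) (-(2 * ξ j)) 0 := by
        have := (((hasDerivAt_id (0 : ℝ)).const_mul (2 * ξ j)).const_add (‖ξ‖ ^ 2)).add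
          ((hasDerivAt_id (0 : ℝ)).pow 2)
        refine this.neg.congr_deriv ?_
        simp
      refine h4.exp.congr_deriv ?_
      simp
      ring)
  refine ⟨fun y => (-(1 / 2 : ℂ)) * (κ y * (Complex.I * (⟪y, EuclideanSpace.single j 1⟫ : ℝ))), ?_⟩
  convert h2.const_mul (-(1 / 2 : ℂ)) using 2 with ξ
  push_cast
  ring

end Phi42

end

/-! ### Trigonometric polynomials and the action of plane kernels on the torus. -/

noncomputable section

namespace Phi42

open scoped FourierTransform RealInnerProductSpace ContDiff

section TrigPoly

variable (L : ℝ)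

/-- The trigonometric polynomial with coefficients `a`. -/
def tp (a : TDist) (x : Torus L) : ℂ := ∑' k, a k * torusChar L k x

lemma tp_eq_sum {a : TDist} {S : Finset Freq} (h : ∀ k ∉ S, a k = 0) (x : Torus L) :
    tp L a x = ∑ k ∈ S, a k * torusChar L k x :=
  tsum_eq_sum fun k hk => by simp [h k hk]

lemma tp_eq_sum' {a : TDist} (h : a.support.Finite) (x : Torus L) :
    tp L a x = ∑ k ∈ h.toFinset, a k * torusChar L k x :=
  tp_eq_sum L (fun k hk => by simpa using hk) x

lemma continuous_tp {a : TDist} (h : a.support.Finite) : Continuous (tp L a) := by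
  have : tp L a = fun x => ∑ k ∈ h.toFinset, a k * torusChar L k x :=
    funext (tp_eq_sum' L h)
  rw [this]
  exact continuous_finsetSum _ fun k _ => continuous_const.mul (continuous_torusChar L k)

lemma support_mul_finite {a : TDist} (c : TDist) (ha : a.support.Finite) :
    (fun k => c k * a k).support.Finite := by
  refine ha.subset fun k hk => ?_
  simp only [Function.mem_support, ne_eq, mul_eq_zero, not_or] at hk ⊢
  exact hk.2

lemma tp_add {a b : TDist} (ha : a.support.Finite) (hb : b.support.Finite) (x : Torus L) :
    tp L (a + b) x = tp L a x + tp L b x := by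
  classical
  have h1 : ∀ k ∉ ha.toFinset ∪ hb.toFinset, a k = 0 := fun k hk => by
    simp at hk; exact hk.1
  have h2 : ∀ k ∉ ha.toFinset ∪ hb.toFinset, b k = 0 := fun k hk => by
    simp at hk; exact hk.2
  rw [tp_eq_sum L h1, tp_eq_sum L h2, tp_eq_sum L (a := a + b) (S := ha.toFinset ∪ hb.toFinset)
    (fun k hk => by simp [h1 k hk, h2 k hk]), ← Finset.sum_add_distrib]
  exact Finset.sum_congr rfl fun k _ => by simp [add_mul]

lemma tp_smul (c : ℂ) (a : TDist) (x : Torus L) : tp L (c • a) x = c * tp L a x := by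
  simp only [tp, Pi.smul_apply, smul_eq_mul, mul_assoc, tsum_mul_left]

end TrigPoly

section Conv

variable (L : ℝ)

/-- Convolution of a function on the torus with the kernel `κ` rescaled by `ε`. -/
def conv (κ : Pln → ℂ) (ε : ℝ) (W : Torus L → ℂ) (x : Torus L) : ℂ :=
  ∫ y, κ y * W (x + proj L (ε • y))

variable {L} {κ ψ : Pln → ℂ} {W V : Torus L → ℂ}

lemma exists_norm_bound [Fact (0 < L)] {E : Type*} [NormedAddCommGroup E] {W : Torus L → E}
    (hW : Continuous W) :
    ∃ M, 0 ≤ M ∧ ∀ x, ‖W x‖ ≤ M := by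
  obtain ⟨M, hM⟩ := (isCompact_range hW.norm).bddAbove
  exact ⟨max M 0, le_max_right _ _, fun x => (hM ⟨x, rfl⟩).trans (le_max_left _ _)⟩

lemma continuous_shift (ε : ℝ) (x : Torus L) :
    Continuous fun y : Pln => x + proj L (ε • y) :=
  continuous_const.add ((continuous_proj L).comp (continuous_const_smul ε))

lemma integrable_conv (hκ : Integrable κ) (hW : Continuous W) {M : ℝ} (hM : ∀ x, ‖W x‖ ≤ M)
    (ε : ℝ) (x : Torus L) : Integrable fun y => κ y * W (x + proj L (ε • y)) :=
  hκ.mul_bdd (c := M) (hW.comp (continuous_shift ε x)).aestronglyMeasurable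
    (Eventually.of_forall fun _ => hM _)

lemma norm_conv_le (hκ : Integrable κ) {M : ℝ} (hM : ∀ x, ‖W x‖ ≤ M)
    (ε : ℝ) (x : Torus L) : ‖conv L κ ε W x‖ ≤ (∫ y, ‖κ y‖) * M := by
  rw [conv, ← integral_mul_const]
  refine norm_integral_le_of_norm_le (hκ.norm.mul_const M) (Eventually.of_forall fun y => ?_)
  rw [norm_mul]
  exact mul_le_mul_of_nonneg_left (hM _) (norm_nonneg _)

lemma conv_add (hκ : Integrable κ) (hW : Continuous W) {M : ℝ} (hM : ∀ x, ‖W x‖ ≤ M)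
    (hV : Continuous V) {N : ℝ} (hN : ∀ x, ‖V x‖ ≤ N) (ε : ℝ) (x : Torus L) :
    conv L κ ε (fun z => W z + V z) x = conv L κ ε W x + conv L κ ε V x := by
  simp only [conv, mul_add]
  exact integral_add (integrable_conv hκ hW hM ε x) (integrable_conv hκ hV hN ε x)

lemma conv_const_mul (c : ℂ) (ε : ℝ) (x : Torus L) :
    conv L κ ε (fun z => c * W z) x = c * conv L κ ε W x := by
  simp only [conv, mul_left_comm _ c]
  exact integral_const_mul _ _

/-- Translating a character multiplies it by a phase, so the integral against κ is the symbol
evaluated at the dilated wave vector. The plus signs in `conv` and in `IsKernel` match, and no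
periodization of κ is needed. -/
lemma conv_torusChar (h : IsKernel ψ κ) (ε : ℝ) (k : Freq) (x : Torus L) :
    conv L κ ε (torusChar L k) x = ψ (ε • fvec L k) * torusChar L k x := by
  rw [conv, ← h.eq, ← integral_mul_const]
  refine integral_congr_ae (Eventually.of_forall fun y => ?_)
  simp only [torusChar_shift, real_inner_smul_left, real_inner_smul_right]
  ring

lemma conv_tp (h : IsKernel ψ κ) (ε : ℝ) {a : TDist} (ha : a.support.Finite) (x : Torus L) :
    conv L κ ε (tp L a) x = tp L (fun k => ψ (ε • fvec L k) * a k) x := by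
  have h1 : ∀ k ∉ ha.toFinset, a k = 0 := fun k hk => by simpa using hk
  rw [tp_eq_sum L (S := ha.toFinset) (fun k hk => by simp [h1 k hk])]
  have h2 : ∀ k ∈ ha.toFinset, Integrable fun y =>
      κ y * (a k * torusChar L k (x + proj L (ε • y))) := fun k _ =>
    integrable_conv h.int (W := fun z => a k * torusChar L k z) (M := ‖a k‖)
      (continuous_const.mul (continuous_torusChar L k)) (fun z => by simp) ε x
  have h3 : ∀ z, tp L a z = ∑ k ∈ ha.toFinset, a k * torusChar L k z := tp_eq_sum L h1
  simp only [conv, h3, Finset.mul_sum]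
  rw [integral_finsetSum _ h2]
  refine Finset.sum_congr rfl fun k _ => ?_
  have := conv_const_mul (L := L) (κ := κ) (W := torusChar L k) (a k) ε x
  rw [conv_torusChar h] at this
  simp only [conv] at this
  rw [this]
  ring

/-- A multiplier which equals `1` on the support of `a` acts as the identity. -/
lemma conv_tp_of_eq_one (h : IsKernel ψ κ) {ε : ℝ} {a : TDist} (ha : a.support.Finite)
    (h1 : ∀ k, a k ≠ 0 → ψ (ε • fvec L k) = 1) (x : Torus L) :
    conv L κ ε (tp L a) x = tp L a x := by
  rw [conv_tp h ε ha]
  congr 1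
  ext k
  by_cases hk : a k = 0
  · simp [hk]
  · rw [h1 k hk, one_mul]

/-- The source of every multiplier bound below: the constant is the L¹ norm of the plane kernel,
whatever ε and L. -/
lemma norm_tp_mul_le (h : IsKernel ψ κ) (ε : ℝ) {a : TDist} (ha : a.support.Finite) {M : ℝ}
    (hM : ∀ x, ‖tp L a x‖ ≤ M) (x : Torus L) :
    ‖tp L (fun k => ψ (ε • fvec L k) * a k) x‖ ≤ (∫ y, ‖κ y‖) * M := by
  rw [← conv_tp h ε ha]
  exact norm_conv_le h.int hM ε x

lemma IsKernel.integral_eq (h : IsKernel ψ κ) : ∫ y, κ y = ψ 0 := by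
  rw [← h.eq 0]; simp

end Conv

section ConvDuality

variable {L : ℝ} [hL : Fact (0 < L)] {κ ψ : Pln → ℂ} {W V : Torus L → ℂ}

/-- Convolution can be moved to the other factor. -/
lemma integral_conv_mul (hκ : Integrable κ) (hV : Continuous V) (hW : Continuous W) (ε : ℝ) :
    ∫ x, conv L κ ε V x * W x = ∫ y, κ y * ∫ x, V x * W (x - proj L (ε • y)) := by
  obtain ⟨M, hM0, hM⟩ := exists_norm_bound hV
  obtain ⟨N, hN0, hN⟩ := exists_norm_bound hW
  simp only [conv, ← integral_mul_const]
  rw [integral_integral_swap]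
  · refine integral_congr_ae (Eventually.of_forall fun y => ?_)
    simp only [mul_assoc]
    rw [integral_const_mul]
    congr 1
    rw [← integral_shift L (fun x => V x * W (x - proj L (ε • y))) (proj L (ε • y))]
    simp
  · have h1 : Integrable (fun p : Torus L × Pln => κ p.2) (volume.prod volume) :=
      hκ.comp_snd volume
    have h2 : Continuous fun p : Torus L × Pln => V (p.1 + proj L (ε • p.2)) * W p.1 :=
      (hV.comp (continuous_fst.add ((continuous_proj L).comp
        (continuous_snd.const_smul ε)))).mul (hW.comp continuous_fst)
    refine (h1.mul_bdd (c := M * N) h2.aestronglyMeasurable (Eventually.of_forall fun p => ?_)).congr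
      (Eventually.of_forall fun p => by simp [Function.uncurry, mul_assoc])
    rw [norm_mul]
    exact mul_le_mul (hM _) (hN _) (norm_nonneg _) hM0

end ConvDuality

section Smoothing

variable {L : ℝ} [hL : Fact (0 < L)] {κ ψ : Pln → ℂ} {W : Torus L → ℂ}

/-- On continuous functions, convolution acts on Fourier coefficients as the multiplier. -/
lemma tp_fcoef_eq_conv (h : IsKernel ψ κ) (ε : ℝ)
    (hfin : (Function.support fun k : Freq => ψ (ε • fvec L k)).Finite)
    (hW : Continuous W) (x : Torus L) :
    tp L (fun k => ψ (ε • fvec L k) * fcoef L W k) x = conv L κ ε W x := by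
  have hint : ∀ (f : C(Torus L, ℂ)) (k : Freq),
      Integrable fun z => f z * (starRingEnd ℂ) (torusChar L k z) := fun f k =>
    integrable_of_cont L (f.continuous.mul (Complex.continuous_conj.comp (continuous_torusChar L k)))
  have hb : ∀ (f : C(Torus L, ℂ)) z, ‖f z‖ ≤ ‖f‖ := fun f z => f.norm_coe_le_norm z
  let A : C(Torus L, ℂ) →ₗ[ℂ] ℂ :=
    { toFun := fun f => conv L κ ε f x
      map_add' := fun f g => conv_add h.int f.continuous (hb f) g.continuous (hb g) ε x
      map_smul' := fun c f => conv_const_mul c ε x }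
  have hA : Continuous A := by
    exact (A.mkContinuous (∫ y, ‖κ y‖) (fun f => norm_conv_le h.int (hb f) ε x)).continuous
  let F (k : Freq) : C(Torus L, ℂ) →ₗ[ℂ] ℂ :=
    { toFun := fun f => fcoef L f k
      map_add' := fun f g => by
        simp only [fcoef, ContinuousMap.add_apply, add_mul]
        rw [integral_add (hint f k) (hint g k), mul_add]
      map_smul' := fun c f => by
        simp only [fcoef, ContinuousMap.smul_apply, smul_eq_mul, mul_assoc, RingHom.id_apply]
        rw [integral_const_mul, mul_left_comm] }
  have hF : ∀ k, Continuous (F k) := fun k => by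
    refine ((F k).mkContinuous 1 (fun f => ?_)).continuous
    show ‖fcoef L f k‖ ≤ 1 * ‖f‖
    have h1 : ‖∫ z, f z * (starRingEnd ℂ) (torusChar L k z)‖ ≤ ‖f‖ * L ^ 2 := by
      rw [← volume_torus L]
      refine norm_integral_le_of_norm_le_const (Eventually.of_forall fun z => ?_)
      simpa using hb f z
    have hLp := hL.out
    rw [fcoef, norm_mul, Complex.norm_real, Real.norm_of_nonneg (by positivity), one_mul]
    calc (L ^ 2)⁻¹ * _ ≤ (L ^ 2)⁻¹ * (‖f‖ * L ^ 2) := by gcongr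
      _ = ‖f‖ := by field_simp
  let B : C(Torus L, ℂ) →ₗ[ℂ] ℂ :=
    ∑ k ∈ hfin.toFinset, (ψ (ε • fvec L k) * torusChar L k x) • F k
  have hBapp : ∀ f : C(Torus L, ℂ), B f = tp L (fun k => ψ (ε • fvec L k) * fcoef L f k) x := by
    intro f
    rw [tp_eq_sum L (S := hfin.toFinset)]
    · simp only [B, LinearMap.sum_apply, LinearMap.smul_apply, smul_eq_mul]
      refine Finset.sum_congr rfl fun k _ => ?_
      show _ * fcoef L f k = _
      ring
    · intro k hk
      have : ψ (ε • fvec L k) = 0 := by simpa using hk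
      simp [this]
  have hB : Continuous B := by
    have : (B : C(Torus L, ℂ) → ℂ) = fun f =>
        ∑ k ∈ hfin.toFinset, (ψ (ε • fvec L k) * torusChar L k x) * F k f := by
      ext f; simp [B]
    rw [this]
    exact continuous_finsetSum _ fun k _ => continuous_const.mul (hF k)
  -- Both sides are continuous linear functionals of W which agree on characters, and these span a
  -- dense subspace.
  have hsub : (LinearMap.eqLocus B A) = ⊤ := by
    have hcl : IsClosed (LinearMap.eqLocus B A : Set C(Torus L, ℂ)) := isClosed_eq hB hA
    rw [eq_top_iff, ← span_torusChar_closure_eq_top L]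
    refine Submodule.topologicalClosure_minimal _ (Submodule.span_le.2 ?_) hcl
    rintro - ⟨j, rfl⟩
    show B _ = A _
    rw [hBapp]
    show tp L (fun k => ψ (ε • fvec L k) * fcoef L (torusChar L j) k) x
      = conv L κ ε (torusChar L j) x
    rw [conv_torusChar h]
    simp only [fcoef_torusChar]
    rw [tp_eq_sum L (S := {j}) (fun k hk => by
      have : j ≠ k := fun e => hk (by simp [e])
      simp [this])]
    simp
  have := (LinearMap.mem_eqLocus.1 (hsub ▸ Submodule.mem_top :
    (⟨W, hW⟩ : C(Torus L, ℂ)) ∈ LinearMap.eqLocus B A))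
  rw [hBapp] at this
  exact this

/-- Convolutions with a concentrating kernel converge pointwise. -/
lemma tendsto_conv (h : Integrable κ) (h1 : ∫ y, κ y = 1) (hW : Continuous W) (x : Torus L)
    {ι : Type*} {l : Filter ι} [l.IsCountablyGenerated] {ε : ι → ℝ} (hε : Tendsto ε l (𝓝 0)) :
    Tendsto (fun i => conv L κ (ε i) W x) l (𝓝 (W x)) := by
  obtain ⟨M, hM0, hM⟩ := exists_norm_bound hW
  have h2 : ∫ y, κ y * W x = W x := by rw [integral_mul_const, h1, one_mul]
  rw [← h2]
  refine tendsto_integral_filter_of_dominated_convergence (fun y => ‖κ y‖ * M)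
    (Eventually.of_forall fun i => (integrable_conv h hW hM (ε i) x).aestronglyMeasurable)
    (Eventually.of_forall fun i => Eventually.of_forall fun y => ?_) (h.norm.mul_const M)
    (Eventually.of_forall fun y => ?_)
  · rw [norm_mul]
    exact mul_le_mul_of_nonneg_left (hM _) (norm_nonneg _)
  · refine tendsto_const_nhds.mul ?_
    have h3 : Tendsto (fun i => x + proj L (ε i • y)) l (𝓝 (x + proj L ((0 : ℝ) • y))) :=
      ((continuous_const.add ((continuous_proj L).comp
        (continuous_id.smul continuous_const))).tendsto (0 : ℝ)).comp hε
    rw [zero_smul, proj_zero, add_zero] at h3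
    exact (hW.tendsto x).comp h3

end Smoothing

end Phi42

end

/-! ### Littlewood-Paley blocks, Bernstein's inequality and heat smoothing. -/

noncomputable section

namespace Phi42

open scoped FourierTransform RealInnerProductSpace ContDiff

section Cutoff

lemma cutoff_eq_one {ρ : ℝ} (h : ρ ≤ 1) : cutoff ρ = 1 :=
  Real.smoothTransition.one_of_one_le (by linarith)

lemma cutoff_eq_zero {ρ : ℝ} (h : 4 / 3 ≤ ρ) : cutoff ρ = 0 :=
  Real.smoothTransition.zero_of_nonpos (by linarith)

lemma lt_of_cutoff_ne_zero {ρ : ℝ} (h : cutoff ρ ≠ 0) : ρ < 4 / 3 := by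
  by_contra! h'
  exact h (cutoff_eq_zero h')

/-- The radial cutoff function on the plane, at scale `c`. -/
def bump (c : ℝ) (ξ : Pln) : ℂ := (cutoff (c * ‖ξ‖) : ℂ)

/-- The norm is smooth away from the origin, and near the origin the cutoff is identically 1. -/
lemma contDiff_bump (c : ℝ) : ContDiff ℝ ∞ (bump c) := by
  rw [contDiff_iff_contDiffAt]
  intro ξ
  by_cases h : ξ = 0
  · subst h
    have hev : bump c =ᶠ[𝓝 0] fun _ => 1 := by
      have : Tendsto (fun ξ : Pln => c * ‖ξ‖) (𝓝 0) (𝓝 0) := by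
        have := (by fun_prop : Continuous fun ξ : Pln => c * ‖ξ‖).tendsto 0
        simpa only [norm_zero, mul_zero] using this
      filter_upwards [this.eventually (gt_mem_nhds zero_lt_one)] with ξ hξ
      simp [bump, cutoff_eq_one hξ.le]
    exact contDiffAt_const.congr_of_eventuallyEq hev
  · have h1 : ContDiffAt ℝ ∞ (fun ξ : Pln => 4 - 3 * (c * ‖ξ‖)) ξ :=
      contDiffAt_const.sub (contDiffAt_const.mul (contDiffAt_const.mul (contDiffAt_norm ℝ h)))
    have h2 : ContDiffAt ℝ ∞ (fun ξ : Pln => cutoff (c * ‖ξ‖)) ξ :=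
      (Real.smoothTransition.contDiff (n := (⊤ : ℕ∞))).contDiffAt.comp ξ h1
    exact Complex.ofRealCLM.contDiff.contDiffAt.comp ξ h2

lemma hasCompactSupport_bump {c : ℝ} (hc : 0 < c) : HasCompactSupport (bump c) := by
  refine HasCompactSupport.intro (isCompact_closedBall (0 : Pln) (4 / 3 / c)) fun ξ hξ => ?_
  rw [mem_closedBall_zero_iff, not_le, div_lt_iff₀ hc] at hξ
  simp [bump, cutoff_eq_zero (by linarith : 4 / 3 ≤ c * ‖ξ‖)]

/-- The annular cutoff. -/
def annulus (c d : ℝ) (ξ : Pln) : ℂ := bump c ξ - bump d ξ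

lemma contDiff_annulus (c d : ℝ) : ContDiff ℝ ∞ (annulus c d) :=
  (contDiff_bump c).sub (contDiff_bump d)

lemma hasCompactSupport_annulus {c d : ℝ} (hc : 0 < c) (hd : 0 < d) :
    HasCompactSupport (annulus c d) :=
  (hasCompactSupport_bump hc).sub (hasCompactSupport_bump hd)

lemma annulus_zero (c d : ℝ) : annulus c d 0 = 0 := by
  simp [annulus, bump]

/-- The inverse Laplacian of a first derivative, localized to an annulus, has a smooth compactly
supported symbol. -/
lemma contDiff_annulus_mul_inv (j : Fin 2) :
    ContDiff ℝ ∞ fun ξ : Pln => annulus (1 / 2) 4 ξ * ((ξ j / ‖ξ‖ ^ 2 : ℝ) : ℂ) := by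
  rw [contDiff_iff_contDiffAt]
  intro ξ
  by_cases h : ξ = 0
  · subst h
    have hev : (fun ξ : Pln => annulus (1 / 2) 4 ξ * ((ξ j / ‖ξ‖ ^ 2 : ℝ) : ℂ)) =ᶠ[𝓝 0]
        fun _ => 0 := by
      -- On |ξ| < 1/4 both cutoffs equal 1 and the annular symbol vanishes, which removes the
      -- singularity of ξ_j/|ξ|².
      filter_upwards [Metric.ball_mem_nhds (0 : Pln) (by norm_num : (0 : ℝ) < 1 / 4)] with ξ hξ
      rw [mem_ball_zero_iff] at hξ
      simp [annulus, bump, cutoff_eq_one (by linarith : 4 * ‖ξ‖ ≤ 1),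
        cutoff_eq_one (by linarith : 2⁻¹ * ‖ξ‖ ≤ 1)]
    exact contDiffAt_const.congr_of_eventuallyEq hev
  · refine (contDiff_annulus _ _).contDiffAt.mul ?_
    refine Complex.ofRealCLM.contDiff.contDiffAt.comp ξ ?_
    refine ContDiffAt.div ?_ (contDiff_norm_sq ℝ).contDiffAt (by positivity)
    exact (EuclideanSpace.proj (𝕜 := ℝ) j).contDiff.contDiffAt

lemma contDiff_coord_mul_bump (c : ℝ) (j : Fin 2) :
    ContDiff ℝ ∞ fun ξ : Pln => (ξ j : ℂ) * bump c ξ := by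
  refine ContDiff.mul ?_ (contDiff_bump c)
  exact Complex.ofRealCLM.contDiff.comp (EuclideanSpace.proj (𝕜 := ℝ) j).contDiff

end Cutoff

section Blocks

variable (L : ℝ)

/-- The Littlewood-Paley multipliers. -/
def lpMul : ℕ → Freq → ℝ
  | 0, k => cutoff ‖fvec L k‖
  | n + 1, k => cutoff ((2 : ℝ)⁻¹ ^ (n + 1) * ‖fvec L k‖) - cutoff ((2 : ℝ)⁻¹ ^ n * ‖fvec L k‖)

lemma mollify_eq_tp (δ : ℝ) (u : TDist) (x : Torus L) :
    mollify L δ u x = tp L (fun k => (cutoff (δ * ‖fvec L k‖) : ℂ) * u k) x := by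
  simp only [mollify, tp, sqrt_freqSq]

lemma sum_lpMul (N : ℕ) (k : Freq) :
    ∑ n ∈ Finset.range (N + 1), lpMul L n k = cutoff ((2 : ℝ)⁻¹ ^ N * ‖fvec L k‖) := by
  induction N with
  | zero => simp [lpMul]
  | succ N ih => rw [Finset.sum_range_succ, ih, lpMul]; ring

lemma lpMul_ne_zero_le {n : ℕ} {k : Freq} (h : lpMul L n k ≠ 0) :
    (2 : ℝ)⁻¹ ^ n * ‖fvec L k‖ ≤ 4 / 3 := by
  cases n with
  | zero =>
    have := lt_of_cutoff_ne_zero (ρ := ‖fvec L k‖) h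
    simpa using this.le
  | succ n =>
    by_contra! h'
    apply h
    have h2 : (2 : ℝ)⁻¹ ^ (n + 1) * ‖fvec L k‖ = 2⁻¹ * ((2 : ℝ)⁻¹ ^ n * ‖fvec L k‖) := by
      rw [pow_succ]; ring
    rw [lpMul, cutoff_eq_zero h'.le, cutoff_eq_zero (by linarith), sub_zero]

/-- Below this frequency the two cutoffs of the difference both equal 1 and cancel. Block 0 is a
single cutoff and has no such lower bound, hence `n ≠ 0`; every gain from high frequency below
carries the same restriction. -/
lemma lpMul_ne_zero_ge {n : ℕ} {k : Freq} (hn : n ≠ 0) (h : lpMul L n k ≠ 0) :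
    1 / 2 ≤ (2 : ℝ)⁻¹ ^ n * ‖fvec L k‖ := by
  obtain ⟨n, rfl⟩ := Nat.exists_eq_succ_of_ne_zero hn
  by_contra! h'
  apply h
  have h2 : (2 : ℝ)⁻¹ ^ (n + 1) * ‖fvec L k‖ = 2⁻¹ * ((2 : ℝ)⁻¹ ^ n * ‖fvec L k‖) := by
    rw [pow_succ]; ring
  rw [Nat.succ_eq_add_one] at h'
  rw [Nat.succ_eq_add_one, lpMul, cutoff_eq_one (by linarith), cutoff_eq_one (by linarith), sub_self]

/-- The coefficients `a` are finitely many and live in the `n`-th dyadic annulus. -/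
structure AnnSupp (n : ℕ) (a : TDist) : Prop where
  fin : a.support.Finite
  le : ∀ k, a k ≠ 0 → (2 : ℝ)⁻¹ ^ n * ‖fvec L k‖ ≤ 4 / 3
  ge : n ≠ 0 → ∀ k, a k ≠ 0 → 1 / 2 ≤ (2 : ℝ)⁻¹ ^ n * ‖fvec L k‖

lemma sum_lpBlock (N : ℕ) (u : TDist) (x : Torus L) :
    ∑ n ∈ Finset.range (N + 1), lpBlock L n u x = mollify L ((2 : ℝ)⁻¹ ^ N) u x := by
  induction N with
  | zero => simp [lpBlock]
  | succ N ih => rw [Finset.sum_range_succ, ih, lpBlock]; ring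

lemma bump_smul_fvec (c : ℝ) {ε : ℝ} (hε : 0 ≤ ε) (k : Freq) :
    bump c (ε • fvec L k) = (cutoff (c * (ε * ‖fvec L k‖)) : ℂ) := by
  rw [bump, norm_smul, Real.norm_of_nonneg hε]

variable {L}

lemma AnnSupp.mul {n : ℕ} {a : TDist} (h : AnnSupp L n a) (c : TDist) :
    AnnSupp L n (fun k => c k * a k) :=
  ⟨support_mul_finite c h.fin, fun k hk => h.le k (right_ne_zero_of_mul hk),
    fun hn k hk => h.ge hn k (right_ne_zero_of_mul hk)⟩

variable (L) [hL : Fact (0 < L)]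

lemma finite_cutoff {δ : ℝ} (hδ : 0 < δ) (u : TDist) :
    (Function.support fun k => (cutoff (δ * ‖fvec L k‖) : ℂ) * u k).Finite := by
  refine (finite_norm_fvec_le L (4 / 3 / δ)).subset fun k hk => ?_
  have h1 : cutoff (δ * ‖fvec L k‖) ≠ 0 := by
    intro h
    simp [h] at hk
  have := lt_of_cutoff_ne_zero h1
  rw [Set.mem_ofPred_eq, le_div_iff₀ hδ]
  linarith

lemma annSupp_lpMul (n : ℕ) (u : TDist) : AnnSupp L n (fun k => (lpMul L n k : ℂ) * u k) := by
  have h0 : ∀ k, (lpMul L n k : ℂ) * u k ≠ 0 → lpMul L n k ≠ 0 := fun k hk h => by simp [h] at hk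
  refine ⟨?_, fun k hk => lpMul_ne_zero_le L (h0 k hk), fun hn k hk => lpMul_ne_zero_ge L hn (h0 k hk)⟩
  refine (finite_norm_fvec_le L (4 / 3 / 2⁻¹ ^ n)).subset fun k hk => ?_
  have h1 := lpMul_ne_zero_le L (h0 k hk)
  rw [Set.mem_ofPred_eq, le_div_iff₀ (by positivity)]
  linarith

lemma lpBlock_eq_tp (n : ℕ) (u : TDist) (x : Torus L) :
    lpBlock L n u x = tp L (fun k => (lpMul L n k : ℂ) * u k) x := by
  cases n with
  | zero => simp [lpBlock, mollify_eq_tp, lpMul]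
  | succ n =>
    rw [lpBlock, mollify_eq_tp, mollify_eq_tp, sub_eq_iff_eq_add, ← tp_add]
    · congr 1
      ext k
      simp only [Pi.add_apply, lpMul]
      push_cast
      ring
    · exact (annSupp_lpMul L (n + 1) u).fin
    · exact finite_cutoff L (by positivity) u

lemma continuous_lpBlock (n : ℕ) (u : TDist) : Continuous (lpBlock L n u) := by
  rw [funext (lpBlock_eq_tp L n u)]
  exact continuous_tp L (annSupp_lpMul L n u).fin

lemma continuous_mollify {δ : ℝ} (hδ : 0 < δ) (u : TDist) : Continuous (mollify L δ u) := by
  rw [funext (mollify_eq_tp L δ u)]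
  exact continuous_tp L (finite_cutoff L hδ u)

lemma lpBlock_add (n : ℕ) (u v : TDist) (x : Torus L) :
    lpBlock L n (u + v) x = lpBlock L n u x + lpBlock L n v x := by
  simp only [lpBlock_eq_tp]
  rw [← tp_add _ (annSupp_lpMul L n u).fin (annSupp_lpMul L n v).fin]
  congr 1
  ext k
  simp [mul_add]

lemma lpBlock_smul (n : ℕ) (c : ℂ) (u : TDist) (x : Torus L) :
    lpBlock L n (c • u) x = c * lpBlock L n u x := by
  simp only [lpBlock_eq_tp]
  rw [← tp_smul]
  congr 1
  ext k
  simp [mul_left_comm]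

lemma lpBlock_neg (n : ℕ) (u : TDist) (x : Torus L) :
    lpBlock L n (-u) x = -lpBlock L n u x := by
  have := lpBlock_smul L n (-1) u x
  simpa using this

/-- The kernel of the low-frequency cutoff. -/
def lowKer : Pln → ℂ :=
  (exists_isKernel (hasCompactSupport_bump one_pos) (contDiff_bump 1)).choose

lemma isKernel_lowKer : IsKernel (bump 1) lowKer :=
  (exists_isKernel (hasCompactSupport_bump one_pos) (contDiff_bump 1)).choose_spec.1

lemma integral_lowKer : ∫ y, lowKer y = 1 := by
  rw [isKernel_lowKer.integral_eq]
  simp [bump, cutoff_eq_one]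

lemma mollify_fcoef {δ : ℝ} (hδ : 0 < δ) {W : Torus L → ℂ} (hW : Continuous W) (x : Torus L) :
    mollify L δ (fcoef L W) x = conv L lowKer δ W x := by
  rw [mollify_eq_tp, ← tp_fcoef_eq_conv isKernel_lowKer δ _ hW]
  · simp only [bump_smul_fvec L 1 hδ.le, one_mul]
  · have := finite_cutoff L hδ 1
    simpa [bump_smul_fvec L 1 hδ.le] using this

omit hL in
lemma mollify_tp {δ : ℝ} (hδ : 0 < δ) {a : TDist} (ha : a.support.Finite) (x : Torus L) :
    mollify L δ a x = conv L lowKer δ (tp L a) x := by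
  rw [mollify_eq_tp, conv_tp isKernel_lowKer δ ha]
  simp only [bump_smul_fvec L 1 hδ.le, one_mul]

/-- The total variation of the kernel of the low-frequency cutoff. -/
def lowConst : ℝ := ∫ y, ‖lowKer y‖

lemma lowConst_nonneg : 0 ≤ lowConst := integral_nonneg fun _ => norm_nonneg _

lemma norm_mollify_fcoef_le {δ : ℝ} (hδ : 0 < δ) {W : Torus L → ℂ} (hW : Continuous W) {M : ℝ}
    (hM : ∀ x, ‖W x‖ ≤ M) (x : Torus L) : ‖mollify L δ (fcoef L W) x‖ ≤ lowConst * M := by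
  rw [mollify_fcoef L hδ hW]
  exact norm_conv_le isKernel_lowKer.int hM δ x

lemma norm_lpBlock_fcoef_le (n : ℕ) {W : Torus L → ℂ} (hW : Continuous W) {M : ℝ}
    (hM : ∀ x, ‖W x‖ ≤ M) (x : Torus L) : ‖lpBlock L n (fcoef L W) x‖ ≤ 2 * lowConst * M := by
  have hM0 : 0 ≤ M := (norm_nonneg _).trans (hM 0)
  have h0 : 0 ≤ lowConst * M := mul_nonneg lowConst_nonneg hM0
  cases n with
  | zero =>
    rw [lpBlock]
    linarith [norm_mollify_fcoef_le L one_pos hW hM x]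
  | succ n =>
    rw [lpBlock]
    refine (norm_sub_le _ _).trans ?_
    linarith [norm_mollify_fcoef_le L (δ := 2⁻¹ ^ (n + 1)) (by positivity) hW hM x,
      norm_mollify_fcoef_le L (δ := 2⁻¹ ^ n) (by positivity) hW hM x]

lemma tendsto_mollify_fcoef {W : Torus L → ℂ} (hW : Continuous W) (x : Torus L) :
    Tendsto (fun N : ℕ => mollify L ((2 : ℝ)⁻¹ ^ N) (fcoef L W) x) atTop (𝓝 (W x)) := by
  have := tendsto_conv isKernel_lowKer.int integral_lowKer hW x
    (tendsto_pow_atTop_nhds_zero_of_lt_one (r := (2 : ℝ)⁻¹) (by norm_num) (by norm_num))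
  refine this.congr fun N => ?_
  rw [mollify_fcoef L (by positivity) hW]

end Blocks

section Bernstein

variable {L : ℝ} [hL : Fact (0 < L)]

lemma inv_two_pow_mul (n : ℕ) : (2 : ℝ) ^ n * (2 : ℝ)⁻¹ ^ n = 1 := by
  rw [← mul_pow]; norm_num

/-- Bernstein's inequality for one partial derivative. -/
lemma exists_bernstein : ∃ C, 0 ≤ C ∧ ∀ (L : ℝ) [Fact (0 < L)] (n : ℕ) (a : TDist) (M : ℝ),
    AnnSupp L n a → (∀ x, ‖tp L a x‖ ≤ M) → ∀ (j : Fin 2) (x : Torus L),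
      ‖tp L (fun k => (fvec L k j : ℂ) * a k) x‖ ≤ C * 2 ^ n * M := by
  have hk : ∀ j : Fin 2, ∃ κ, IsKernel (fun ξ : Pln => (ξ j : ℂ) * bump (1 / 2) ξ) κ := fun j =>
    (exists_isKernel ((hasCompactSupport_bump (by norm_num : (0 : ℝ) < 1 / 2)).mul_left)
      (contDiff_coord_mul_bump (1 / 2) j)).imp fun κ h => h.1
  choose κ hκ using hk
  refine ⟨∑ j, ∫ y, ‖κ j y‖, Finset.sum_nonneg fun j _ => integral_nonneg fun _ => norm_nonneg _,
    fun L _ n a M ha hM j x => ?_⟩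
  have hM0 : 0 ≤ M := (norm_nonneg _).trans (hM 0)
  have h1 := norm_tp_mul_le (hκ j) (2⁻¹ ^ n) ha.fin hM x
  -- On the support of a the rescaled wave vector has norm at most 4/3, where bump (1/2) equals 1
  -- and may be inserted freely. Undoing the dilation of the coordinate produces the factor 2^n.
  have h2 : (fun k => (fvec L k j : ℂ) * a k) = ((2 : ℂ) ^ n) • fun k =>
      (((((2 : ℝ)⁻¹ ^ n) • fvec L k) j : ℝ) : ℂ) * bump (1 / 2) (((2 : ℝ)⁻¹ ^ n) • fvec L k) * a k := by
    ext k
    by_cases hk : a k = 0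
    · simp [hk]
    · rw [Pi.smul_apply, bump_smul_fvec L _ (by positivity),
        cutoff_eq_one (by linarith [ha.le k hk]), PiLp.smul_apply, smul_eq_mul, smul_eq_mul]
      have h3 : ((2 : ℂ) ^ n) * ((2 : ℂ)⁻¹ ^ n) = 1 := by rw [← mul_pow]; norm_num
      push_cast
      linear_combination (-(fvec L k j : ℂ) * a k) * h3
  rw [h2, tp_smul, norm_mul, norm_pow, Complex.norm_ofNat]
  have h3 : ∫ y, ‖κ j y‖ ≤ ∑ j, ∫ y, ‖κ j y‖ :=
    Finset.single_le_sum (f := fun j => ∫ y, ‖κ j y‖)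
      (fun j _ => integral_nonneg fun _ => norm_nonneg _) (Finset.mem_univ j)
  calc _ ≤ 2 ^ n * ((∫ y, ‖κ j y‖) * M) := by gcongr
    _ ≤ 2 ^ n * ((∑ j, ∫ y, ‖κ j y‖) * M) := by gcongr
    _ = _ := by ring

/-- Smoothing effect of the heat semigroup on dyadic blocks. -/
lemma exists_heat_block : ∃ C, 0 ≤ C ∧ ∀ (L : ℝ) [Fact (0 < L)] (n : ℕ) (a : TDist) (M t : ℝ),
    AnnSupp L n a → (∀ x, ‖tp L a x‖ ≤ M) → 0 < t → ∀ (x : Torus L),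
      ‖tp L (fun k => (Real.exp (-t * freqSq L k) : ℂ) * a k) x‖ ≤ C * M ∧
      (n ≠ 0 → ‖tp L (fun k => (Real.exp (-t * freqSq L k) : ℂ) * a k) x‖
        ≤ C * (t * 4 ^ n)⁻¹ * M) := by
  obtain ⟨G, hG, -⟩ := exists_isKernel_gaussian
  choose D hD using exists_isKernel_coord_gaussian
  have hk : ∀ j : Fin 2, ∃ κ, IsKernel
      (fun ξ : Pln => annulus (1 / 2) 4 ξ * ((ξ j / ‖ξ‖ ^ 2 : ℝ) : ℂ)) κ := fun j =>
    (exists_isKernel ((hasCompactSupport_annulus (by norm_num : (0 : ℝ) < 1 / 2)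
      (by norm_num : (0 : ℝ) < 4)).mul_right) (contDiff_annulus_mul_inv j)).imp fun κ h => h.1
  choose κ hκ using hk
  set CG := ∫ y, ‖G y‖ with hCG
  have hCG0 : 0 ≤ CG := integral_nonneg fun _ => norm_nonneg _
  have hCD0 : ∀ j, 0 ≤ ∫ y, ‖D j y‖ := fun j => integral_nonneg fun _ => norm_nonneg _
  have hCκ0 : ∀ j, 0 ≤ ∫ y, ‖κ j y‖ := fun j => integral_nonneg fun _ => norm_nonneg _
  set C1 := ∑ j, (∫ y, ‖D j y‖) * ∫ y, ‖κ j y‖ with hC1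
  have hC10 : 0 ≤ C1 := Finset.sum_nonneg fun j _ => mul_nonneg (hCD0 j) (hCκ0 j)
  -- Half of the gain. With ζ = √t k and η = 2^{-n} k one has e^{-|ζ|²} = (√t 2^n)^{-1} ∑_j (ζ_j
  -- e^{-|ζ|²}) (η_j/|η|²), and each factor, once η is localized to an annulus, is a multiplier with
  -- an integrable kernel.
  have hone : ∀ (L : ℝ) [Fact (0 < L)] (n : ℕ) (a : TDist) (M t : ℝ),
    AnnSupp L n a → (∀ x, ‖tp L a x‖ ≤ M) → 0 < t → ∀ (x : Torus L),
      ‖tp L (fun k => (Real.exp (-t * freqSq L k) : ℂ) * a k) x‖ ≤ CG * M ∧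
      (n ≠ 0 → ‖tp L (fun k => (Real.exp (-t * freqSq L k) : ℂ) * a k) x‖
        ≤ C1 * (Real.sqrt t * 2 ^ n)⁻¹ * M) := by
    intro L _ n a M t ha hM ht x
    have hM0 : 0 ≤ M := (norm_nonneg _).trans (hM 0)
    have hs : Real.sqrt t ^ 2 = t := Real.sq_sqrt ht.le
    have hs0 : 0 < Real.sqrt t := Real.sqrt_pos.2 ht
    have hn : ∀ k, ‖Real.sqrt t • fvec L k‖ ^ 2 = t * freqSq L k := fun k => by
      rw [norm_smul, mul_pow, Real.norm_of_nonneg hs0.le, hs, freqSq_eq]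
    refine ⟨?_, fun hn0 => ?_⟩
    · have := norm_tp_mul_le hG (Real.sqrt t) ha.fin hM x
      simp only [hn] at this
      simpa only [neg_mul] using this
    · have key : ∀ j, ‖tp L (fun k => ((((Real.sqrt t • fvec L k) j) *
          Real.exp (-‖Real.sqrt t • fvec L k‖ ^ 2) : ℝ) : ℂ) *
          (annulus (1 / 2) 4 (((2 : ℝ)⁻¹ ^ n) • fvec L k) *
            (((((2 : ℝ)⁻¹ ^ n) • fvec L k) j / ‖((2 : ℝ)⁻¹ ^ n) • fvec L k‖ ^ 2 : ℝ) : ℂ) * a k)) x‖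
          ≤ (∫ y, ‖D j y‖) * ((∫ y, ‖κ j y‖) * M) := fun j =>
        norm_tp_mul_le (hD j) (Real.sqrt t) (support_mul_finite _ ha.fin)
          (fun z => norm_tp_mul_le (hκ j) (2⁻¹ ^ n) ha.fin hM z) x
      have hsum : (fun k => (Real.exp (-t * freqSq L k) : ℂ) * a k) =
          (((Real.sqrt t * 2 ^ n)⁻¹ : ℝ) : ℂ) •
          ((fun k => ((((Real.sqrt t • fvec L k) 0) *
          Real.exp (-‖Real.sqrt t • fvec L k‖ ^ 2) : ℝ) : ℂ) *
          (annulus (1 / 2) 4 (((2 : ℝ)⁻¹ ^ n) • fvec L k) *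
            (((((2 : ℝ)⁻¹ ^ n) • fvec L k) 0 / ‖((2 : ℝ)⁻¹ ^ n) • fvec L k‖ ^ 2 : ℝ) : ℂ) * a k)) +
          (fun k => ((((Real.sqrt t • fvec L k) 1) *
          Real.exp (-‖Real.sqrt t • fvec L k‖ ^ 2) : ℝ) : ℂ) *
          (annulus (1 / 2) 4 (((2 : ℝ)⁻¹ ^ n) • fvec L k) *
            (((((2 : ℝ)⁻¹ ^ n) • fvec L k) 1 / ‖((2 : ℝ)⁻¹ ^ n) • fvec L k‖ ^ 2 : ℝ) : ℂ) *
              a k))) := by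
        ext k
        by_cases hk : a k = 0
        · simp [hk]
        have h1 := ha.le k hk
        have h2 := ha.ge hn0 k hk
        have hf : 0 < ‖fvec L k‖ := by
          by_contra! h
          have : ‖fvec L k‖ = 0 := le_antisymm h (norm_nonneg _)
          rw [this] at h2; norm_num at h2
        -- The annular symbol is 1 on 1/3 ≤ |η| ≤ 2, which contains the range 1/2 ≤ |η| ≤ 4/3 of the
        -- rescaled frequencies.
        have hann : annulus (1 / 2) 4 (((2 : ℝ)⁻¹ ^ n) • fvec L k) = 1 := by
          rw [annulus, bump_smul_fvec L _ (by positivity), bump_smul_fvec L _ (by positivity),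
            cutoff_eq_one (by linarith), cutoff_eq_zero (by linarith)]
          simp
        have hfs : freqSq L k = fvec L k 0 ^ 2 + fvec L k 1 ^ 2 := by
          simp [freqSq, fvec_apply]
        have hst : ‖Real.sqrt t‖ ^ 2 = t := by rw [Real.norm_of_nonneg hs0.le, hs]
        have hfp : 0 < freqSq L k := by rw [freqSq_eq]; positivity
        simp only [Pi.smul_apply, Pi.add_apply, smul_eq_mul, hann, hst, one_mul,
          PiLp.smul_apply, norm_smul, mul_pow, ← freqSq_eq]
        rw [Real.norm_of_nonneg (by positivity : (0 : ℝ) ≤ 2⁻¹ ^ n)]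
        rw [← mul_assoc, ← mul_assoc, ← add_mul, ← mul_assoc]
        congr 1
        rw [← Complex.ofReal_mul, ← Complex.ofReal_mul, ← Complex.ofReal_add, ← Complex.ofReal_mul]
        congr 1
        have h3 : ∀ v : ℝ, (2 : ℝ)⁻¹ ^ n * v / ((2⁻¹ ^ n) ^ 2 * freqSq L k)
            = 2 ^ n * v / freqSq L k := by
          intro v
          rw [inv_pow]
          field_simp
        simp only [h3, neg_mul]
        field_simp
        rw [hfs]
      have hfinj : ∀ j : Fin 2, (fun k => ((((Real.sqrt t • fvec L k) j) *
          Real.exp (-‖Real.sqrt t • fvec L k‖ ^ 2) : ℝ) : ℂ) *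
          (annulus (1 / 2) 4 (((2 : ℝ)⁻¹ ^ n) • fvec L k) *
            (((((2 : ℝ)⁻¹ ^ n) • fvec L k) j / ‖((2 : ℝ)⁻¹ ^ n) • fvec L k‖ ^ 2 : ℝ) : ℂ) *
              a k)).support.Finite := fun j =>
        support_mul_finite _ (support_mul_finite _ ha.fin)
      rw [hsum, tp_smul, tp_add L (hfinj 0) (hfinj 1), norm_mul, Complex.norm_real,
        Real.norm_of_nonneg (by positivity)]
      calc _ ≤ (Real.sqrt t * 2 ^ n)⁻¹ * ((∫ y, ‖D 0 y‖) * ((∫ y, ‖κ 0 y‖) * M) +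
            (∫ y, ‖D 1 y‖) * ((∫ y, ‖κ 1 y‖) * M)) := by
            gcongr
            exact (norm_add_le _ _).trans (add_le_add (key 0) (key 1))
        _ = _ := by rw [hC1, Fin.sum_univ_two]; ring
  refine ⟨CG + C1 ^ 2 * 2, by positivity, fun L _ n a M t ha hM ht x => ?_⟩
  have hM0 : 0 ≤ M := (norm_nonneg _).trans (hM 0)
  refine ⟨?_, fun hn0 => ?_⟩
  · refine ((hone L n a M t ha hM ht x).1).trans ?_
    have : 0 ≤ C1 ^ 2 * 2 * M := by positivity
    linarith
  -- The full gain: run the half gain twice, over two time steps t/2, using the semigroup property.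
  -- The square of (√(t/2) 2^n)^{-1} is 2 (t 4^n)^{-1}.
  · have h1 := fun z => (hone L n a M (t / 2) ha hM (by linarith) z).2 hn0
    have h2 := (hone L n _ _ (t / 2) (ha.mul _) h1 (by linarith) x).2 hn0
    have h3 : (fun k => (Real.exp (-(t / 2) * freqSq L k) : ℂ) *
        ((Real.exp (-(t / 2) * freqSq L k) : ℂ) * a k)) =
        fun k => (Real.exp (-t * freqSq L k) : ℂ) * a k := by
      ext k
      rw [← mul_assoc, ← Complex.ofReal_mul, ← Real.exp_add]
      congr 4
      ring
    rw [h3] at h2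
    refine h2.trans ?_
    have hs : Real.sqrt (t / 2) ^ 2 = t / 2 := Real.sq_sqrt (by linarith)
    have h4 : (Real.sqrt (t / 2) * 2 ^ n)⁻¹ * (Real.sqrt (t / 2) * 2 ^ n)⁻¹ = 2 * (t * 4 ^ n)⁻¹ := by
      rw [← mul_inv, ← sq, mul_pow, hs, ← pow_mul, mul_comm n 2, pow_mul]
      norm_num
      field_simp
    have h5 : 0 ≤ CG * (t * 4 ^ n)⁻¹ * M := by positivity
    calc _ = C1 ^ 2 * ((Real.sqrt (t / 2) * 2 ^ n)⁻¹ * (Real.sqrt (t / 2) * 2 ^ n)⁻¹) * M := by ring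
      _ = C1 ^ 2 * 2 * (t * 4 ^ n)⁻¹ * M := by rw [h4]; ring
      _ ≤ _ := by linarith

end Bernstein

end Phi42

end

/-! ### Dyadic duality pairing of distributions with Hölder functions. -/

noncomputable section

namespace Phi42

open scoped FourierTransform RealInnerProductSpace ContDiff

section Powers

lemma inv_two_pow_rpow (n : ℕ) (b : ℝ) : (((2 : ℝ)⁻¹ ^ n) ^ b) = (2 : ℝ) ^ (-(b * n)) := by
  rw [inv_pow, Real.inv_rpow (by positivity), ← Real.rpow_natCast, ← Real.rpow_mul (by norm_num),
    Real.rpow_neg (by norm_num), mul_comm]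

lemma two_pow_rpow (n : ℕ) (b : ℝ) : (((2 : ℝ) ^ n) ^ b) = (2 : ℝ) ^ (b * n) := by
  rw [← Real.rpow_natCast, ← Real.rpow_mul (by norm_num), mul_comm]

lemma summable_geo {c : ℝ} (hc : 0 < c) : Summable fun n : ℕ => (2 : ℝ) ^ (-(c * n)) := by
  have h : (fun n : ℕ => (2 : ℝ) ^ (-(c * n))) = fun n : ℕ => ((2 : ℝ) ^ (-c)) ^ n := by
    ext n
    rw [← Real.rpow_natCast, ← Real.rpow_mul (by norm_num)]
    ring_nf
  rw [h]
  exact summable_geometric_of_lt_one (by positivity)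
    (Real.rpow_lt_one_of_one_lt_of_neg (by norm_num) (by linarith))

/-- The sum of a geometric series with ratio `2^{-c}`. -/
def geo (c : ℝ) : ℝ := ∑' n : ℕ, (2 : ℝ) ^ (-(c * n))

lemma geo_nonneg (c : ℝ) : 0 ≤ geo c := tsum_nonneg fun _ => by positivity

lemma rpow_le_one_add {r b : ℝ} (hr : 0 ≤ r) (hb : 0 ≤ b) (hb' : b ≤ 1) : r ^ b ≤ 1 + r := by
  rcases le_total r 1 with h | h
  · linarith [Real.rpow_le_one hr h hb]
  · have := Real.rpow_le_rpow_of_exponent_le h hb'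
    rw [Real.rpow_one] at this
    linarith

/-- The interpolation device used throughout: a trivial bound together with a bound of first order
gives every intermediate order. -/
lemma min_one_le_rpow {r b : ℝ} (hr : 0 ≤ r) (hb : 0 ≤ b) (hb' : b ≤ 1) : min 1 r ≤ r ^ b := by
  rcases le_total r 1 with h | h
  · rw [min_eq_right h]
    rcases hr.eq_or_lt with rfl | hr
    · positivity
    · have := Real.rpow_le_rpow_of_exponent_ge hr h hb'
      rwa [Real.rpow_one] at this
  · rw [min_eq_left h]
    exact Real.one_le_rpow h hb

end Powers

section Pairing

variable {L : ℝ}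

/-- Growth of the Littlewood-Paley blocks like `2^{an}`. -/
def BlockBound (L a U : ℝ) (u : TDist) : Prop := ∀ n x, ‖lpBlock L n u x‖ ≤ U * (2 : ℝ) ^ (a * n)

/-- Duality pairing of a distribution with a function, by summation over dyadic blocks. -/
def pairing [Fact (0 < L)] (u : TDist) (W : Torus L → ℂ) : ℂ :=
  ∑' n : ℕ, ∫ x, lpBlock L n u x * W x

/-- A Hölder condition in mean. -/
structure L1Hol [Fact (0 < L)] (b A M : ℝ) (W : Torus L → ℂ) : Prop where
  cont : Continuous W
  l1 : ∫ x, ‖W x‖ ≤ A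
  mod : ∀ y : Pln, ∫ x, ‖W (x + proj L y) - W x‖ ≤ M * ‖y‖ ^ b

variable [hL : Fact (0 < L)]

lemma L1Hol.nonneg {b A M : ℝ} {W : Torus L → ℂ} (h : L1Hol b A M W) : 0 ≤ A ∧ 0 ≤ M := by
  refine ⟨(integral_nonneg fun _ => norm_nonneg _).trans h.l1, ?_⟩
  have h1 := (integral_nonneg fun _ => norm_nonneg _).trans (h.mod (EuclideanSpace.single 0 1))
  simpa using h1

lemma norm_integral_mul_le {p W : Torus L → ℂ} (hW : Continuous W) {P : ℝ}
    (hP : ∀ x, ‖p x‖ ≤ P) : ‖∫ x, p x * W x‖ ≤ P * ∫ x, ‖W x‖ := by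
  rw [← integral_const_mul]
  refine norm_integral_le_of_norm_le ((integrable_of_cont L hW.norm).const_mul P)
    (Eventually.of_forall fun x => ?_)
  rw [norm_mul]
  exact mul_le_mul_of_nonneg_right (hP x) (norm_nonneg _)

/-- Pairing a function localized in a dyadic annulus with a Hölder function. -/
lemma exists_block_pairing : ∃ C, 1 ≤ C ∧ ∀ (L : ℝ) [Fact (0 < L)] (n : ℕ) (a : TDist)
    (b A M P : ℝ) (W : Torus L → ℂ), AnnSupp L n a → (∀ x, ‖tp L a x‖ ≤ P) → n ≠ 0 → 0 ≤ b →
    b ≤ 1 → L1Hol b A M W → ‖∫ x, tp L a x * W x‖ ≤ C * P * M * (2 : ℝ) ^ (-(b * n)) := by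
  obtain ⟨κ, hκ, hκ1⟩ := exists_isKernel (hasCompactSupport_annulus
    (by norm_num : (0 : ℝ) < 1 / 2) (by norm_num : (0 : ℝ) < 4)) (contDiff_annulus (1 / 2) 4)
  have hint : Integrable fun y => ‖κ y‖ * (1 + ‖y‖) := by
    refine (hκ.int.norm.add hκ1).congr (Eventually.of_forall fun y => ?_)
    simp only [Pi.add_apply]; ring
  have hI0 : 0 ≤ ∫ y, ‖κ y‖ * (1 + ‖y‖) := integral_nonneg fun _ => by positivity
  -- The extra 1 makes the constant at least 1, so that it also serves for block 0 in
  -- `norm_block_pairing_le`.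
  refine ⟨1 + ∫ y, ‖κ y‖ * (1 + ‖y‖), by linarith,
    fun L _ n a b A M P W ha hP hn hb hb' hW => ?_⟩
  have hP0 : 0 ≤ P := (norm_nonneg _).trans (hP 0)
  have hM0 := hW.nonneg.2
  set ε : ℝ := 2⁻¹ ^ n with hε
  have hε0 : 0 < ε := by positivity
  -- The dilated annular multiplier is 1 on the support of a, so convolution with its kernel
  -- reproduces the block and can be moved onto W.
  have hid : ∀ x, conv L κ ε (tp L a) x = tp L a x := by
    refine conv_tp_of_eq_one hκ ha.fin fun k hk => ?_
    have h1 : ε * ‖fvec L k‖ ≤ 4 / 3 := ha.le k hk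
    have h2 : 1 / 2 ≤ ε * ‖fvec L k‖ := ha.ge hn k hk
    rw [annulus, bump_smul_fvec L _ hε0.le, bump_smul_fvec L _ hε0.le,
      cutoff_eq_one (by linarith), cutoff_eq_zero (by linarith)]
    simp
  have hcont := continuous_tp L ha.fin
  -- The kernel has mean zero, so W(x) may be subtracted from its translate by εy. The L¹ modulus of
  -- continuity then gives ε^b = 2^{-bn}.
  have h0 : ∫ y, κ y = 0 := by rw [hκ.integral_eq, annulus_zero]
  have h1 : ∫ x, tp L a x * W x
      = ∫ y, κ y * ∫ x, tp L a x * (W (x - proj L (ε • y)) - W x) := by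
    have h2 := integral_conv_mul hκ.int hcont hW.cont ε
    simp only [hid] at h2
    have h3 : ∀ y, ∫ x, tp L a x * (W (x - proj L (ε • y)) - W x)
        = (∫ x, tp L a x * W (x - proj L (ε • y))) - ∫ x, tp L a x * W x := by
      intro y
      simp only [mul_sub]
      exact integral_sub
        (integrable_of_cont L (hcont.mul (hW.cont.comp (continuous_id.sub continuous_const))))
        (integrable_of_cont L (hcont.mul hW.cont))
    simp only [h3]
    simp only [mul_sub (κ _)]
    rw [integral_sub, ← h2, integral_mul_const, h0, zero_mul, sub_zero]
    · obtain ⟨N, hN0, hN⟩ := exists_norm_bound hW.cont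
      refine hκ.int.mul_bdd (c := P * (N * L ^ 2)) ?_ (Eventually.of_forall fun y => ?_)
      · refine Continuous.aestronglyMeasurable ?_
        have hc2 : Continuous (Function.uncurry
            fun (y : Pln) (x : Torus L) => tp L a x * W (x - proj L (ε • y))) :=
          (hcont.comp continuous_snd).mul (hW.cont.comp (continuous_snd.sub
            ((continuous_proj L).comp (continuous_fst.const_smul ε))))
        have h5 := continuous_parametric_integral_of_continuous
          (μ := (volume : Measure (Torus L))) hc2 isCompact_univ
        simpa using h5
      · refine (norm_integral_mul_le (hW.cont.comp
          (continuous_id.sub continuous_const)) hP).trans ?_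
        refine mul_le_mul_of_nonneg_left ?_ hP0
        rw [← volume_torus L, mul_comm]
        have := integral_mono (μ := (volume : Measure (Torus L))) (integrable_of_cont L
          (hW.cont.comp (continuous_id.sub (continuous_const (y := proj L (ε • y))))).norm)
          (integrable_const N) (fun x => hN _)
        simpa using this
    · exact hκ.int.mul_const _
  rw [h1]
  have h4 : ∀ y, ‖κ y * ∫ x, tp L a x * (W (x - proj L (ε • y)) - W x)‖
      ≤ ‖κ y‖ * (1 + ‖y‖) * (P * M * ε ^ b) := by
    intro y
    rw [norm_mul, mul_assoc]
    refine mul_le_mul_of_nonneg_left ?_ (norm_nonneg _)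
    refine (norm_integral_mul_le ((hW.cont.comp
          (continuous_id.sub continuous_const)).sub hW.cont) hP).trans ?_
    have h5 := hW.mod (-(ε • y))
    rw [norm_neg, norm_smul, Real.norm_of_nonneg hε0.le, Real.mul_rpow hε0.le (norm_nonneg _),
      proj_neg] at h5
    simp only [← sub_eq_add_neg] at h5
    calc P * _ ≤ P * (M * (ε ^ b * ‖y‖ ^ b)) := by
          refine mul_le_mul_of_nonneg_left h5 hP0
      _ ≤ P * (M * (ε ^ b * (1 + ‖y‖))) := by
          gcongr
          exact rpow_le_one_add (norm_nonneg _) hb hb'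
      _ = _ := by ring
  refine (norm_integral_le_of_norm_le (hint.mul_const _) (Eventually.of_forall h4)).trans ?_
  rw [integral_mul_const, hε, inv_two_pow_rpow]
  have h6 : 0 ≤ P * M * (2 : ℝ) ^ (-(b * n)) := by positivity
  nlinarith

/-- The absolute constant of the dyadic pairing estimate. -/
def pairConst : ℝ := exists_block_pairing.choose

lemma one_le_pairConst : 1 ≤ pairConst := exists_block_pairing.choose_spec.1

/-- Dyadic pairing estimate, for all blocks. -/
lemma norm_block_pairing_le {n : ℕ} {a : TDist} {b A M P : ℝ} {W : Torus L → ℂ}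
    (ha : AnnSupp L n a) (hP : ∀ x, ‖tp L a x‖ ≤ P) (hb : 0 ≤ b) (hb' : b ≤ 1)
    (hW : L1Hol b A M W) :
    ‖∫ x, tp L a x * W x‖ ≤ pairConst * P * (A + M) * (2 : ℝ) ^ (-(b * n)) := by
  have hC := one_le_pairConst
  have hP0 : 0 ≤ P := (norm_nonneg _).trans (hP 0)
  obtain ⟨hA0, hM0⟩ := hW.nonneg
  rcases eq_or_ne n 0 with rfl | hn
  · refine (norm_integral_mul_le hW.cont hP).trans ?_
    simp only [CharP.cast_eq_zero, mul_zero, neg_zero, Real.rpow_zero, mul_one]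
    calc P * ∫ x, ‖W x‖ ≤ P * A := by gcongr; exact hW.l1
      _ ≤ P * (A + M) := by gcongr; linarith
      _ ≤ pairConst * (P * (A + M)) := le_mul_of_one_le_left (by positivity) hC
      _ = _ := by ring
  · refine (exists_block_pairing.choose_spec.2 L n a b A M P W ha hP hn hb hb' hW).trans ?_
    rw [← pairConst]
    have : M ≤ A + M := by linarith
    gcongr

/-- The block grows like 2^{an} and the pairing gains 2^{-bn}; when a < b the dyadic series defining
`pairing` converges geometrically. -/
lemma norm_lpBlock_pairing_le {u : TDist} {a U b A M : ℝ} {W : Torus L → ℂ}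
    (hu : BlockBound L a U u) (hb : 0 ≤ b) (hb' : b ≤ 1) (hW : L1Hol b A M W) (n : ℕ) :
    ‖∫ x, lpBlock L n u x * W x‖ ≤ pairConst * U * (A + M) * (2 : ℝ) ^ (-((b - a) * n)) := by
  simp only [lpBlock_eq_tp]
  refine (norm_block_pairing_le (annSupp_lpMul L n u)
    (fun x => by rw [← lpBlock_eq_tp]; exact hu n x) hb hb' hW).trans_eq ?_
  rw [show -((b - a) * (n : ℝ)) = a * n + -(b * n) by ring, Real.rpow_add (by norm_num)]
  ring

lemma summable_pairing {u : TDist} {a U b A M : ℝ} {W : Torus L → ℂ}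
    (hu : BlockBound L a U u) (hab : a < b) (hb : 0 ≤ b) (hb' : b ≤ 1) (hW : L1Hol b A M W) :
    Summable fun n : ℕ => ∫ x, lpBlock L n u x * W x :=
  Summable.of_norm_bounded ((summable_geo (sub_pos.2 hab)).mul_left _)
    (norm_lpBlock_pairing_le hu hb hb' hW)

lemma norm_pairing_le {u : TDist} {a U b A M : ℝ} {W : Torus L → ℂ}
    (hu : BlockBound L a U u) (hab : a < b) (hb : 0 ≤ b) (hb' : b ≤ 1) (hW : L1Hol b A M W) :
    ‖pairing u W‖ ≤ pairConst * U * (A + M) * geo (b - a) := by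
  rw [geo, ← tsum_mul_left]
  exact tsum_of_norm_bounded ((summable_geo (sub_pos.2 hab)).mul_left _).hasSum
    (norm_lpBlock_pairing_le hu hb hb' hW)

lemma pairing_sum {ι : Type*} {u : TDist} {S : Finset ι} {c : ι → ℂ} {W : ι → Torus L → ℂ}
    (hc : ∀ i ∈ S, Continuous (W i))
    (h : ∀ i ∈ S, Summable fun n : ℕ => ∫ x, lpBlock L n u x * W i x) :
    pairing u (fun x => ∑ i ∈ S, c i * W i x) = ∑ i ∈ S, c i * pairing u (W i) := by
  simp only [pairing, ← tsum_mul_left]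
  rw [← Summable.tsum_finsetSum fun i hi => (h i hi).mul_left (c i)]
  congr 1
  ext n
  simp only [Finset.mul_sum, ← integral_const_mul]
  rw [integral_finsetSum]
  · refine Finset.sum_congr rfl fun i _ => integral_congr_ae (Eventually.of_forall fun x => ?_)
    simp only; ring
  · intro i hi
    exact integrable_of_cont L ((continuous_lpBlock L n u).mul (continuous_const.mul (hc i hi)))

/-- The pairings of the mollifications converge. -/
lemma tendsto_integral_mollify {u : TDist} {a U b A M : ℝ} {W : Torus L → ℂ}
    (hu : BlockBound L a U u) (hab : a < b) (hb : 0 ≤ b) (hb' : b ≤ 1) (hW : L1Hol b A M W) :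
    Tendsto (fun δ => ∫ x, mollify L δ u x * W x) (𝓝[>] 0) (𝓝 (pairing u W)) := by
  set c : ℝ → ℕ → TDist := fun δ n k => (cutoff (δ * ‖fvec L k‖) : ℂ) * ((lpMul L n k : ℂ) * u k)
  have hcS : ∀ δ n, AnnSupp L n (c δ n) := fun δ n => (annSupp_lpMul L n u).mul _
  have hbound : ∀ δ, 0 < δ → ∀ n, ‖∫ x, tp L (c δ n) x * W x‖ ≤
      lowConst * (pairConst * U * (A + M)) * (2 : ℝ) ^ (-((b - a) * n)) := by
    intro δ hδ n
    have h1 : ∀ x, ‖tp L (c δ n) x‖ ≤ lowConst * (U * (2 : ℝ) ^ (a * n)) := by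
      intro x
      rw [← mollify_eq_tp, mollify_tp L hδ (annSupp_lpMul L n u).fin]
      exact norm_conv_le isKernel_lowKer.int
        (fun z => by rw [← lpBlock_eq_tp]; exact hu n z) δ x
    refine (norm_block_pairing_le (hcS δ n) h1 hb hb' hW).trans_eq ?_
    rw [show -((b - a) * (n : ℝ)) = a * n + -(b * n) by ring, Real.rpow_add (by norm_num)]
    ring
  have hsum : ∀ δ, 0 < δ → ∑' n, ∫ x, tp L (c δ n) x * W x = ∫ x, mollify L δ u x * W x := by
    intro δ hδ
    -- At fixed δ only finitely many blocks meet the frequencies kept by the mollifier, and on those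
    -- frequencies the first N + 1 block multipliers already sum to 1.
    obtain ⟨N, hN⟩ : ∃ N : ℕ, ∀ n, N ≤ n → (2 : ℝ)⁻¹ ^ n * (4 / 3 / δ) < 1 / 2 := by
      have := (tendsto_pow_atTop_nhds_zero_of_lt_one (r := (2 : ℝ)⁻¹) (by norm_num)
        (by norm_num)).mul_const (4 / 3 / δ)
      rw [zero_mul] at this
      exact eventually_atTop.1 (this.eventually (gt_mem_nhds (by norm_num)))
    have hfr : ∀ k, cutoff (δ * ‖fvec L k‖) ≠ 0 → ∀ n, N ≤ n →
        (2 : ℝ)⁻¹ ^ n * ‖fvec L k‖ < 1 / 2 := by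
      intro k hk n hn
      have h1 := lt_of_cutoff_ne_zero hk
      have h2 : ‖fvec L k‖ ≤ 4 / 3 / δ := by rw [le_div_iff₀ hδ]; linarith
      exact (mul_le_mul_of_nonneg_left h2 (by positivity)).trans_lt (hN n hn)
    rw [tsum_eq_sum (s := Finset.range (N + 1)), ← integral_finsetSum]
    · refine integral_congr_ae (Eventually.of_forall fun x => ?_)
      simp only
      rw [← Finset.sum_mul]
      congr 1
      have hS : ∀ n, ∀ k ∉ (finite_cutoff L hδ 1).toFinset, c δ n k = 0 := by
        intro n k hk
        have : cutoff (δ * ‖fvec L k‖) = 0 := by simpa using hk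
        simp [c, this]
      rw [mollify_eq_tp, tp_eq_sum L (S := (finite_cutoff L hδ 1).toFinset)
        (fun k hk => by have : cutoff (δ * ‖fvec L k‖) = 0 := by simpa using hk
                        simp [this])]
      rw [Finset.sum_congr rfl fun n _ => tp_eq_sum L (hS n) x, Finset.sum_comm]
      refine Finset.sum_congr rfl fun k _ => ?_
      rw [← Finset.sum_mul]
      congr 1
      simp only [c, ← Finset.mul_sum, ← Finset.sum_mul]
      by_cases hk : cutoff (δ * ‖fvec L k‖) = 0
      · simp [hk]
      · rw [← Complex.ofReal_sum, sum_lpMul,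
          cutoff_eq_one (ρ := (2 : ℝ)⁻¹ ^ N * ‖fvec L k‖) (by linarith [hfr k hk N le_rfl])]
        simp
    · intro n _
      exact integrable_of_cont L ((continuous_tp L (hcS δ n).fin).mul hW.cont)
    · intro n hn
      have hn' : N < n := by simpa using hn
      have h0 : c δ n = 0 := by
        ext k
        simp only [c, Pi.zero_apply, mul_eq_zero, Complex.ofReal_eq_zero]
        by_contra! h
        have h1 := hfr k h.1 n hn'.le
        have h2 := lpMul_ne_zero_ge L (by omega : n ≠ 0) h.2.1
        linarith
      simp [h0, tp]
  have hlim : Tendsto (fun δ => ∑' n, ∫ x, tp L (c δ n) x * W x) (𝓝[>] 0) (𝓝 (pairing u W)) := by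
    refine tendsto_tsum_of_dominated_convergence
      ((summable_geo (sub_pos.2 hab)).mul_left (lowConst * (pairConst * U * (A + M))))
      (fun n => ?_) (eventually_nhdsWithin_of_forall fun δ hδ n => hbound δ hδ n)
    refine tendsto_const_nhds.congr' ?_
    -- At fixed n the mollifier acts as the identity on block n once δ is small, so each term is
    -- eventually constant; `hbound` dominates the series uniformly in δ.
    have hlt : ∀ᶠ δ : ℝ in 𝓝[>] 0, δ * (4 / 3 * 2 ^ n) < 1 := by
      have : Tendsto (fun δ : ℝ => δ * (4 / 3 * 2 ^ n)) (𝓝[>] 0) (𝓝 0) := by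
        have h := (by fun_prop : Continuous fun δ : ℝ => δ * (4 / 3 * 2 ^ n)).tendsto 0
        rw [zero_mul] at h
        exact h.mono_left nhdsWithin_le_nhds
      exact this.eventually (gt_mem_nhds one_pos)
    filter_upwards [hlt, self_mem_nhdsWithin] with δ hδ hδ0
    have hc : c δ n = fun k => (lpMul L n k : ℂ) * u k := by
      ext k
      by_cases hk : lpMul L n k = 0
      · simp [c, hk]
      · have h1 := lpMul_ne_zero_le L hk
        have h2 : ‖fvec L k‖ ≤ 4 / 3 * 2 ^ n := by
          have := inv_two_pow_mul n
          calc ‖fvec L k‖ = 2 ^ n * ((2 : ℝ)⁻¹ ^ n * ‖fvec L k‖) := by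
                rw [← mul_assoc, this, one_mul]
            _ ≤ 2 ^ n * (4 / 3) := by gcongr
            _ = _ := by ring
        have h3 : δ * ‖fvec L k‖ ≤ 1 := by
          have := mul_le_mul_of_nonneg_left h2 (le_of_lt hδ0)
          linarith
        simp [c, cutoff_eq_one h3]
    rw [hc]
    simp only [lpBlock_eq_tp]
  exact hlim.congr' (eventually_nhdsWithin_of_forall fun δ hδ => hsum δ hδ)

/-- The limit in `mulDist` exists by `tendsto_integral_mollify` with the conjugate character as part
of the test function; from here on products are handled through `pairing` only. -/
lemma mulDist_eq {u : TDist} {a U b A M : ℝ} {w : Torus L → ℝ} {k : Freq}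
    (hu : BlockBound L a U u) (hab : a < b) (hb : 0 ≤ b) (hb' : b ≤ 1)
    (hW : L1Hol b A M fun x => (w x : ℂ) * (starRingEnd ℂ) (torusChar L k x)) :
    mulDist L u w k = ((L ^ 2)⁻¹ : ℝ) *
      pairing u fun x => (w x : ℂ) * (starRingEnd ℂ) (torusChar L k x) := by
  refine Tendsto.limUnder_eq ?_
  refine ((tendsto_integral_mollify hu hab hb hb' hW).const_mul _).congr fun δ => ?_
  simp only [fcoef, mul_assoc]

end Pairing

end Phi42

end

/-! ### Hölder estimates for blocks, block kernels and products. -/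

noncomputable section

namespace Phi42

open scoped FourierTransform RealInnerProductSpace ContDiff

section Lipschitz

/-- Mean value inequality along t ↦ x + ty: the derivative has symbol i⟨y, k⟩, and Bernstein's
inequality bounds its two coordinates, whence the factor 2. -/
lemma exists_tp_lipschitz : ∃ C, 0 ≤ C ∧ ∀ (L : ℝ) [Fact (0 < L)] (n : ℕ) (a : TDist) (M : ℝ),
    AnnSupp L n a → (∀ x, ‖tp L a x‖ ≤ M) → ∀ (x : Torus L) (y : Pln),
      ‖tp L a (x + proj L y) - tp L a x‖ ≤ C * 2 ^ n * M * ‖y‖ := by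
  obtain ⟨C, hC, hB⟩ := exists_bernstein
  refine ⟨2 * C, by positivity, fun L _ n a M ha hM x y => ?_⟩
  have hM0 : 0 ≤ M := (norm_nonneg _).trans (hM 0)
  set a' : TDist := fun k => (Complex.I * (⟪y, fvec L k⟫ : ℝ)) * a k with ha'
  have hder : ∀ t : ℝ, HasDerivAt (fun t : ℝ => tp L a (x + proj L (t • y)))
      (tp L a' (x + proj L (t • y))) t := by
    intro t
    have h0 : ∀ k ∉ ha.fin.toFinset, a k = 0 := fun k hk => by simpa using hk
    have h1 : ∀ k ∉ ha.fin.toFinset, a' k = 0 := fun k hk => by simp [ha', h0 k hk]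
    simp only [fun z => tp_eq_sum L h0 z, fun z => tp_eq_sum L h1 z, torusChar_shift,
      real_inner_smul_left]
    refine HasDerivAt.fun_sum fun k _ => ?_
    have h3 : HasDerivAt (fun t : ℝ => ((t * ⟪y, fvec L k⟫ : ℝ) : ℂ)) ((⟪y, fvec L k⟫ : ℝ) : ℂ) t := by
      apply HasDerivAt.ofReal_comp
      simpa using (hasDerivAt_id t).mul_const (⟪y, fvec L k⟫ : ℝ)
    refine ((((h3.const_mul Complex.I).cexp).const_mul (torusChar L k x)).const_mul
      (a k)).congr_deriv ?_
    simp only [ha']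
    ring
  have hbd : ∀ z, ‖tp L a' z‖ ≤ 2 * C * 2 ^ n * M * ‖y‖ := by
    intro z
    have h2 : a' = (Complex.I * (y 0 : ℂ)) • (fun k => (fvec L k 0 : ℂ) * a k)
        + (Complex.I * (y 1 : ℂ)) • (fun k => (fvec L k 1 : ℂ) * a k) := by
      ext k
      simp only [ha', PiLp.inner_apply, Fin.sum_univ_two, RCLike.inner_apply, conj_trivial,
        Pi.add_apply, Pi.smul_apply, smul_eq_mul]
      push_cast
      ring
    have hf : ∀ j : Fin 2, (fun k => (fvec L k j : ℂ) * a k).support.Finite := fun j =>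
      support_mul_finite _ ha.fin
    have hf' : ∀ j : Fin 2, ((Complex.I * (y j : ℂ)) • fun k => (fvec L k j : ℂ) * a k).support.Finite :=
      fun j => support_mul_finite (fun _ => Complex.I * (y j : ℂ)) (hf j)
    rw [h2, tp_add L (hf' 0) (hf' 1), tp_smul, tp_smul]
    refine (norm_add_le _ _).trans ?_
    have hy : ∀ j, |y j| ≤ ‖y‖ := fun j => by simpa using PiLp.norm_apply_le y j
    simp only [norm_mul, Complex.norm_I, one_mul, Complex.norm_real, Real.norm_eq_abs]
    calc _ ≤ ‖y‖ * (C * 2 ^ n * M) + ‖y‖ * (C * 2 ^ n * M) := by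
          gcongr
          · exact hy 0
          · exact hB L n a M ha hM 0 z
          · exact hy 1
          · exact hB L n a M ha hM 1 z
      _ = _ := by ring
  have := norm_image_sub_le_of_norm_deriv_le_segment_01' (f := fun t : ℝ => tp L a (x + proj L (t • y)))
    (fun t _ => (hder t).hasDerivWithinAt) (fun t _ => hbd _)
  simpa using this

/-- The constant in the Lipschitz estimate for dyadic blocks. -/
def lipConst : ℝ := exists_tp_lipschitz.choose

lemma lipConst_nonneg : 0 ≤ lipConst := exists_tp_lipschitz.choose_spec.1

variable {L : ℝ} [hL : Fact (0 < L)]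

lemma tp_lipschitz {n : ℕ} {a : TDist} {M : ℝ} (ha : AnnSupp L n a) (hM : ∀ x, ‖tp L a x‖ ≤ M)
    (x : Torus L) (y : Pln) :
    ‖tp L a (x + proj L y) - tp L a x‖ ≤ lipConst * 2 ^ n * M * ‖y‖ :=
  exists_tp_lipschitz.choose_spec.2 L n a M ha hM x y

lemma lpBlock_lipschitz {n : ℕ} {u : TDist} {M : ℝ} (hM : ∀ x, ‖lpBlock L n u x‖ ≤ M)
    (x : Torus L) (y : Pln) :
    ‖lpBlock L n u (x + proj L y) - lpBlock L n u x‖ ≤ lipConst * 2 ^ n * M * ‖y‖ := by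
  simp only [lpBlock_eq_tp] at hM ⊢
  exact tp_lipschitz (annSupp_lpMul L n u) hM x y

/-- Interpolates between the trivial bound 2M and the Lipschitz bound with constant of order 2^n. -/
lemma lpBlock_holder {n : ℕ} {u : TDist} {M b : ℝ} (hM : ∀ x, ‖lpBlock L n u x‖ ≤ M)
    (hb : 0 ≤ b) (hb' : b ≤ 1) (x : Torus L) (y : Pln) :
    ‖lpBlock L n u (x + proj L y) - lpBlock L n u x‖
      ≤ (2 + lipConst) * M * (2 : ℝ) ^ (b * n) * ‖y‖ ^ b := by
  have hM0 : 0 ≤ M := (norm_nonneg _).trans (hM 0)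
  have h1 := lpBlock_lipschitz hM x y
  have h2 : ‖lpBlock L n u (x + proj L y) - lpBlock L n u x‖ ≤ 2 * M := by
    refine (norm_sub_le _ _).trans ?_
    linarith [hM (x + proj L y), hM x]
  have h3 : ‖lpBlock L n u (x + proj L y) - lpBlock L n u x‖
      ≤ (2 + lipConst) * M * min 1 (2 ^ n * ‖y‖) := by
    have hl := lipConst_nonneg
    rcases le_total 1 (2 ^ n * ‖y‖) with h | h
    · rw [min_eq_left h]
      nlinarith [mul_nonneg hl hM0]
    · rw [min_eq_right h]
      have : 0 ≤ 2 * M * (2 ^ n * ‖y‖) := by positivity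
      nlinarith
  refine h3.trans ?_
  have h4 := min_one_le_rpow (r := 2 ^ n * ‖y‖) (by positivity) hb hb'
  rw [Real.mul_rpow (by positivity) (norm_nonneg _), two_pow_rpow] at h4
  rw [mul_assoc _ ((2 : ℝ) ^ (b * n))]
  have := lipConst_nonneg
  gcongr

end Lipschitz

section Kernel

variable {L : ℝ} [hL : Fact (0 < L)]

lemma integral_le_of_le {f : Torus L → ℝ} (hf : Continuous f) {M : ℝ} (hM : ∀ x, f x ≤ M) :
    ∫ x, f x ≤ M * L ^ 2 := by
  have := integral_mono (μ := (volume : Measure (Torus L))) (integrable_of_cont L hf)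
    (integrable_const M) hM
  rwa [integral_const, volume_torus, smul_eq_mul, mul_comm] at this

/-- The `L¹` norm of a continuous function by duality with continuous functions. -/
lemma integral_norm_le_of_duality {k : Torus L → ℂ} (hk : Continuous k) {C : ℝ}
    (h : ∀ f : Torus L → ℂ, Continuous f → (∀ x, ‖f x‖ ≤ 1) → ‖∫ x, k x * f x‖ ≤ C) :
    ∫ x, ‖k x‖ ≤ C := by
  have hL2 : 0 < L ^ 2 := by have := hL.out; positivity
  refine le_of_forall_pos_le_add fun η hη => ?_
  set ε := η / L ^ 2 with hε
  have hε0 : 0 < ε := by positivity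
  have hsq : ∀ x, 0 < Real.sqrt (‖k x‖ ^ 2 + ε ^ 2) := fun x => Real.sqrt_pos.2 (by positivity)
  -- A continuous substitute for the conjugate phase of k: it has modulus at most 1, and the loss
  -- |k| - |k|²/√(|k|²+ε²) is at most ε pointwise, hence at most η after integration.
  set f : Torus L → ℂ := fun x =>
    (starRingEnd ℂ) (k x) * ((Real.sqrt (‖k x‖ ^ 2 + ε ^ 2))⁻¹ : ℝ) with hf
  have hs : Continuous fun x => Real.sqrt (‖k x‖ ^ 2 + ε ^ 2) := by fun_prop
  have hfc : Continuous f :=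
    (Complex.continuous_conj.comp hk).mul
      (Complex.continuous_ofReal.comp (hs.inv₀ fun x => (hsq x).ne'))
  have hle : ∀ x, ‖k x‖ ≤ Real.sqrt (‖k x‖ ^ 2 + ε ^ 2) := fun x =>
    Real.le_sqrt_of_sq_le (by nlinarith)
  have hle' : ∀ x, Real.sqrt (‖k x‖ ^ 2 + ε ^ 2) ≤ ‖k x‖ + ε := fun x => by
    rw [Real.sqrt_le_left (by positivity)]
    nlinarith [norm_nonneg (k x)]
  have hf1 : ∀ x, ‖f x‖ ≤ 1 := fun x => by
    rw [hf, norm_mul, RCLike.norm_conj, Complex.norm_real, Real.norm_of_nonneg (by positivity),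
      ← div_eq_mul_inv]
    exact (div_le_one (hsq x)).2 (hle x)
  have hkf : ∀ x, k x * f x = ((‖k x‖ ^ 2 / Real.sqrt (‖k x‖ ^ 2 + ε ^ 2) : ℝ) : ℂ) := fun x => by
    rw [hf]
    simp only
    rw [← mul_assoc, Complex.mul_conj, Complex.normSq_eq_norm_sq, ← Complex.ofReal_mul,
      div_eq_mul_inv]
  have hcq : Continuous fun x => ‖k x‖ ^ 2 / Real.sqrt (‖k x‖ ^ 2 + ε ^ 2) :=
    (hk.norm.pow 2).div hs fun x => (hsq x).ne'
  have h1 := h f hfc hf1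
  simp only [hkf] at h1
  rw [integral_complex_ofReal, Complex.norm_real, Real.norm_of_nonneg
    (integral_nonneg fun x => by positivity)] at h1
  have h2 : ∫ x, ‖k x‖ ≤ ∫ x, (‖k x‖ ^ 2 / Real.sqrt (‖k x‖ ^ 2 + ε ^ 2) + ε) := by
    refine integral_mono (integrable_of_cont L hk.norm)
      (integrable_of_cont L (hcq.add continuous_const)) fun x => ?_
    simp only
    rw [← sub_le_iff_le_add, le_div_iff₀ (hsq x)]
    have h3 := hle' x
    rcases le_total (‖k x‖) ε with h4 | h4
    · nlinarith [hsq x, sq_nonneg ‖k x‖]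
    · nlinarith [hsq x]
  rw [integral_add (integrable_of_cont L hcq) (integrable_const _), integral_const,
    volume_torus, smul_eq_mul] at h2
  have h5 : L ^ 2 * ε = η := by rw [hε, mul_div_cancel₀ _ hL2.ne']
  linarith

/-- The integral kernel of a Littlewood-Paley block. -/
def lpKer (L : ℝ) (n : ℕ) (x z : Torus L) : ℂ :=
  ((L ^ 2)⁻¹ : ℝ) * tp L (fun k => (lpMul L n k : ℂ)) (x - z)

lemma annSupp_lpMul_one (n : ℕ) : AnnSupp L n (fun k => (lpMul L n k : ℂ)) := by
  simpa using annSupp_lpMul L n 1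

lemma continuous_lpKer (n : ℕ) (x : Torus L) : Continuous (lpKer L n x) :=
  continuous_const.mul ((continuous_tp L (annSupp_lpMul_one n).fin).comp
    (continuous_const.sub continuous_id))

lemma lpKer_eq_sum (n : ℕ) (x z : Torus L) :
    lpKer L n x z = ∑ k ∈ (annSupp_lpMul_one (L := L) n).fin.toFinset,
      (((L ^ 2)⁻¹ : ℝ) * (lpMul L n k : ℂ) * torusChar L k x) * (starRingEnd ℂ) (torusChar L k z) := by
  rw [lpKer, tp_eq_sum' L (annSupp_lpMul_one (L := L) n).fin, Finset.mul_sum]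
  refine Finset.sum_congr rfl fun k _ => ?_
  have h : torusChar L k (x - z) = torusChar L k x * (starRingEnd ℂ) (torusChar L k z) := by
    have h1 : torusChar L k x = torusChar L k (x - z) * torusChar L k z := by
      rw [← torusChar_add_apply, sub_add_cancel]
    rw [h1, mul_assoc, Complex.mul_conj, Complex.normSq_eq_norm_sq, norm_torusChar]
    simp
  rw [h]; ring

lemma lpBlock_eq_sum (n : ℕ) (u : TDist) (x : Torus L) :
    lpBlock L n u x = ∑ k ∈ (annSupp_lpMul_one (L := L) n).fin.toFinset,
      (lpMul L n k : ℂ) * u k * torusChar L k x := by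
  rw [lpBlock_eq_tp, tp_eq_sum L]
  intro k hk
  have : lpMul L n k = 0 := by simpa using hk
  simp [this]

lemma integral_lpKer_mul (n : ℕ) (x : Torus L) {f : Torus L → ℂ} (hf : Continuous f) :
    ∫ z, lpKer L n x z * f z = lpBlock L n (fcoef L f) x := by
  rw [lpBlock_eq_sum]
  simp only [lpKer_eq_sum, Finset.sum_mul]
  rw [integral_finsetSum]
  · refine Finset.sum_congr rfl fun k _ => ?_
    simp only [mul_assoc]
    rw [integral_const_mul, integral_const_mul, integral_const_mul, fcoef]
    simp only [mul_comm (f _)]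
    ring
  · intro k _
    exact integrable_of_cont L ((continuous_const.mul
      (Complex.continuous_conj.comp (continuous_torusChar L k))).mul hf)

/-- By duality the L¹ norm of the kernel is the norm of f ↦ Δf(x) on continuous functions, bounded
uniformly in n, x and L. -/
lemma integral_norm_lpKer_le (n : ℕ) (x : Torus L) : ∫ z, ‖lpKer L n x z‖ ≤ 2 * lowConst := by
  refine integral_norm_le_of_duality (continuous_lpKer n x) fun f hf hf1 => ?_
  rw [integral_lpKer_mul n x hf]
  simpa using norm_lpBlock_fcoef_le L n hf hf1 x

omit hL in
lemma lpKer_shift (n : ℕ) (x z y : Torus L) : lpKer L n x (z + y) = lpKer L n (x - y) z := by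
  simp only [lpKer]
  congr 2
  abel

/-- The same duality, applied to increments: shifting the second argument of the kernel by y shifts
the first by -y, so the Hölder bound for blocks of bounded functions applies. -/
lemma integral_norm_lpKer_sub_le (n : ℕ) (x : Torus L) (y : Pln) {b : ℝ} (hb : 0 ≤ b)
    (hb' : b ≤ 1) : ∫ z, ‖lpKer L n x (z + proj L y) - lpKer L n x z‖
      ≤ (2 + lipConst) * (2 * lowConst) * (2 : ℝ) ^ (b * n) * ‖y‖ ^ b := by
  simp only [lpKer_shift]
  refine integral_norm_le_of_duality (k := fun z => lpKer L n (x - proj L y) z - lpKer L n x z)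
    ((continuous_lpKer n _).sub (continuous_lpKer n x)) fun f hf hf1 => ?_
  have h1 : ∫ z, (lpKer L n (x - proj L y) z - lpKer L n x z) * f z
      = lpBlock L n (fcoef L f) (x + proj L (-y)) - lpBlock L n (fcoef L f) x := by
    rw [proj_neg, ← sub_eq_add_neg, ← integral_lpKer_mul n _ hf, ← integral_lpKer_mul n _ hf]
    simp only [sub_mul]
    exact integral_sub (integrable_of_cont L ((continuous_lpKer n _).mul hf))
      (integrable_of_cont L ((continuous_lpKer n _).mul hf))
  rw [h1]
  have h2 := lpBlock_holder (fun z => norm_lpBlock_fcoef_le L n hf hf1 z) hb hb' x (-y)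
  simpa using h2

end Kernel

section Holder

variable {L : ℝ} [hL : Fact (0 < L)]

/-- Bounded Hölder functions on the torus. -/
structure HolB (b M : ℝ) (w : Torus L → ℝ) : Prop where
  cont : Continuous w
  bound : ∀ x, |w x| ≤ M
  hol : ∀ x (y : Pln), |w (x + proj L y) - w x| ≤ M * ‖y‖ ^ b

omit hL in
lemma HolB.nonneg {b M : ℝ} {w : Torus L → ℝ} (h : HolB b M w) : 0 ≤ M :=
  (abs_nonneg _).trans (h.bound 0)

omit hL in
lemma HolB.mono {b M N : ℝ} {w : Torus L → ℝ} (h : HolB b M w) (hMN : M ≤ N) : HolB b N w :=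
  ⟨h.cont, fun x => (h.bound x).trans hMN, fun x y => (h.hol x y).trans (by gcongr)⟩

omit hL in
lemma HolB.mul {b M N : ℝ} {w z : Torus L → ℝ} (h : HolB b M w) (h' : HolB b N z) :
    HolB b (2 * M * N) (fun x => w x * z x) := by
  have hM := h.nonneg
  have hN := h'.nonneg
  refine ⟨h.cont.mul h'.cont, fun x => ?_, fun x y => ?_⟩
  · rw [abs_mul]
    calc _ ≤ M * N := mul_le_mul (h.bound x) (h'.bound x) (abs_nonneg _) hM
      _ ≤ _ := by nlinarith [mul_nonneg hM hN]
  · have e : w (x + proj L y) * z (x + proj L y) - w x * z x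
        = w (x + proj L y) * (z (x + proj L y) - z x) + (w (x + proj L y) - w x) * z x := by ring
    rw [e]
    refine (abs_add_le _ _).trans ?_
    rw [abs_mul, abs_mul]
    calc _ ≤ M * (N * ‖y‖ ^ b) + M * ‖y‖ ^ b * N := by
          refine add_le_add (mul_le_mul (h.bound _) (h'.hol x y) (abs_nonneg _) hM)
            (mul_le_mul (h.hol x y) (h'.bound x) (abs_nonneg _) (by positivity))
      _ = _ := by ring

omit hL in
lemma HolB.const_mul {b M : ℝ} {w : Torus L → ℝ} (h : HolB b M w) (c : ℝ) :
    HolB b (|c| * M) (fun x => c * w x) := by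
  refine ⟨continuous_const.mul h.cont, fun x => ?_, fun x y => ?_⟩
  · rw [abs_mul]; exact mul_le_mul_of_nonneg_left (h.bound x) (abs_nonneg c)
  · rw [← mul_sub, abs_mul, mul_assoc]
    exact mul_le_mul_of_nonneg_left (h.hol x y) (abs_nonneg c)

/-- The product of a bounded Hölder function and a continuous function with an integrated Hölder
bound. -/
lemma HolB.mul_l1Hol {b M A K : ℝ} {w : Torus L → ℝ} {k : Torus L → ℂ} (h : HolB b M w)
    (hk : L1Hol b A K k) :
    L1Hol b (M * A) (M * (A + K)) (fun x => (w x : ℂ) * k x) := by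
  have hM := h.nonneg
  have hc : Continuous fun x => (w x : ℂ) := Complex.continuous_ofReal.comp h.cont
  refine ⟨hc.mul hk.cont, ?_, fun y => ?_⟩
  · calc _ ≤ ∫ x, M * ‖k x‖ := by
          refine integral_mono (integrable_of_cont L (hc.mul hk.cont).norm)
            (integrable_of_cont L (continuous_const.mul hk.cont.norm)) fun x => ?_
          simp only [norm_mul]
          refine mul_le_mul_of_nonneg_right ?_ (norm_nonneg _)
          simpa using h.bound x
      _ = M * ∫ x, ‖k x‖ := integral_const_mul _ _
      _ ≤ _ := mul_le_mul_of_nonneg_left hk.l1 hM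
  · have hks : Continuous fun x => k (x + proj L y) :=
      hk.cont.comp (continuous_id.add continuous_const)
    have hws : Continuous fun x => (w (x + proj L y) : ℂ) :=
      hc.comp (continuous_id.add continuous_const)
    calc _ ≤ ∫ x, (M * ‖k (x + proj L y) - k x‖ + M * ‖y‖ ^ b * ‖k x‖) := by
          refine integral_mono (integrable_of_cont L ((hws.mul hks).sub (hc.mul hk.cont)).norm)
            (integrable_of_cont L ((continuous_const.mul (hks.sub hk.cont).norm).add
              (continuous_const.mul hk.cont.norm))) fun x => ?_
          have e : (w (x + proj L y) : ℂ) * k (x + proj L y) - w x * k x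
            = w (x + proj L y) * (k (x + proj L y) - k x)
              + ((w (x + proj L y) - w x : ℝ) : ℂ) * k x := by push_cast; ring
          simp only [e]
          refine (norm_add_le _ _).trans ?_
          rw [norm_mul, norm_mul]
          refine add_le_add (mul_le_mul_of_nonneg_right ?_ (norm_nonneg _))
            (mul_le_mul_of_nonneg_right ?_ (norm_nonneg _))
          · simpa using h.bound (x + proj L y)
          · rw [Complex.norm_real]; exact h.hol x y
      _ = M * (∫ x, ‖k (x + proj L y) - k x‖) + M * ‖y‖ ^ b * ∫ x, ‖k x‖ := by
          rw [integral_add, integral_const_mul, integral_const_mul]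
          · exact integrable_of_cont L (continuous_const.mul (hks.sub hk.cont).norm)
          · exact integrable_of_cont L (continuous_const.mul hk.cont.norm)
      _ ≤ M * (K * ‖y‖ ^ b) + M * ‖y‖ ^ b * A := by
          refine add_le_add (mul_le_mul_of_nonneg_left (hk.mod y) hM)
            (mul_le_mul_of_nonneg_left hk.l1 (by positivity))
      _ = _ := by ring

/-- Trigonometric polynomials satisfy Hölder bounds. -/
lemma exists_l1Hol_torusChar (k : Freq) {b : ℝ} (hb : 0 ≤ b) (hb' : b ≤ 1) :
    ∃ A M, L1Hol b A M fun x => (starRingEnd ℂ) (torusChar L k x) := by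
  have hc : Continuous fun x => (starRingEnd ℂ) (torusChar L k x) :=
    Complex.continuous_conj.comp (continuous_torusChar L k)
  refine ⟨_, (2 + ‖fvec L k‖) ^ 1 * (L ^ 2), hc, le_rfl, fun y => ?_⟩
  have h1 : ∀ x, ‖(starRingEnd ℂ) (torusChar L k (x + proj L y)) - (starRingEnd ℂ) (torusChar L k x)‖
      ≤ (2 + ‖fvec L k‖) * ‖y‖ ^ b := by
    intro x
    rw [← map_sub, RCLike.norm_conj, torusChar_shift, ← mul_sub_one, norm_mul, norm_torusChar,
      one_mul]
    have h2 : ‖Complex.exp (Complex.I * (⟪y, fvec L k⟫ : ℝ)) - 1‖ ≤ ‖y‖ * ‖fvec L k‖ := by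
      refine (Real.norm_exp_I_mul_ofReal_sub_one_le).trans ?_
      exact norm_inner_le_norm y _
    have h3 : ‖Complex.exp (Complex.I * (⟪y, fvec L k⟫ : ℝ)) - 1‖ ≤ 2 := by
      refine (norm_sub_le _ _).trans ?_
      rw [norm_exp_I_mul]; norm_num
    have h4 : ‖Complex.exp (Complex.I * (⟪y, fvec L k⟫ : ℝ)) - 1‖
        ≤ (2 + ‖fvec L k‖) * min 1 ‖y‖ := by
      rcases le_total 1 ‖y‖ with h | h
      · rw [min_eq_left h]; linarith [norm_nonneg (fvec L k)]
      · rw [min_eq_right h]; nlinarith [norm_nonneg y]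
    exact h4.trans (mul_le_mul_of_nonneg_left (min_one_le_rpow (norm_nonneg _) hb hb')
      (by positivity))
  have hcs : Continuous fun x => (starRingEnd ℂ) (torusChar L k (x + proj L y)) :=
    hc.comp (continuous_id.add continuous_const)
  exact (integral_le_of_le (hcs.sub hc).norm h1).trans_eq (by ring)

/-- The product of a distribution with a Hölder function in Fourier variables. -/
lemma HolB.mulDist_eq {u : TDist} {a U b M : ℝ} {w : Torus L → ℝ}
    (hu : BlockBound L a U u) (hab : a < b) (hb : 0 ≤ b) (hb' : b ≤ 1) (hw : HolB b M w) (k : Freq) :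
    mulDist L u w k = ((L ^ 2)⁻¹ : ℝ) *
      pairing u fun x => (w x : ℂ) * (starRingEnd ℂ) (torusChar L k x) := by
  obtain ⟨A, K, h⟩ := exists_l1Hol_torusChar (L := L) k hb hb'
  exact Phi42.mulDist_eq hu hab hb hb' (hw.mul_l1Hol h)

lemma HolB.summable_pairing_char {u : TDist} {a U b M : ℝ} {w : Torus L → ℝ}
    (hu : BlockBound L a U u) (hab : a < b) (hb : 0 ≤ b) (hb' : b ≤ 1) (hw : HolB b M w) (k : Freq) :
    Summable fun n : ℕ => ∫ x, lpBlock L n u x *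
      ((w x : ℂ) * (starRingEnd ℂ) (torusChar L k x)) := by
  obtain ⟨A, K, h⟩ := exists_l1Hol_torusChar (L := L) k hb hb'
  exact summable_pairing hu hab hb hb' (hw.mul_l1Hol h)

/-- Finite combinations of Fourier coefficients of a product. -/
lemma HolB.sum_mulDist {u : TDist} {a U b M : ℝ} {w : Torus L → ℝ}
    (hu : BlockBound L a U u) (hab : a < b) (hb : 0 ≤ b) (hb' : b ≤ 1) (hw : HolB b M w)
    (S : Finset Freq) (c : Freq → ℂ) :
    ∑ k ∈ S, c k * (((L ^ 2 : ℝ) : ℂ) * mulDist L u w k) =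
      pairing u fun x => (w x : ℂ) * ∑ k ∈ S, c k * (starRingEnd ℂ) (torusChar L k x) := by
  have hL' : (L : ℂ) ≠ 0 := by exact_mod_cast hL.out.ne'
  have h1 := pairing_sum (u := u) (S := S) (c := c)
    (W := fun k x => (w x : ℂ) * (starRingEnd ℂ) (torusChar L k x))
    (fun k _ => (Complex.continuous_ofReal.comp hw.cont).mul
      (Complex.continuous_conj.comp (continuous_torusChar L k)))
    (fun k _ => hw.summable_pairing_char hu hab hb hb' k)
  have h2 : (fun x => (w x : ℂ) * ∑ k ∈ S, c k * (starRingEnd ℂ) (torusChar L k x)) =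
      fun x => ∑ k ∈ S, c k * ((w x : ℂ) * (starRingEnd ℂ) (torusChar L k x)) := by
    ext x
    rw [Finset.mul_sum]
    exact Finset.sum_congr rfl fun k _ => by ring
  rw [h2, h1]
  refine Finset.sum_congr rfl fun k _ => ?_
  rw [hw.mulDist_eq hu hab hb hb' k]
  push_cast
  field_simp

/-- The product of a distribution of regularity `-a` with a `b`-Hölder function, `b > a`. -/
lemma HolB.blockBound_mulDist {u : TDist} {a U b M : ℝ} {w : Torus L → ℝ}
    (hu : BlockBound L a U u) (hab : a < b) (hb : 0 ≤ b) (hb' : b ≤ 1) (hw : HolB b M w) :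
    BlockBound L b (pairConst * geo (b - a) * (2 * lowConst * (4 + lipConst)) * (U * M))
      (mulDist L u w) := by
  intro n x
  have hlow := lowConst_nonneg
  have hlip := lipConst_nonneg
  have hM := hw.nonneg
  -- The mean Hölder constant of the block kernel is of order 2^{bn}. This is why the product is
  -- recorded with growth b rather than a, a harmless loss since b is taken small.
  have hK : L1Hol b (2 * lowConst) ((2 + lipConst) * (2 * lowConst) * (2 : ℝ) ^ (b * n))
      (lpKer L n x) :=
    ⟨continuous_lpKer n x, integral_norm_lpKer_le n x, fun y =>
      integral_norm_lpKer_sub_le n x y hb hb'⟩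
  -- A block of the product, at a point, is the distribution tested against w times the block
  -- kernel.
  have h1 : lpBlock L n (mulDist L u w) x = pairing u fun z => (w z : ℂ) * lpKer L n x z := by
    rw [lpBlock_eq_sum]
    have hL' : (L : ℂ) ≠ 0 := by exact_mod_cast hL.out.ne'
    have h2 := hw.sum_mulDist hu hab hb hb' (annSupp_lpMul_one (L := L) n).fin.toFinset
      (fun k => ((L ^ 2)⁻¹ : ℝ) * (lpMul L n k : ℂ) * torusChar L k x)
    simp only [lpKer_eq_sum]
    rw [← h2]
    refine Finset.sum_congr rfl fun k _ => ?_
    push_cast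
    field_simp
  rw [h1]
  have h2 := norm_pairing_le hu hab hb hb' (hw.mul_l1Hol hK)
  have hU : 0 ≤ U := by
    have := (norm_nonneg _).trans (hu 0 0)
    simpa using this
  have h3 : (1 : ℝ) ≤ (2 : ℝ) ^ (b * n) := Real.one_le_rpow (by norm_num) (by positivity)
  have hg := geo_nonneg (b - a)
  have hp := one_le_pairConst
  refine h2.trans ?_
  have h4 : M * (2 * lowConst) + M * (2 * lowConst + (2 + lipConst) * (2 * lowConst) * (2 : ℝ) ^ (b * n))
      ≤ M * (2 * lowConst) * (4 + lipConst) * (2 : ℝ) ^ (b * n) := by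
    have : M * (2 * lowConst) ≤ M * (2 * lowConst) * (2 : ℝ) ^ (b * n) :=
      le_mul_of_one_le_right (by positivity) h3
    linarith
  calc _ ≤ pairConst * U * (M * (2 * lowConst) * (4 + lipConst) * (2 : ℝ) ^ (b * n)) * geo (b - a) := by
        gcongr
    _ = _ := by ring

end Holder

end Phi42

end

/-! ### Besov norms, reconstruction from blocks and C¹ functions. -/

noncomputable section

namespace Phi42

open scoped FourierTransform RealInnerProductSpace ContDiff

section Besov

variable {L : ℝ}

lemma BlockBound.nonneg {a U : ℝ} {u : TDist} (h : BlockBound L a U u) : 0 ≤ U := by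
  have := (norm_nonneg _).trans (h 0 0)
  simpa using this

lemma BlockBound.mono {a a' U U' : ℝ} {u : TDist} (h : BlockBound L a U u) (ha : a ≤ a')
    (hU : U ≤ U') : BlockBound L a' U' u := fun n x =>
  (h n x).trans (mul_le_mul hU (Real.rpow_le_rpow_of_exponent_le (by norm_num)
    (by gcongr)) (by positivity) (h.nonneg.trans hU))

/-- The factor 2^a reflects the indexing: `lpBlock L n` is Δ_{n-1}, weighted by 2^{(n-1)a} in the
norm. -/
lemma blockBound_of_besov {a : ℝ} {u : TDist} (h : besov L a u < ⊤) :
    BlockBound L (-a) ((2 : ℝ) ^ a * (besov L a u).toReal) u := by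
  intro n x
  have h1 : ENNReal.ofReal ((2 : ℝ) ^ (((n : ℝ) - 1) * a)) * ‖lpBlock L n u x‖ₑ ≤ besov L a u := by
    refine le_trans ?_ (le_iSup (fun n : ℕ => ENNReal.ofReal ((2 : ℝ) ^ (((n : ℝ) - 1) * a)) *
      ⨆ x : Torus L, ‖lpBlock L n u x‖ₑ) n)
    gcongr
    exact le_iSup (fun x : Torus L => ‖lpBlock L n u x‖ₑ) x
  have h2 := ENNReal.toReal_mono h.ne h1
  rw [ENNReal.toReal_mul, ENNReal.toReal_ofReal (by positivity), toReal_enorm] at h2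
  have h3 : (2 : ℝ) ^ a * (2 : ℝ) ^ (-a * n) * (2 : ℝ) ^ (((n : ℝ) - 1) * a) = 1 := by
    rw [← Real.rpow_add (by norm_num), ← Real.rpow_add (by norm_num)]
    ring_nf
    simp
  calc ‖lpBlock L n u x‖ = (2 : ℝ) ^ a * (2 : ℝ) ^ (-a * n) *
        ((2 : ℝ) ^ (((n : ℝ) - 1) * a) * ‖lpBlock L n u x‖) := by
        rw [← mul_assoc, h3, one_mul]
    _ ≤ (2 : ℝ) ^ a * (2 : ℝ) ^ (-a * n) * (besov L a u).toReal := by gcongr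
    _ = _ := by ring

/-- Distributions of negative regularity, with the norm itself as constant. -/
lemma blockBound_of_besov_neg {a : ℝ} (ha : 0 ≤ a) {u : TDist} (h : besov L (-a) u < ⊤) :
    BlockBound L a (besov L (-a) u).toReal u := by
  have h1 := blockBound_of_besov h
  rw [neg_neg] at h1
  refine h1.mono le_rfl ?_
  refine mul_le_of_le_one_left ENNReal.toReal_nonneg ?_
  exact Real.rpow_le_one_of_one_le_of_nonpos (by norm_num) (by linarith)

variable [hL : Fact (0 < L)]

lemma besov_add_le (a : ℝ) (u v : TDist) : besov L a (u + v) ≤ besov L a u + besov L a v := by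
  refine iSup_le fun n => ?_
  refine le_trans ?_ (add_le_add (le_iSup (fun n : ℕ => ENNReal.ofReal ((2 : ℝ) ^ (((n : ℝ) - 1) * a)) *
      ⨆ x : Torus L, ‖lpBlock L n u x‖ₑ) n) (le_iSup (fun n : ℕ =>
      ENNReal.ofReal ((2 : ℝ) ^ (((n : ℝ) - 1) * a)) * ⨆ x : Torus L, ‖lpBlock L n v x‖ₑ) n))
  rw [← mul_add]
  gcongr
  refine iSup_le fun x => ?_
  rw [lpBlock_add]
  refine (enorm_add_le _ _).trans (add_le_add ?_ ?_)
  · exact le_iSup (fun x : Torus L => ‖lpBlock L n u x‖ₑ) x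
  · exact le_iSup (fun x : Torus L => ‖lpBlock L n v x‖ₑ) x

lemma besov_neg (a : ℝ) (u : TDist) : besov L a (-u) = besov L a u := by
  simp only [besov, lpBlock_neg, enorm_neg]

/-- Reverse triangle inequality, after checking that all the norms involved are finite. -/
lemma ContPath.continuousOn {a s : ℝ} {w : ℝ → TDist} (h : ContPath L a s w) :
    ContinuousOn (fun t => (besov L a (w t)).toReal) (Set.Ici s) := by
  intro t₀ ht₀
  have h0 := (h.1 t₀ ht₀).2
  have hsub : ∀ t, s ≤ t → besov L a (w t - w t₀) < ⊤ := fun t ht => by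
    rw [sub_eq_add_neg]
    refine (besov_add_le a _ _).trans_lt ?_
    rw [besov_neg]
    exact ENNReal.add_lt_top.2 ⟨(h.1 t ht).2, h0⟩
  have hle : ∀ t, s ≤ t → |(besov L a (w t)).toReal - (besov L a (w t₀)).toReal|
      ≤ (besov L a (w t - w t₀)).toReal := by
    intro t ht
    have h1 : (besov L a (w t)).toReal ≤ (besov L a (w t - w t₀)).toReal + (besov L a (w t₀)).toReal := by
      rw [← ENNReal.toReal_add (hsub t ht).ne h0.ne]
      refine ENNReal.toReal_mono (ENNReal.add_lt_top.2 ⟨hsub t ht, h0⟩).ne ?_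
      simpa using besov_add_le (L := L) a (w t - w t₀) (w t₀)
    have h2 : (besov L a (w t₀)).toReal ≤ (besov L a (w t - w t₀)).toReal + (besov L a (w t)).toReal := by
      rw [← ENNReal.toReal_add (hsub t ht).ne (h.1 t ht).2.ne]
      refine ENNReal.toReal_mono (ENNReal.add_lt_top.2 ⟨hsub t ht, (h.1 t ht).2⟩).ne ?_
      have h3 := besov_add_le (L := L) a (-(w t - w t₀)) (w t)
      rw [besov_neg] at h3
      simpa using h3
    rw [abs_le]
    constructor <;> linarith
  have hlim : Tendsto (fun t => (besov L a (w t - w t₀)).toReal) (𝓝[Set.Ici s] t₀) (𝓝 0) := by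
    exact (ENNReal.tendsto_toReal ENNReal.zero_ne_top).comp (h.2 t₀ ht₀)
  refine tendsto_iff_dist_tendsto_zero.2 (squeeze_zero' (Eventually.of_forall fun _ => dist_nonneg)
    ?_ hlim)
  filter_upwards [self_mem_nhdsWithin] with t ht
  exact hle t ht

end Besov

section Reconstruction

variable {L : ℝ} [hL : Fact (0 < L)]

/-- The partial sums telescope to mollifications at scale 2^{-N}, which converge pointwise to W;
summability then identifies the sum. -/
lemma hasSum_lpBlock {W : Torus L → ℂ} (hW : Continuous W) {x : Torus L}
    (hs : Summable fun n => lpBlock L n (fcoef L W) x) :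
    HasSum (fun n => lpBlock L n (fcoef L W) x) (W x) := by
  have h1 := hs.hasSum.tendsto_sum_nat.comp (tendsto_add_atTop_nat 1)
  have h2 := tendsto_mollify_fcoef L hW x
  have h3 : Tendsto (fun N : ℕ => mollify L ((2 : ℝ)⁻¹ ^ N) (fcoef L W) x) atTop
      (𝓝 (∑' n, lpBlock L n (fcoef L W) x)) := h1.congr fun N => sum_lpBlock L N _ x
  rw [tendsto_nhds_unique h2 h3]
  exact hs.hasSum

omit hL in
lemma BlockBound.summable {u : TDist} {c U : ℝ} (h : BlockBound L (-c) U u) (hc : 0 < c)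
    (x : Torus L) : Summable fun n => lpBlock L n u x := by
  refine Summable.of_norm_bounded ((summable_geo hc).mul_left U) fun n => ?_
  simpa only [neg_mul] using h n x

/-- Functions of positive Besov regularity are Hölder. -/
lemma HolB.of_blockBound {w : Torus L → ℝ} (hw : Continuous w) {β b U : ℝ} (hb : 0 ≤ b)
    (hb' : b ≤ 1) (hbβ : b < β) (h : BlockBound L (-β) U (fcoefR L w)) :
    HolB b ((2 + lipConst) * U * geo (β - b)) w := by
  have hc : Continuous fun x => (w x : ℂ) := Complex.continuous_ofReal.comp hw
  have hβ : 0 < β := hb.trans_lt hbβ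
  have hs : ∀ x, HasSum (fun n => lpBlock L n (fcoefR L w) x) (w x : ℂ) := fun x =>
    hasSum_lpBlock hc (h.summable hβ x)
  have hU := h.nonneg
  have hlip := lipConst_nonneg
  have hle : ∀ n : ℕ, (2 : ℝ) ^ (-β * n) ≤ (2 : ℝ) ^ (-((β - b) * n)) := fun n =>
    Real.rpow_le_rpow_of_exponent_le (by norm_num) (by nlinarith [(Nat.cast_nonneg n : (0 : ℝ) ≤ n)])
  refine ⟨hw, fun x => ?_, fun x y => ?_⟩
  · have h1 := (hs x).norm_le_of_bounded
      (((summable_geo (sub_pos.2 hbβ)).mul_left ((2 + lipConst) * U)).hasSum) fun n => by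
        refine (h n x).trans ?_
        calc U * (2 : ℝ) ^ (-β * n) ≤ (U + (1 + lipConst) * U) * (2 : ℝ) ^ (-((β - b) * n)) := by
              refine mul_le_mul ?_ (hle n) (by positivity) (by positivity)
              linarith [mul_nonneg (by linarith : 0 ≤ 1 + lipConst) hU]
          _ = _ := by ring
    rw [tsum_mul_left, Complex.norm_real] at h1
    exact h1
  · have h1 := ((hs (x + proj L y)).sub (hs x)).norm_le_of_bounded
      (((summable_geo (sub_pos.2 hbβ)).mul_left ((2 + lipConst) * U * ‖y‖ ^ b)).hasSum) fun n => by
        refine (lpBlock_holder (h n) hb hb' x y).trans_eq ?_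
        rw [show -((β - b) * (n : ℝ)) = -β * n + b * n by ring, Real.rpow_add (by norm_num)]
        ring
    rw [tsum_mul_left, ← Complex.ofReal_sub, Complex.norm_real] at h1
    refine h1.trans_eq ?_
    rw [geo]; ring

/-- The blocks of bounded functions. -/
lemma HolB.blockBound_zero {w : Torus L → ℝ} {b M : ℝ} (h : HolB b M w) :
    BlockBound L 0 (2 * lowConst * M) (fcoefR L w) := by
  intro n x
  have := norm_lpBlock_fcoef_le L n (W := fun x => (w x : ℂ))
    (Complex.continuous_ofReal.comp h.cont) (M := M) (fun x => by simpa using h.bound x) x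
  simpa [fcoefR] using this

/-- Blocks of Lipschitz functions. -/
lemma exists_blockBound_lipschitz : ∃ C, 0 ≤ C ∧ ∀ (L : ℝ) [Fact (0 < L)] (w : Torus L → ℝ) (M : ℝ),
    HolB 1 M w → BlockBound L (-1) (C * M) (fcoefR L w) := by
  obtain ⟨κ, hκ, hκ1⟩ := exists_isKernel (hasCompactSupport_annulus
    (by norm_num : (0 : ℝ) < 1) (by norm_num : (0 : ℝ) < 2)) (contDiff_annulus 1 2)
  have hI : 0 ≤ ∫ y, ‖y‖ * ‖κ y‖ := integral_nonneg fun _ => by positivity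
  have hlow := lowConst_nonneg
  refine ⟨2 * lowConst + ∫ y, ‖y‖ * ‖κ y‖, by positivity, fun L _ w M h n x => ?_⟩
  have hM := h.nonneg
  have hc : Continuous fun x => (w x : ℂ) := Complex.continuous_ofReal.comp h.cont
  rcases eq_or_ne n 0 with rfl | hn
  · have := h.blockBound_zero 0 x
    simp only [CharP.cast_eq_zero, mul_zero, Real.rpow_zero, mul_one] at this ⊢
    nlinarith
  set ε : ℝ := 2⁻¹ ^ n with hε
  have hε0 : 0 < ε := by positivity
  -- For n ≥ 1 the block multiplier is exactly the dilation of one fixed annular symbol.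
  have hmul : ∀ k, annulus 1 2 (ε • fvec L k) = (lpMul L n k : ℂ) := by
    intro k
    obtain ⟨m, rfl⟩ := Nat.exists_eq_succ_of_ne_zero hn
    rw [annulus, bump_smul_fvec L _ hε0.le, bump_smul_fvec L _ hε0.le, Nat.succ_eq_add_one, lpMul,
      hε, Nat.succ_eq_add_one]
    have : (2 : ℝ) * (2⁻¹ ^ (m + 1) * ‖fvec L k‖) = 2⁻¹ ^ m * ‖fvec L k‖ := by
      rw [pow_succ]; ring
    rw [this]
    push_cast
    simp
  have h1 : lpBlock L n (fcoefR L w) x = conv L κ ε (fun x => (w x : ℂ)) x := by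
    rw [lpBlock_eq_tp, ← tp_fcoef_eq_conv hκ ε _ hc]
    · simp only [hmul, fcoefR]
    · simpa [hmul] using (annSupp_lpMul L n 1).fin
  obtain ⟨N, hN0, hN⟩ := exists_norm_bound hc
  -- The annular kernel has mean zero, so only increments of w enter, each of size at most Mε‖y‖.
  have h2 : conv L κ ε (fun x => (w x : ℂ)) x
      = ∫ y, κ y * ((w (x + proj L (ε • y)) : ℂ) - w x) := by
    simp only [mul_sub]
    rw [integral_sub (integrable_conv hκ.int hc hN ε x) (hκ.int.mul_const _), integral_mul_const,
      hκ.integral_eq, annulus_zero, zero_mul, sub_zero, conv]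
  rw [h1, h2]
  have h3 : ∀ y, ‖κ y * ((w (x + proj L (ε • y)) : ℂ) - w x)‖ ≤ ‖y‖ * ‖κ y‖ * (M * ε) := by
    intro y
    have h4 := h.hol x (ε • y)
    rw [Real.rpow_one, norm_smul, Real.norm_of_nonneg hε0.le] at h4
    rw [norm_mul, ← Complex.ofReal_sub, Complex.norm_real, Real.norm_eq_abs]
    calc _ ≤ ‖κ y‖ * (M * (ε * ‖y‖)) := by gcongr
      _ = _ := by ring
  refine (norm_integral_le_of_norm_le (hκ1.mul_const _) (Eventually.of_forall h3)).trans ?_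
  rw [integral_mul_const]
  have h5 : ε = (2 : ℝ) ^ (-1 * (n : ℝ)) := by
    have := inv_two_pow_rpow n 1
    rw [Real.rpow_one] at this
    rw [hε, this]; ring_nf
  rw [← h5]
  have : 0 ≤ 2 * lowConst * (M * ε) := by positivity
  nlinarith

end Reconstruction

section C1

variable {L : ℝ} [hL : Fact (0 < L)] {w : Torus L → ℝ}

omit hL in
lemma IsC.contDiff_lift {n : WithTop ℕ∞} (h : IsC n w) :
    ContDiff ℝ n fun y : Pln => w (proj L y) :=
  ContDiff.comp (g := torusLift w) h (PiLp.contDiff_ofLp)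

omit hL in
lemma isC_of_contDiff_lift {n : WithTop ℕ∞} (h : ContDiff ℝ n fun y : Pln => w (proj L y)) :
    IsC n w := ContDiff.comp (g := fun y : Pln => w (proj L y)) h (PiLp.contDiff_toLp)

omit hL in
lemma proj_single (i : Fin 2) (τ : ℝ) :
    proj L (EuclideanSpace.single i τ) = Pi.single i (τ : AddCircle L) := by
  ext j
  by_cases h : j = i
  · subst h; simp [proj]
  · simp [proj, h]

omit hL in
lemma IsC.continuous (h : IsC 1 w) : Continuous w :=
  continuous_of_comp_proj L h.contDiff_lift.continuous

omit hL in
/-- The derivative of a `C¹` function along a line. -/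
lemma IsC.hasDerivAt (h : IsC 1 w) (x : Torus L) (y : Pln) (t : ℝ) :
    HasDerivAt (fun t : ℝ => w (x + proj L (t • y)))
      (∑ i, y i * pderiv i w (x + proj L (t • y))) t := by
  obtain ⟨z, rfl⟩ := proj_surjective L x
  set W : Pln → ℝ := fun y => w (proj L y) with hW
  have hd : Differentiable ℝ W := h.contDiff_lift.differentiable (by norm_num)
  have hp : ∀ (v : Pln) i, pderiv i w (proj L v) = fderiv ℝ W v (EuclideanSpace.single i 1) := by
    intro v i
    have h1 : HasDerivAt (fun τ : ℝ => v + τ • EuclideanSpace.single i (1 : ℝ))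
        (EuclideanSpace.single i 1) 0 := by
      simpa using ((hasDerivAt_id (0 : ℝ)).smul_const (EuclideanSpace.single i (1 : ℝ))).const_add v
    have h2 : HasFDerivAt W (fderiv ℝ W v) (v + (0 : ℝ) • EuclideanSpace.single i (1 : ℝ)) := by
      simpa using (hd v).hasFDerivAt
    have h3 := h2.comp_hasDerivAt (0 : ℝ) h1
    rw [pderiv, ← h3.deriv]
    congr 1
    ext τ
    simp only [Function.comp, hW, proj_add]
    congr 2
    rw [← proj_single]
    congr 1
    ext j
    by_cases hj : j = i
    · subst hj; simp
    · simp [hj]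
  have h1 : HasDerivAt (fun t : ℝ => z + t • y) y t := by
    simpa using ((hasDerivAt_id t).smul_const y).const_add z
  have h2 := (hd (z + t • y)).hasFDerivAt.comp_hasDerivAt t h1
  have h3 : fderiv ℝ W (z + t • y) y = ∑ i, y i * pderiv i w (proj L z + proj L (t • y)) := by
    rw [← proj_add]
    simp only [hp]
    have : y = ∑ i, y i • EuclideanSpace.single i (1 : ℝ) := by
      ext j
      fin_cases j <;> simp
    conv_lhs => arg 2; rw [this]
    simp only [map_sum, map_smul, smul_eq_mul]
  rw [← h3]
  refine h2.congr_of_eventuallyEq (Eventually.of_forall fun s => ?_)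
  simp [hW]

omit hL in
lemma IsC.continuous_pderiv (h : IsC 1 w) (i : Fin 2) : Continuous (pderiv i w) := by
  refine continuous_of_comp_proj L ?_
  have hd := h.contDiff_lift
  have h1 : (fun y : Pln => pderiv i w (proj L y)) = fun y =>
      fderiv ℝ (fun y : Pln => w (proj L y)) y (EuclideanSpace.single i 1) := by
    ext y
    have h2 := h.hasDerivAt (proj L y) (EuclideanSpace.single i 1) 0
    have h3 : HasDerivAt (fun τ : ℝ => y + τ • EuclideanSpace.single i (1 : ℝ))
        (EuclideanSpace.single i 1) 0 := by
      simpa using ((hasDerivAt_id (0 : ℝ)).smul_const (EuclideanSpace.single i (1 : ℝ))).const_add y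
    have h4 : HasFDerivAt (fun y : Pln => w (proj L y)) (fderiv ℝ (fun y : Pln => w (proj L y)) y)
        (y + (0 : ℝ) • EuclideanSpace.single i (1 : ℝ)) := by
      simpa using (hd.differentiable (by norm_num) y).hasFDerivAt
    have h5 := h4.comp_hasDerivAt (0 : ℝ) h3
    have h6 : (fun t : ℝ => w (proj L y + proj L (t • EuclideanSpace.single i (1 : ℝ))))
        = ((fun y : Pln => w (proj L y)) ∘ fun τ : ℝ => y + τ • EuclideanSpace.single i (1 : ℝ)) := by
      ext t; simp
    rw [h6] at h2
    have h7 := h2.unique h5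
    rw [← h7, Finset.sum_eq_single i]
    · simp
    · intro j _ hj; simp [hj]
    · simp
  rw [h1]
  exact (hd.continuous_fderiv (by norm_num)).clm_apply continuous_const

omit hL in
lemma IsC.continuous_gradSq (h : IsC 1 w) : Continuous (gradSq w) :=
  continuous_finsetSum _ fun i _ => (h.continuous_pderiv i).pow 2

omit hL in
lemma gradSq_nonneg (w : Torus L → ℝ) (x : Torus L) : 0 ≤ gradSq w x :=
  Finset.sum_nonneg fun _ _ => sq_nonneg _

omit hL in
lemma abs_sum_mul_pderiv_le (w : Torus L → ℝ) (y : Pln) (x : Torus L) :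
    |∑ i, y i * pderiv i w x| ≤ ‖y‖ * Real.sqrt (gradSq w x) := by
  rw [← Real.sqrt_sq_eq_abs, ← Real.sqrt_sq (norm_nonneg y), ← Real.sqrt_mul (sq_nonneg _)]
  refine Real.sqrt_le_sqrt ?_
  rw [EuclideanSpace.norm_sq_eq]
  simp only [Fin.sum_univ_two, gradSq, Real.norm_eq_abs, sq_abs]
  nlinarith [sq_nonneg (y 0 * pderiv 1 w x - y 1 * pderiv 0 w x)]

/-- `L¹` modulus of continuity of a `C¹` function. -/
lemma IsC.integral_shift_sub_le (h : IsC 1 w) (y : Pln) :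
    ∫ x, |w (x + proj L y) - w x| ≤ ‖y‖ * ∫ x, Real.sqrt (gradSq w x) := by
  have hg : Continuous fun x => Real.sqrt (gradSq w x) := h.continuous_gradSq.sqrt
  have hpc : ∀ x, Continuous fun t : ℝ => x + proj L (t • y) := fun x =>
    continuous_const.add ((continuous_proj L).comp (continuous_id.smul continuous_const))
  have h1 : ∀ x, |w (x + proj L y) - w x| ≤
      ∫ t in (0 : ℝ)..1, ‖y‖ * Real.sqrt (gradSq w (x + proj L (t • y))) := by
    intro x
    have hD : ∀ t ∈ Set.uIcc (0 : ℝ) 1, HasDerivAt (fun t : ℝ => w (x + proj L (t • y)))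
        (∑ i, y i * pderiv i w (x + proj L (t • y))) t := fun t _ => h.hasDerivAt x y t
    have hDc : Continuous fun t : ℝ => ∑ i, y i * pderiv i w (x + proj L (t • y)) :=
      continuous_finsetSum _ fun i _ => continuous_const.mul ((h.continuous_pderiv i).comp (hpc x))
    have h2 := intervalIntegral.integral_eq_sub_of_hasDerivAt hD (hDc.intervalIntegrable _ _)
    simp only [one_smul, zero_smul, proj_zero, add_zero] at h2
    rw [← h2, ← Real.norm_eq_abs]
    refine intervalIntegral.norm_integral_le_of_norm_le zero_le_one
      (Eventually.of_forall fun t _ => ?_)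
      ((continuous_const.mul (hg.comp (hpc x))).intervalIntegrable _ _)
    exact abs_sum_mul_pderiv_le w y _
  have hcont2 : Continuous fun p : Torus L × ℝ =>
      ‖y‖ * Real.sqrt (gradSq w (p.1 + proj L (p.2 • y))) :=
    continuous_const.mul (hg.comp (continuous_fst.add ((continuous_proj L).comp
      (continuous_snd.smul continuous_const))))
  calc ∫ x, |w (x + proj L y) - w x|
      ≤ ∫ x, ∫ t in (0 : ℝ)..1, ‖y‖ * Real.sqrt (gradSq w (x + proj L (t • y))) := by
        refine integral_mono (integrable_of_cont L (((h.continuous.comp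
          (continuous_id.add continuous_const)).sub h.continuous).abs)) ?_ h1
        refine integrable_of_cont L ?_
        exact intervalIntegral.continuous_parametric_intervalIntegral_of_continuous' hcont2 0 1
    _ = ∫ t in (0 : ℝ)..1, ∫ x, ‖y‖ * Real.sqrt (gradSq w (x + proj L (t • y))) := by
        simp only [intervalIntegral.integral_of_le zero_le_one]
        refine integral_integral_swap ?_
        obtain ⟨M, hM0, hM⟩ := exists_norm_bound hg
        refine Integrable.of_bound hcont2.aestronglyMeasurable (‖y‖ * M)
          (Eventually.of_forall fun p => ?_)
        show ‖‖y‖ * Real.sqrt (gradSq w (p.1 + proj L (p.2 • y)))‖ ≤ _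
        rw [norm_mul, norm_norm]
        exact mul_le_mul_of_nonneg_left (hM _) (norm_nonneg _)
    _ = ∫ t in (0 : ℝ)..1, ‖y‖ * ∫ x, Real.sqrt (gradSq w x) := by
        congr 1
        ext t
        rw [integral_const_mul,
          integral_shift L (fun x => Real.sqrt (gradSq w x)) (proj L (t • y))]
    _ = _ := by simp

/-- Functions of Besov regularity larger than `1` are of class `C¹`. -/
lemma isC_one_of_blockBound (hw : Continuous w) {κ U : ℝ} (hκ : 0 < κ)
    (h : BlockBound L (-(1 + κ)) U (fcoefR L w)) :
    IsC 1 w ∧ (∀ x, |w x| ≤ U * geo κ) ∧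
      ∀ i x, |pderiv i w x| ≤ lipConst * U * geo κ := by
  have hc : Continuous fun x => (w x : ℂ) := Complex.continuous_ofReal.comp hw
  have hU := h.nonneg
  have hlip := lipConst_nonneg
  have hs : ∀ x, HasSum (fun n => lpBlock L n (fcoefR L w) x) (w x : ℂ) := fun x =>
    hasSum_lpBlock hc (h.summable (by linarith) x)
  have hpow : ∀ n : ℕ, (2 : ℝ) ^ n * (2 : ℝ) ^ (-(1 + κ) * n) = (2 : ℝ) ^ (-(κ * n)) := fun n => by
    rw [← Real.rpow_natCast, ← Real.rpow_add (by norm_num)]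
    ring_nf
  have hle : ∀ n : ℕ, (2 : ℝ) ^ (-(1 + κ) * n) ≤ (2 : ℝ) ^ (-(κ * n)) := fun n =>
    Real.rpow_le_rpow_of_exponent_le (by norm_num) (by nlinarith [(Nat.cast_nonneg n : (0 : ℝ) ≤ n)])
  have hlipn : ∀ n x (y : Pln), ‖lpBlock L n (fcoefR L w) (x + proj L y)
      - lpBlock L n (fcoefR L w) x‖ ≤ lipConst * U * (2 : ℝ) ^ (-(κ * n)) * ‖y‖ := by
    intro n x y
    refine (lpBlock_lipschitz (h n) x y).trans_eq ?_
    rw [← hpow]; ring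
  have hlipw : ∀ x (y : Pln), |w (x + proj L y) - w x| ≤ lipConst * U * geo κ * ‖y‖ := by
    intro x y
    have h1 := ((hs (x + proj L y)).sub (hs x)).norm_le_of_bounded
      (((summable_geo hκ).mul_left (lipConst * U * ‖y‖)).hasSum) fun n =>
        (hlipn n x y).trans_eq (by ring)
    rw [tsum_mul_left, ← Complex.ofReal_sub, Complex.norm_real] at h1
    exact h1.trans_eq (by rw [geo]; ring)
  have hC1 : IsC 1 w := by
    refine isC_of_contDiff_lift ?_
    have hF : ∀ n, ContDiff ℝ 1 fun y : Pln => lpBlock L n (fcoefR L w) (proj L y) := by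
      intro n
      simp only [lpBlock_eq_sum, torusChar_proj]
      refine ContDiff.sum fun k _ => contDiff_const.mul ?_
      refine ContDiff.cexp (contDiff_const.mul ?_)
      exact Complex.ofRealCLM.contDiff.comp (contDiff_id.inner ℝ contDiff_const)
    -- Termwise differentiation: the Lipschitz constant of block n is at most a multiple of 2^n
    -- 2^{-(1+κ)n} = 2^{-κn}, which is summable.
    have h1 : ContDiff ℝ (1 : ℕ∞) fun y : Pln => ∑' n, lpBlock L n (fcoefR L w) (proj L y) := by
      refine contDiff_tsum (𝕜 := ℝ) (v := fun (j n : ℕ) => (1 + lipConst) * U * (2 : ℝ) ^ (-(κ * n)))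
        hF (fun j _ => (summable_geo hκ).mul_left _) ?_
      intro j n y hj
      have hj' : j ≤ 1 := by exact_mod_cast hj
      interval_cases j
      · rw [norm_iteratedFDeriv_zero]
        refine (h n _).trans ?_
        calc U * (2 : ℝ) ^ (-(1 + κ) * n) ≤ (U + lipConst * U) * (2 : ℝ) ^ (-(κ * n)) := by
              refine mul_le_mul ?_ (hle n) (by positivity) (by positivity)
              linarith [mul_nonneg hlip hU]
          _ = _ := by ring
      · rw [norm_iteratedFDeriv_one]
        refine norm_fderiv_le_of_lip' (𝕜 := ℝ) (by positivity) (Eventually.of_forall fun z => ?_)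
        have h2 := hlipn n (proj L y) (z - y)
        rw [← proj_add, add_sub_cancel] at h2
        refine h2.trans ?_
        have : 0 ≤ U * (2 : ℝ) ^ (-(κ * n)) * ‖z - y‖ := by positivity
        nlinarith
    have h2 : (fun y : Pln => w (proj L y))
        = fun y => (∑' n, lpBlock L n (fcoefR L w) (proj L y)).re := by
      ext y
      rw [(hs (proj L y)).tsum_eq, Complex.ofReal_re]
    rw [h2]
    exact Complex.reCLM.contDiff.comp h1
  refine ⟨hC1, fun x => ?_, fun i x => ?_⟩
  · have h1 := (hs x).norm_le_of_bounded (((summable_geo hκ).mul_left U).hasSum) fun n =>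
      (h n x).trans (mul_le_mul_of_nonneg_left (hle n) hU)
    rw [tsum_mul_left, Complex.norm_real] at h1
    exact h1
  · rw [pderiv, ← Real.norm_eq_abs]
    have hg := geo_nonneg κ
    refine norm_deriv_le_of_lip' (by positivity) (Eventually.of_forall fun τ => ?_)
    have h1 := hlipw x (EuclideanSpace.single i τ)
    rw [proj_single] at h1
    simpa using h1

/-- `C¹` functions are Lipschitz. -/
lemma IsC.exists_holB (h : IsC 1 w) : ∃ M, HolB 1 M w := by
  obtain ⟨M, hM0, hM⟩ := exists_norm_bound h.continuous
  obtain ⟨N, hN0, hN⟩ := exists_norm_bound h.continuous_gradSq.sqrt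
  refine ⟨M + N, h.continuous, fun x => (hM x).trans (by linarith), fun x y => ?_⟩
  have := norm_image_sub_le_of_norm_deriv_le_segment_01' (f := fun t : ℝ => w (x + proj L (t • y)))
    (C := N * ‖y‖) (fun t _ => (h.hasDerivAt x y t).hasDerivWithinAt) (fun t _ => by
      refine (abs_sum_mul_pderiv_le w y _).trans ?_
      rw [mul_comm]
      refine mul_le_mul_of_nonneg_right ?_ (norm_nonneg _)
      exact (le_abs_self _).trans (hN _))
  rw [Real.rpow_one]
  simp only [one_smul, zero_smul, proj_zero, add_zero] at this
  refine this.trans ?_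
  nlinarith [norm_nonneg y]

/-- Fourier coefficients of partial derivatives. -/
lemma IsC.fcoefR_pderiv (h : IsC 1 w) (i : Fin 2) (k : Freq) :
    fcoefR L (pderiv i w) k = Complex.I * (fvec L k i : ℂ) * fcoefR L w k := by
  set e : Pln := EuclideanSpace.single i 1 with he
  obtain ⟨N, hN0, hN⟩ := exists_norm_bound (h.continuous_pderiv i)
  have hwc : Continuous fun x => (w x : ℂ) := Complex.continuous_ofReal.comp h.continuous
  have hec : Continuous fun x => (starRingEnd ℂ) (torusChar L k x) :=
    Complex.continuous_conj.comp (continuous_torusChar L k)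
  have hsum : ∀ x, ∑ j, e j * pderiv j w x = pderiv i w x := by
    intro x
    rw [Finset.sum_eq_single i]
    · simp [he]
    · intro j _ hj; simp [he, hj]
    · simp
  have hd : ∀ x t, HasDerivAt (fun t : ℝ => (w (x + proj L (t • e)) : ℂ) *
      (starRingEnd ℂ) (torusChar L k x)) ((pderiv i w (x + proj L (t • e)) : ℂ) *
      (starRingEnd ℂ) (torusChar L k x)) t := by
    intro x t
    have h1 := h.hasDerivAt x e t
    rw [hsum] at h1
    exact h1.ofReal_comp.mul_const _
  have hsc : ∀ t : ℝ, Continuous fun x : Torus L => x + proj L (t • e) := fun t =>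
    continuous_id.add continuous_const
  have h4 := (hasDerivAt_integral_of_dominated_loc_of_deriv_le
    (μ := (volume : Measure (Torus L)))
    (F := fun (t : ℝ) x => (w (x + proj L (t • e)) : ℂ) * (starRingEnd ℂ) (torusChar L k x))
    (F' := fun (t : ℝ) x => (pderiv i w (x + proj L (t • e)) : ℂ) *
      (starRingEnd ℂ) (torusChar L k x))
    (x₀ := 0) (s := Set.univ) (bound := fun _ => N) univ_mem
    (Eventually.of_forall fun t => ((hwc.comp (hsc t)).mul hec).aestronglyMeasurable)
    (integrable_of_cont L ((hwc.comp (hsc 0)).mul hec))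
    (((Complex.continuous_ofReal.comp ((h.continuous_pderiv i).comp
      (hsc 0))).mul hec).aestronglyMeasurable)
    (Eventually.of_forall fun x t _ => by
      rw [norm_mul, RCLike.norm_conj, norm_torusChar, mul_one, Complex.norm_real]
      exact hN _)
    (integrable_const _)
    (Eventually.of_forall fun x t _ => hd x t)).2
  simp only [zero_smul, proj_zero, add_zero] at h4
  -- Integration by parts in disguise: by translation invariance the translate by te only
  -- contributes a phase, so the derivative at t = 0, already computed under the integral in `h4`,
  -- is the multiplier i k_i.
  have h5 : ∀ t : ℝ, ∫ x, (w (x + proj L (t • e)) : ℂ) * (starRingEnd ℂ) (torusChar L k x)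
      = (∫ x, (w x : ℂ) * (starRingEnd ℂ) (torusChar L k x)) *
        Complex.exp (Complex.I * ((t * fvec L k i : ℝ) : ℂ)) := by
    intro t
    rw [← integral_shift L (fun x => (w x : ℂ) * (starRingEnd ℂ) (torusChar L k x))
      (proj L (t • e)), ← integral_mul_const]
    refine integral_congr_ae (Eventually.of_forall fun x => ?_)
    have h6 : (⟪t • e, fvec L k⟫ : ℝ) = t * fvec L k i := by
      rw [real_inner_smul_left, he, EuclideanSpace.inner_single_left]; simp
    simp only [torusChar_shift, map_mul, h6]
    rw [mul_assoc, mul_assoc, ← Complex.exp_conj, ← Complex.exp_add]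
    simp
  simp only [h5] at h4
  have h6 : HasDerivAt (fun t : ℝ => (∫ x, (w x : ℂ) * (starRingEnd ℂ) (torusChar L k x)) *
      Complex.exp (Complex.I * ((t * fvec L k i : ℝ) : ℂ)))
      ((∫ x, (w x : ℂ) * (starRingEnd ℂ) (torusChar L k x)) * (Complex.I * (fvec L k i : ℂ))) 0 := by
    have h7 : HasDerivAt (fun t : ℝ => ((t * fvec L k i : ℝ) : ℂ)) (fvec L k i : ℂ) 0 := by
      apply HasDerivAt.ofReal_comp
      simpa using (hasDerivAt_id (0 : ℝ)).mul_const (fvec L k i)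
    refine (((h7.const_mul Complex.I).cexp).const_mul _).congr_deriv ?_
    simp
  have h7 := h4.unique h6
  simp only [fcoefR, fcoef]
  rw [h7]; ring

end C1

end Phi42

end

/-! ### Schauder estimate for mild solutions and size of the renormalization constant. -/

noncomputable section

namespace Phi42

section Singular

variable {s t p θ : ℝ}

/-- One of t - r and r - s is at least (t - s)/2, so only one of the two factors is singular at a
time. -/
lemma singular_le (hp : 0 ≤ p) (hθ : 0 ≤ θ) {r : ℝ} (hsr : s < r) (hrt : r < t) :
    (t - r) ^ (-p) * (r - s) ^ (-θ)
      ≤ ((t - s) / 2) ^ (-p) * (r - s) ^ (-θ) + ((t - s) / 2) ^ (-θ) * (t - r) ^ (-p) := by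
  have h1 : 0 < t - r := by linarith
  have h2 : 0 < r - s := by linarith
  have h3 : 0 < (t - s) / 2 := by linarith
  rcases le_total ((t - s) / 2) (t - r) with h | h
  · have := Real.rpow_le_rpow_of_nonpos h3 h (by linarith : -p ≤ 0)
    have h4 : 0 ≤ ((t - s) / 2) ^ (-θ) * (t - r) ^ (-p) := by positivity
    have h5 : 0 ≤ (r - s) ^ (-θ) := by positivity
    nlinarith
  · have h' : (t - s) / 2 ≤ r - s := by linarith
    have := Real.rpow_le_rpow_of_nonpos h3 h' (by linarith : -θ ≤ 0)
    have h4 : 0 ≤ ((t - s) / 2) ^ (-p) * (r - s) ^ (-θ) := by positivity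
    have h5 : 0 ≤ (t - r) ^ (-p) := by positivity
    nlinarith

lemma intervalIntegrable_sub_rpow (hθ : θ < 1) :
    IntervalIntegrable (fun r => (r - s) ^ (-θ)) volume s t := by
  have := (intervalIntegral.intervalIntegrable_rpow' (a := 0) (b := t - s)
    (by linarith : -1 < -θ)).comp_sub_right s
  simpa using this

lemma intervalIntegrable_sub_rpow' (hp : p < 1) :
    IntervalIntegrable (fun r => (t - r) ^ (-p)) volume s t := by
  have := (intervalIntegral.intervalIntegrable_rpow' (a := t - s) (b := 0)
    (by linarith : -1 < -p)).comp_sub_left t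
  simpa using this

/-- The constant in the singular convolution integral. -/
def singConst (p θ : ℝ) : ℝ := 2 ^ p / (1 - θ) + 2 ^ θ / (1 - p)

lemma singConst_nonneg (hp : p < 1) (hθ : θ < 1) : 0 ≤ singConst p θ := by
  have h1 : 0 < 1 - p := by linarith
  have h2 : 0 < 1 - θ := by linarith
  unfold singConst
  positivity

lemma integral_singular (hst : s < t) (hp : p < 1) (hθ : θ < 1) :
    ∫ r in s..t, (((t - s) / 2) ^ (-p) * (r - s) ^ (-θ) + ((t - s) / 2) ^ (-θ) * (t - r) ^ (-p))
      = singConst p θ * (t - s) ^ (1 - p - θ) := by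
  have h0 : 0 < t - s := by linarith
  have hA : (t - s) ^ (1 - p - θ) = (t - s) ^ (-p) * ((t - s) ^ (-θ) * (t - s)) := by
    rw [show 1 - p - θ = -p + (-θ + 1) by ring, Real.rpow_add h0, Real.rpow_add h0, Real.rpow_one]
  have hB : (t - s) ^ (-p + 1) = (t - s) ^ (-p) * (t - s) := by rw [Real.rpow_add h0, Real.rpow_one]
  have hC : (t - s) ^ (-θ + 1) = (t - s) ^ (-θ) * (t - s) := by rw [Real.rpow_add h0, Real.rpow_one]
  rw [intervalIntegral.integral_add ((intervalIntegrable_sub_rpow hθ).const_mul _)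
    ((intervalIntegrable_sub_rpow' hp).const_mul _), intervalIntegral.integral_const_mul,
    intervalIntegral.integral_const_mul,
    intervalIntegral.integral_comp_sub_right (fun x => x ^ (-θ)) s,
    intervalIntegral.integral_comp_sub_left (fun x => x ^ (-p)) t, sub_self, sub_self,
    integral_rpow (Or.inl (by linarith)), integral_rpow (Or.inl (by linarith)),
    Real.zero_rpow (by linarith), Real.zero_rpow (by linarith), sub_zero, sub_zero,
    Real.div_rpow h0.le (by norm_num), Real.div_rpow h0.le (by norm_num), singConst,
    Real.rpow_neg (by norm_num : (0 : ℝ) ≤ 2), Real.rpow_neg (by norm_num : (0 : ℝ) ≤ 2), hA, hB, hC,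
    show -θ + 1 = 1 - θ by ring, show -p + 1 = 1 - p by ring]
  have h1 : 1 - p ≠ 0 := by linarith
  have h2 : 1 - θ ≠ 0 := by linarith
  field_simp

end Singular

section Mild

/-- The massive heat semigroup in Fourier variables. -/
def heatF (L m τ : ℝ) (u : TDist) : TDist := fun k =>
  (Real.exp (-τ * (m + freqSq L k)) : ℂ) * u k

/-- The constant of the smoothing estimate for dyadic blocks. -/
def heatConst : ℝ := exists_heat_block.choose

lemma heatConst_nonneg : 0 ≤ heatConst := exists_heat_block.choose_spec.1

variable {L : ℝ} [hL : Fact (0 < L)] {m : ℝ}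

/-- Interpolates between no gain and the gain (τ 4^n)^{-1}. Block 0 gains nothing from frequency;
there τ^p ≤ 1 + T makes up for the factor τ^{-p}. -/
lemma norm_lpBlock_heatF_le (hm : 0 ≤ m) {n : ℕ} {u : TDist} {P p τ T : ℝ}
    (hP : ∀ x, ‖lpBlock L n u x‖ ≤ P) (hτ : 0 < τ) (hT : τ ≤ T) (hp : 0 ≤ p) (hp' : p ≤ 1)
    (x : Torus L) : ‖lpBlock L n (heatF L m τ u) x‖
      ≤ heatConst * (1 + T) * τ ^ (-p) * (2 : ℝ) ^ (-(2 * p * n)) * P := by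
  have hP0 : 0 ≤ P := (norm_nonneg _).trans (hP 0)
  have hC := heatConst_nonneg
  have h1 : lpBlock L n (heatF L m τ u) x = (Real.exp (-τ * m) : ℂ) *
      tp L (fun k => (Real.exp (-τ * freqSq L k) : ℂ) * ((lpMul L n k : ℂ) * u k)) x := by
    rw [lpBlock_eq_tp, ← tp_smul]
    congr 1
    ext k
    simp only [heatF, Pi.smul_apply, smul_eq_mul, mul_add, Real.exp_add]
    push_cast
    ring
  obtain ⟨h2, h3⟩ := exists_heat_block.choose_spec.2 L n _ P τ (annSupp_lpMul L n u)
    (fun z => by rw [← lpBlock_eq_tp]; exact hP z) hτ x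
  rw [← heatConst] at h2 h3
  have h4 : ‖lpBlock L n (heatF L m τ u) x‖ ≤
      ‖tp L (fun k => (Real.exp (-τ * freqSq L k) : ℂ) * ((lpMul L n k : ℂ) * u k)) x‖ := by
    rw [h1, norm_mul, Complex.norm_real, Real.norm_of_nonneg (Real.exp_pos _).le]
    refine mul_le_of_le_one_left (norm_nonneg _) (Real.exp_le_one_iff.2 ?_)
    nlinarith
  refine h4.trans ?_
  rcases eq_or_ne n 0 with rfl | hn
  · have h5 : 1 ≤ (1 + T) * τ ^ (-p) := by
      rw [Real.rpow_neg hτ.le, ← div_eq_mul_inv, one_le_div (by positivity)]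
      exact (rpow_le_one_add hτ.le hp hp').trans (by linarith)
    simp only [CharP.cast_eq_zero, mul_zero, neg_zero, Real.rpow_zero, mul_one]
    calc _ ≤ heatConst * P := h2
      _ ≤ heatConst * P * ((1 + T) * τ ^ (-p)) := le_mul_of_one_le_right (by positivity) h5
      _ = _ := by ring
  · have hx : 0 ≤ (τ * 4 ^ n)⁻¹ := by positivity
    have h5 : ‖tp L (fun k => (Real.exp (-τ * freqSq L k) : ℂ) * ((lpMul L n k : ℂ) * u k)) x‖
        ≤ heatConst * P * min 1 (τ * 4 ^ n)⁻¹ := by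
      rcases le_total 1 (τ * 4 ^ n)⁻¹ with h | h
      · rw [min_eq_left h]; linarith
      · rw [min_eq_right h]; linarith [h3 hn]
    have h6 := min_one_le_rpow hx hp hp'
    have h7 : ((τ * 4 ^ n)⁻¹) ^ p = τ ^ (-p) * (2 : ℝ) ^ (-(2 * p * n)) := by
      rw [Real.inv_rpow (by positivity), ← Real.rpow_neg (by positivity),
        Real.mul_rpow hτ.le (by positivity)]
      congr 1
      rw [show (4 : ℝ) = 2 ^ (2 : ℝ) by norm_num, ← Real.rpow_natCast,
        ← Real.rpow_mul (by norm_num), ← Real.rpow_mul (by norm_num)]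
      ring_nf
    rw [h7] at h6
    have hT0 : 0 ≤ T := hτ.le.trans hT
    calc _ ≤ heatConst * P * (τ ^ (-p) * (2 : ℝ) ^ (-(2 * p * n))) := h5.trans (by gcongr)
      _ ≤ heatConst * P * (τ ^ (-p) * (2 : ℝ) ^ (-(2 * p * n))) * (1 + T) :=
        le_mul_of_one_le_right (by positivity) (by linarith)
      _ = _ := by ring

omit hL in
lemma intervalIntegrable_heat {s t : ℝ} {F : ℝ → TDist} {k : Freq}
    (h : IntervalIntegrable (fun r => F r k) volume s t) :
    IntervalIntegrable (fun r => (Real.exp (-(t - r) * (m + freqSq L k)) : ℂ) * F r k)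
      volume s t :=
  h.continuousOn_mul (by fun_prop)

lemma IsMild.lpBlock_eq {s t : ℝ} {u₀ : TDist} {F : ℝ → TDist} {w : ℝ → Torus L → ℝ}
    (h : IsMild L m s u₀ F w) (hst : s < t) (n : ℕ) (x : Torus L) :
    lpBlock L n (fcoefR L (w t)) x = lpBlock L n (heatF L m (t - s) u₀) x +
      ∫ r in s..t, lpBlock L n (heatF L m (t - r) (F r)) x := by
  simp only [lpBlock_eq_sum]
  rw [intervalIntegral.integral_finsetSum, ← Finset.sum_add_distrib]
  · refine Finset.sum_congr rfl fun k _ => ?_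
    rw [(h t hst k).2, intervalIntegral.integral_mul_const, intervalIntegral.integral_const_mul]
    simp only [heatF]
    ring
  · intro k _
    exact ((intervalIntegrable_heat (h t hst k).1).const_mul _).mul_const _

/-- Schauder estimate for mild solutions, with blow-up at the initial time. -/
lemma IsMild.blockBound {s t T : ℝ} {u₀ : TDist} {F : ℝ → TDist} {w : ℝ → Torus L → ℝ}
    (h : IsMild L m s u₀ F w) (hm : 0 ≤ m) (hst : s < t) (hT : t - s ≤ T) {σ ρ b θ U K : ℝ}
    (hu : BlockBound L (-σ) U u₀)
    (hF : ∀ r, s < r → r < t → BlockBound L b (K * (r - s) ^ (-θ)) (F r))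
    (hθ : 0 ≤ θ) (hθ' : θ < 1) (h1 : σ ≤ ρ) (h2 : ρ - σ ≤ 2) (h3 : 0 ≤ ρ + b) (h4 : ρ + b < 2) :
    BlockBound L (-ρ) (heatConst * (1 + T) * (U * (t - s) ^ (-((ρ - σ) / 2)) +
      K * (singConst ((ρ + b) / 2) θ * (t - s) ^ (1 - (ρ + b) / 2 - θ)))) (fcoefR L (w t)) := by
  intro n x
  have hC := heatConst_nonneg
  have hst0 : 0 < t - s := by linarith
  have hK : 0 ≤ K := by
    have h5 := (hF ((s + t) / 2) (by linarith) (by linarith)).nonneg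
    have h6 : 0 < ((s + t) / 2 - s) ^ (-θ) := Real.rpow_pos_of_pos (by linarith) _
    exact nonneg_of_mul_nonneg_left h5 h6
  rw [h.lpBlock_eq hst n x]
  have hA := norm_lpBlock_heatF_le (L := L) hm (hu n) hst0 hT
    (by linarith : 0 ≤ (ρ - σ) / 2) (by linarith) x
  -- Passing from growth b to regularity ρ costs the time singularity (t-r)^{-p}, integrable exactly
  -- because ρ + b < 2.
  set p := (ρ + b) / 2 with hp
  have hpow1 : (2 : ℝ) ^ (-(2 * ((ρ - σ) / 2) * (n : ℝ))) * (2 : ℝ) ^ (-σ * (n : ℝ))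
      = (2 : ℝ) ^ (-ρ * (n : ℝ)) := by
    rw [← Real.rpow_add (by norm_num)]; ring_nf
  have hpow2 : (2 : ℝ) ^ (-(2 * p * (n : ℝ))) * (2 : ℝ) ^ (b * (n : ℝ))
      = (2 : ℝ) ^ (-ρ * (n : ℝ)) := by
    rw [← Real.rpow_add (by norm_num), hp]; ring_nf
  have hB : ‖∫ r in s..t, lpBlock L n (heatF L m (t - r) (F r)) x‖ ≤
      heatConst * (1 + T) * K * (2 : ℝ) ^ (-ρ * (n : ℝ)) *
        (singConst p θ * (t - s) ^ (1 - p - θ)) := by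
    rw [← integral_singular hst (by linarith : p < 1) hθ', ← intervalIntegral.integral_const_mul]
    refine intervalIntegral.norm_integral_le_of_norm_le hst.le ?_ ?_
    -- The smoothing estimate needs t - r > 0, so the endpoint r = t is discarded as a null set.
    · have hne : ∀ᵐ r : ℝ, r ≠ t := compl_mem_ae_iff.2 (measure_singleton t)
      filter_upwards [hne] with r hrt hr
      have hr' : r < t := lt_of_le_of_ne hr.2 hrt
      have h5 := norm_lpBlock_heatF_le (L := L) hm (hF r hr.1 hr' n) (by linarith : 0 < t - r)
        (by linarith [hr.1] : t - r ≤ T) (by linarith : 0 ≤ p) (by linarith) x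
      have h6 := singular_le (p := p) (by linarith) hθ hr.1 hr'
      have hT0 : 0 ≤ T := hst0.le.trans hT
      calc _ ≤ _ := h5
        _ = heatConst * (1 + T) * K * ((2 : ℝ) ^ (-(2 * p * (n : ℝ))) * (2 : ℝ) ^ (b * (n : ℝ))) *
            ((t - r) ^ (-p) * (r - s) ^ (-θ)) := by ring
        _ ≤ _ := by rw [hpow2]; gcongr
    · exact (((intervalIntegrable_sub_rpow hθ').const_mul _).add
        ((intervalIntegrable_sub_rpow' (by linarith)).const_mul _)).const_mul _
  refine (norm_add_le _ _).trans ((add_le_add hA hB).trans_eq ?_)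
  calc _ = heatConst * (1 + T) * U * (t - s) ^ (-((ρ - σ) / 2)) *
        ((2 : ℝ) ^ (-(2 * ((ρ - σ) / 2) * (n : ℝ))) * (2 : ℝ) ^ (-σ * (n : ℝ))) +
        heatConst * (1 + T) * K * (2 : ℝ) ^ (-ρ * (n : ℝ)) *
        (singConst p θ * (t - s) ^ (1 - p - θ)) := by ring
    _ = _ := by rw [hpow1]; ring

end Mild

section RenormalizationConstant

variable (L : ℝ) [hL : Fact (0 < L)] {m : ℝ}

lemma exp_neg_le_rpow {x ε : ℝ} (hx : 0 < x) (hε : 0 ≤ ε) (hε' : ε ≤ 1) :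
    Real.exp (-x) ≤ 2 * x ^ (-(1 + ε)) := by
  have h1 : x ^ (1 + ε) ≤ 2 * Real.exp x := by
    have h2 := Real.quadratic_le_exp_of_nonneg hx.le
    rcases le_total x 1 with h | h
    · have := Real.rpow_le_one hx.le h (by linarith : 0 ≤ 1 + ε)
      nlinarith
    · have := Real.rpow_le_rpow_of_exponent_le h (by linarith : 1 + ε ≤ (2 : ℝ))
      rw [Real.rpow_two] at this
      nlinarith
  rw [Real.exp_neg, Real.rpow_neg hx.le, ← div_eq_mul_inv, inv_eq_one_div,
    div_le_div_iff₀ (Real.exp_pos x) (by positivity)]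
  linarith

/-- For k ≠ 0 the summand is at most a multiple of ‖k‖^{-2(1+ε)}, summable over a lattice of rank 2
because 2(1+ε) > 2. -/
lemma summable_inv_mass (hm : 0 < m) {ε : ℝ} (hε : 0 < ε) :
    Summable fun k : Freq => (m + freqSq L k) ^ (-(1 + ε)) := by
  have hLp := hL.out
  set c : ℝ := (2 * Real.pi / L) ^ 2 with hc
  have hc0 : 0 < c := by have := Real.pi_pos; positivity
  have h1 := (EisensteinSeries.summable_one_div_norm_rpow
    (by linarith : 2 < 2 * (1 + ε))).mul_left (c ^ (-(1 + ε)))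
  refine Summable.of_norm_bounded_eventually h1 ?_
  have hfin : {k : Freq | k ≠ 0}ᶜ.Finite := by
    refine (Set.finite_singleton (0 : Freq)).subset fun k hk => ?_
    simpa using hk
  filter_upwards [(show {k : Freq | k ≠ 0} ∈ cofinite from hfin)] with k hk
  have hkn : 0 < ‖k‖ := norm_pos_iff.2 hk
  have h2 : c * ‖k‖ ^ 2 ≤ m + freqSq L k := by
    have h3 : ∀ i, c * ‖k i‖ ^ 2 ≤ freqSq L k := by
      intro i
      have h4 : c * ‖k i‖ ^ 2 = (2 * Real.pi * (k i : ℝ) / L) ^ 2 := by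
        rw [Int.norm_eq_abs, sq_abs, hc]; ring
      rw [h4]
      exact Finset.single_le_sum (f := fun i => (2 * Real.pi * (k i : ℝ) / L) ^ 2)
        (fun i _ => sq_nonneg _) (Finset.mem_univ i)
    obtain ⟨i, hi⟩ : ∃ i, ‖k‖ = ‖k i‖ := by
      obtain ⟨i, -, hi⟩ := Finset.exists_mem_eq_sup' (s := (Finset.univ : Finset (Fin 2)))
        Finset.univ_nonempty (fun i => ‖k i‖₊)
      refine ⟨i, ?_⟩
      rw [Finset.sup'_eq_sup] at hi
      rw [Pi.norm_def, hi, coe_nnnorm]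
    rw [hi]
    linarith [h3 i]
  have h5 := Real.rpow_le_rpow_of_nonpos (by positivity) h2 (by linarith : -(1 + ε) ≤ 0)
  rw [Real.norm_of_nonneg (Real.rpow_nonneg (by linarith [freqSq_nonneg L k]) _)]
  refine h5.trans_eq ?_
  rw [Real.mul_rpow hc0.le (by positivity), ← Real.rpow_natCast, ← Real.rpow_mul hkn.le]
  push_cast
  ring_nf

lemma summable_heatKernel (hm : 0 < m) {r : ℝ} (hr : 0 < r) :
    Summable fun k : Freq => (L ^ 2)⁻¹ * Real.exp (-r * (m + freqSq L k)) := by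
  refine Summable.mul_left _ ?_
  refine Summable.of_nonneg_of_le (fun k => (Real.exp_pos _).le) (fun k => ?_)
    ((summable_inv_mass L hm (ε := 1) one_pos).mul_left (2 * r ^ (-(1 + 1 : ℝ))))
  have hk : 0 < m + freqSq L k := by linarith [freqSq_nonneg L k]
  have := exp_neg_le_rpow (x := r * (m + freqSq L k)) (by positivity) zero_le_one le_rfl
  rw [Real.mul_rpow hr.le hk.le] at this
  rw [neg_mul]
  linarith

omit hL in
lemma heatKernel_zero (m r : ℝ) :
    heatKernel L m r 0 = ∑' k : Freq, (L ^ 2)⁻¹ * Real.exp (-r * (m + freqSq L k)) := by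
  have h0 : ∀ k : Freq, torusChar L k 0 = 1 := fun k => by
    have := torusChar_proj L k 0
    simpa using this
  simp only [heatKernel, h0, mul_one]
  rw [← Complex.ofReal_tsum, Complex.ofReal_re]

omit hL in
lemma heatKernel_zero_nonneg (m r : ℝ) : 0 ≤ heatKernel L m r 0 := by
  rw [heatKernel_zero L m r]
  exact tsum_nonneg fun k => by positivity

lemma heatKernel_zero_antitone (hm : 0 < m) :
    AntitoneOn (fun r => heatKernel L m (2 * r) 0) (Set.Ioi 0) := by
  intro r hr r' hr' hrr'
  have h1 : (0 : ℝ) < 2 * r := by have : (0 : ℝ) < r := hr; linarith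
  have h2 : (0 : ℝ) < 2 * r' := by have : (0 : ℝ) < r' := hr'; linarith
  simp only
  rw [heatKernel_zero, heatKernel_zero]
  refine (summable_heatKernel L hm h2).tsum_le_tsum (fun k => ?_) (summable_heatKernel L hm h1)
  have hk : 0 < m + freqSq L k := by linarith [freqSq_nonneg L k]
  gcongr ?_ * Real.exp ?_
  nlinarith

/-- Bounding each exponential by a power slightly beyond -1 makes the frequency sum converge. The
loss r^{-ε} against the true r^{-1} turns the logarithm in the renormalization constant into an
arbitrarily small power, which is all that is needed. -/
lemma heatKernel_zero_le (hm : 0 < m) {ε : ℝ} (hε : 0 < ε) (hε' : ε ≤ 1) :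
    ∃ D, 0 ≤ D ∧ ∀ r, 0 < r → heatKernel L m (2 * r) 0 ≤ D * r ^ (-(1 + ε)) := by
  have hs := summable_inv_mass L hm hε
  refine ⟨(L ^ 2)⁻¹ * (2 * 2 ^ (-(1 + ε)) * ∑' k : Freq, (m + freqSq L k) ^ (-(1 + ε))), ?_, ?_⟩
  · have : 0 ≤ ∑' k : Freq, (m + freqSq L k) ^ (-(1 + ε)) :=
      tsum_nonneg fun k => Real.rpow_nonneg (by linarith [freqSq_nonneg L k]) _
    positivity
  intro r hr
  have h2r : 0 < 2 * r := by linarith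
  rw [heatKernel_zero, tsum_mul_left, mul_assoc]
  refine mul_le_mul_of_nonneg_left ?_ (by positivity)
  rw [← tsum_mul_left, ← tsum_mul_right]
  have hs2 := summable_heatKernel L hm h2r
  rw [summable_mul_left_iff (by have := hL.out; positivity)] at hs2
  refine hs2.tsum_le_tsum (fun k => ?_) ((hs.mul_left _).mul_right _)
  have hk : 0 < m + freqSq L k := by linarith [freqSq_nonneg L k]
  have := exp_neg_le_rpow (x := 2 * r * (m + freqSq L k)) (by positivity) hε.le hε'
  rw [Real.mul_rpow h2r.le hk.le, Real.mul_rpow (by norm_num) hr.le] at this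
  rw [neg_mul]
  linarith

/-- Near the diagonal the renormalization constant is smaller than every negative power. -/
lemma cInf_bound (hm : 0 < m) {ε : ℝ} (hε : 0 < ε) (hε' : ε ≤ 1) :
    (∀ t, 0 < t → 0 ≤ cInf L m t) ∧ AntitoneOn (cInf L m) (Set.Ioi 0) ∧
      ∃ D, 0 ≤ D ∧ ∀ t, 0 < t → cInf L m t ≤ D * t ^ (-ε) := by
  obtain ⟨D, hD, hle⟩ := heatKernel_zero_le L hm hε hε'
  have hnn : ∀ r, 0 < r → 0 ≤ heatKernel L m (2 * r) 0 := fun r _ =>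
    heatKernel_zero_nonneg L m (2 * r)
  have hint : ∀ t, 0 < t → IntegrableOn (fun r => heatKernel L m (2 * r) 0) (Set.Ioi t) := by
    intro t ht
    have h1 : IntegrableOn (fun r : ℝ => D * r ^ (-(1 + ε))) (Set.Ioi t) :=
      (integrableOn_Ioi_rpow_of_lt (by linarith) ht).const_mul D
    refine Integrable.mono' h1 ?_ ?_
    · exact (aemeasurable_restrict_of_antitoneOn measurableSet_Ioi
        ((heatKernel_zero_antitone L hm).mono (Set.Ioi_subset_Ioi ht.le))).aestronglyMeasurable
    · refine (ae_restrict_iff' measurableSet_Ioi).2 (Eventually.of_forall fun r hr => ?_)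
      have hr0 : 0 < r := ht.trans hr
      rw [Real.norm_of_nonneg (hnn r hr0)]
      exact hle r hr0
  refine ⟨fun t ht => ?_, fun t ht t' ht' htt' => ?_, 2 * (D / ε), by positivity, fun t ht => ?_⟩
  · exact mul_nonneg zero_le_two (setIntegral_nonneg measurableSet_Ioi fun r hr =>
      hnn r (ht.trans hr))
  · refine mul_le_mul_of_nonneg_left ?_ zero_le_two
    refine setIntegral_mono_set (hint t ht) ?_ (Eventually.of_forall (Set.Ioi_subset_Ioi htt'))
    exact (ae_restrict_iff' measurableSet_Ioi).2 (Eventually.of_forall fun r hr =>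
      hnn r (lt_trans ht hr))
  · have h1 : ∫ r in Set.Ioi t, heatKernel L m (2 * r) 0 ≤ ∫ r in Set.Ioi t, D * r ^ (-(1 + ε)) :=
      setIntegral_mono_on (hint t ht) ((integrableOn_Ioi_rpow_of_lt (by linarith) ht).const_mul D)
        measurableSet_Ioi fun r hr => hle r (ht.trans hr)
    rw [integral_const_mul, integral_Ioi_rpow_of_lt (by linarith) ht] at h1
    have h2 : D * (-t ^ (-(1 + ε) + 1) / (-(1 + ε) + 1)) = D / ε * t ^ (-ε) := by
      rw [show -(1 + ε) + 1 = -ε by ring]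
      field_simp
    rw [h2] at h1
    rw [cInf]
    linarith

end RenormalizationConstant

end Phi42

end

/-! ### Families with a power singularity at the initial time; the solution class. -/

noncomputable section

namespace Phi42

section Singularities

variable {L : ℝ} [hL : Fact (0 < L)]

/-- On a bounded interval a weaker singularity is dominated by a stronger one. This brings all terms
of an equation to a common exponent; `q ≤ p + 1` keeps the constant equal to 1 + D. -/
lemma rpow_neg_le_of_le {x D p q : ℝ} (hx : 0 < x) (hD : x ≤ D) (hpq : p ≤ q) (hpq' : q ≤ p + 1) :
    x ^ (-p) ≤ (1 + D) * x ^ (-q) := by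
  rw [show -p = (q - p) + -q by ring, Real.rpow_add hx]
  refine mul_le_mul_of_nonneg_right ?_ (by positivity)
  linarith [rpow_le_one_add hx.le (by linarith : 0 ≤ q - p) (by linarith)]

/-- Families of distributions whose norm blows up at most like `(r - s)^{-θ}`. -/
def SingBlock (L b s T θ : ℝ) (F : ℝ → TDist) : Prop :=
  ∃ K, ∀ r, s < r → r ≤ T → BlockBound L b (K * (r - s) ^ (-θ)) (F r)

/-- Families of functions whose Hölder norm blows up at most like `(r - s)^{-θ}`. -/
def SingHol (b s T θ : ℝ) (w : ℝ → Torus L → ℝ) : Prop :=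
  ∃ V, ∀ r, s < r → r ≤ T → HolB b (V * (r - s) ^ (-θ)) (w r)

lemma BlockBound.add {a U V : ℝ} {u v : TDist} (hu : BlockBound L a U u)
    (hv : BlockBound L a V v) : BlockBound L a (U + V) (u + v) := by
  intro n x
  rw [lpBlock_add, add_mul]
  exact (norm_add_le _ _).trans (add_le_add (hu n x) (hv n x))

lemma BlockBound.smul {a U : ℝ} {u : TDist} (hu : BlockBound L a U u) (c : ℂ) :
    BlockBound L a (‖c‖ * U) (c • u) := by
  intro n x
  rw [lpBlock_smul, norm_mul, mul_assoc]
  exact mul_le_mul_of_nonneg_left (hu n x) (norm_nonneg c)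

variable {b s T θ θ' : ℝ} {F G : ℝ → TDist} {w z : ℝ → Torus L → ℝ}

omit hL in
lemma SingBlock.mono (h : SingBlock L b s T θ F) (h1 : θ ≤ θ') (h2 : θ' ≤ θ + 1) :
    SingBlock L b s T θ' F := by
  obtain ⟨K, hK⟩ := h
  refine ⟨K * (1 + (T - s)), fun r hr hrT => (hK r hr hrT).mono le_rfl ?_⟩
  have hr0 : 0 < r - s := by linarith
  have hK0 : 0 ≤ K := nonneg_of_mul_nonneg_left (hK r hr hrT).nonneg (Real.rpow_pos_of_pos hr0 _)
  rw [mul_assoc]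
  exact mul_le_mul_of_nonneg_left (rpow_neg_le_of_le hr0 (by linarith) h1 h2) hK0

lemma SingBlock.add (h : SingBlock L b s T θ F) (h' : SingBlock L b s T θ G) :
    SingBlock L b s T θ (fun r => F r + G r) := by
  obtain ⟨K, hK⟩ := h
  obtain ⟨K', hK'⟩ := h'
  refine ⟨K + K', fun r hr hrT => ?_⟩
  rw [add_mul]
  exact (hK r hr hrT).add (hK' r hr hrT)

lemma SingBlock.const_smul (h : SingBlock L b s T θ F) (c : ℂ) :
    SingBlock L b s T θ (fun r => c • F r) := by
  obtain ⟨K, hK⟩ := h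
  refine ⟨‖c‖ * K, fun r hr hrT => ?_⟩
  rw [mul_assoc]
  exact (hK r hr hrT).smul c

lemma SingBlock.smul {c : ℝ → ℂ} {D : ℝ} (h : SingBlock L b s T θ F)
    (hc : ∀ r, s < r → ‖c r‖ ≤ D * (r - s) ^ (-θ')) :
    SingBlock L b s T (θ' + θ) (fun r => c r • F r) := by
  obtain ⟨K, hK⟩ := h
  refine ⟨D * K, fun r hr hrT => ((hK r hr hrT).smul (c r)).mono le_rfl ?_⟩
  have hr0 : 0 < r - s := by linarith
  calc _ ≤ D * (r - s) ^ (-θ') * (K * (r - s) ^ (-θ)) :=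
        mul_le_mul_of_nonneg_right (hc r hr) (hK r hr hrT).nonneg
    _ = _ := by rw [neg_add, Real.rpow_add hr0]; ring

omit hL in
lemma SingHol.mul (h : SingHol b s T θ w) (h' : SingHol b s T θ' z) :
    SingHol b s T (θ + θ') (fun r x => w r x * z r x) := by
  obtain ⟨K, hK⟩ := h
  obtain ⟨K', hK'⟩ := h'
  refine ⟨2 * K * K', fun r hr hrT => ((hK r hr hrT).mul (hK' r hr hrT)).mono (le_of_eq ?_)⟩
  rw [neg_add, Real.rpow_add (by linarith)]; ring

omit hL in
lemma SingHol.const_mul (h : SingHol b s T θ w) (c : ℝ) :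
    SingHol b s T θ (fun r x => c * w r x) := by
  obtain ⟨K, hK⟩ := h
  refine ⟨|c| * K, fun r hr hrT => ?_⟩
  rw [mul_assoc]
  exact (hK r hr hrT).const_mul c

lemma SingHol.singBlock (h : SingHol b s T θ w) (hb : 0 ≤ b) :
    SingBlock L b s T θ (fun r => fcoefR L (w r)) := by
  obtain ⟨K, hK⟩ := h
  refine ⟨2 * lowConst * K, fun r hr hrT => ?_⟩
  rw [mul_assoc]
  exact (hK r hr hrT).blockBound_zero.mono hb le_rfl

lemma SingHol.mulDist {a U : ℝ} (h : SingHol b s T θ w)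
    (hF : ∀ r, s < r → r ≤ T → BlockBound L a U (F r)) (hab : a < b) (hb : 0 ≤ b) (hb' : b ≤ 1) :
    SingBlock L b s T θ (fun r => Phi42.mulDist L (F r) (w r)) := by
  obtain ⟨K, hK⟩ := h
  refine ⟨pairConst * geo (b - a) * (2 * lowConst * (4 + lipConst)) * (U * K), fun r hr hrT => ?_⟩
  refine ((hK r hr hrT).blockBound_mulDist (hF r hr hrT) hab hb hb').mono le_rfl (le_of_eq ?_)
  ring

omit hL in
lemma singBlock_of_forall {U : ℝ} (hF : ∀ r, s < r → r ≤ T → BlockBound L b U (F r)) :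
    SingBlock L b s T 0 F :=
  ⟨U, fun r hr hrT => by simpa using hF r hr hrT⟩

end Singularities

section InClass

variable {L : ℝ} [hL : Fact (0 < L)] {β γ s : ℝ} {w : ℝ → Torus L → ℝ}

lemma InClass.besov_lt_top (h : InClass L β γ s w) {t : ℝ} (ht : s < t) :
    besov L β (fcoefR L (w t)) < ⊤ := by
  obtain ⟨K, hK⟩ := h.bound t
  have h0 : 0 < min (t - s) 1 ^ γ := Real.rpow_pos_of_pos (lt_min (by linarith) one_pos) _
  refine lt_top_iff_ne_top.2 fun htop => ?_
  have h1 := hK t ht le_rfl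
  rw [htop, ENNReal.mul_top (by simpa using h0)] at h1
  exact absurd (h1.trans_lt ENNReal.ofReal_lt_top) (lt_irrefl _)

/-- The Besov norm of order β > b controls the Hölder norm of order b, and on (s, T] the weight
min(t-s, 1) is at least (t-s)/(1+T-s). -/
lemma InClass.singHol (h : InClass L β γ s w) {b : ℝ} (hb : 0 ≤ b) (hb' : b ≤ 1) (hbβ : b < β)
    (hγ : 0 ≤ γ) (T : ℝ) : SingHol b s T γ w := by
  obtain ⟨K, hK⟩ := h.bound T
  have hlip := lipConst_nonneg
  have hg := geo_nonneg (β - b)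
  refine ⟨(2 + lipConst) * ((2 : ℝ) ^ β * (max K 0 * (1 + (T - s)) ^ γ)) * geo (β - b),
    fun t ht htT => ?_⟩
  have hx : 0 < t - s := by linarith
  have hD : 0 < 1 + (T - s) := by linarith
  have hbes := h.besov_lt_top ht
  refine (HolB.of_blockBound (h.cont t ht) hb hb' hbβ (blockBound_of_besov hbes)).mono ?_
  have h1 := ENNReal.toReal_mono ENNReal.ofReal_ne_top (hK t ht htT)
  rw [ENNReal.toReal_mul, ENNReal.toReal_ofReal', ENNReal.toReal_ofReal',
    max_eq_left (by positivity : 0 ≤ min (t - s) 1 ^ γ)] at h1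
  set B := (besov L β (fcoefR L (w t))).toReal with hB
  have hB0 : 0 ≤ B := ENNReal.toReal_nonneg
  have h2 : (t - s) / (1 + (T - s)) ≤ min (t - s) 1 := by
    refine le_min ?_ ?_
    · exact div_le_self hx.le (by linarith)
    · exact (div_le_one hD).2 (by linarith)
  have h3 : (t - s) ^ γ / (1 + (T - s)) ^ γ ≤ min (t - s) 1 ^ γ := by
    rw [← Real.div_rpow hx.le hD.le]
    exact Real.rpow_le_rpow (by positivity) h2 hγ
  have hpx : 0 < (t - s) ^ γ := Real.rpow_pos_of_pos hx _
  have hpD : 0 < (1 + (T - s)) ^ γ := Real.rpow_pos_of_pos hD _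
  have h4 : B ≤ max K 0 * (1 + (T - s)) ^ γ * (t - s) ^ (-γ) := by
    have h5 : (t - s) ^ γ / (1 + (T - s)) ^ γ * B ≤ max K 0 :=
      (mul_le_mul_of_nonneg_right h3 hB0).trans h1
    rw [Real.rpow_neg hx.le, ← div_eq_mul_inv, le_div_iff₀ hpx]
    rw [div_mul_eq_mul_div, div_le_iff₀ hpD] at h5
    linarith
  calc (2 + lipConst) * ((2 : ℝ) ^ β * B) * geo (β - b)
      ≤ (2 + lipConst) * ((2 : ℝ) ^ β * (max K 0 * (1 + (T - s)) ^ γ * (t - s) ^ (-γ))) *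
        geo (β - b) := by gcongr
    _ = _ := by ring

/-- Elements of the solution class are jointly continuous. -/
lemma InClass.continuousOn_uncurry (h : InClass L β γ s w) (hβ : 0 < β) :
    ContinuousOn (fun p : ℝ × Torus L => w p.1 p.2) (Set.Ioi s ×ˢ Set.univ) := by
  rintro ⟨t₀, x₀⟩ ⟨ht₀, -⟩
  have ht₀ : s < t₀ := ht₀
  refine ContinuousAt.continuousWithinAt ?_
  -- Reconstruction with Hölder exponent 0: the Besov norm of order β > 0 controls the supremum
  -- norm, so continuity in time is uniform in space.
  set C : ℝ := (2 + lipConst) * (2 : ℝ) ^ β * geo (β - 0) with hC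
  have hsub : ∀ t, s < t → ∀ x, |w t x - w t₀ x| ≤
      C * (besov L β (fcoefR L (w t) - fcoefR L (w t₀))).toReal := by
    intro t ht x
    have hc1 := h.cont t ht
    have hc2 := h.cont t₀ ht₀
    have hd : fcoefR L (fun x => w t x - w t₀ x) = fcoefR L (w t) - fcoefR L (w t₀) := by
      ext k
      have hi : ∀ v : Torus L → ℝ, Continuous v →
          Integrable fun x => (v x : ℂ) * (starRingEnd ℂ) (torusChar L k x) := fun v hv =>
        integrable_of_cont L ((Complex.continuous_ofReal.comp hv).mul
          (Complex.continuous_conj.comp (continuous_torusChar L k)))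
      simp only [fcoefR, fcoef, Pi.sub_apply, Complex.ofReal_sub, sub_mul]
      rw [integral_sub (hi _ hc1) (hi _ hc2), mul_sub]
    have hlt : besov L β (fcoefR L (w t) - fcoefR L (w t₀)) < ⊤ := by
      rw [sub_eq_add_neg]
      refine (besov_add_le β _ _).trans_lt ?_
      rw [besov_neg]
      exact ENNReal.add_lt_top.2 ⟨h.besov_lt_top ht, h.besov_lt_top ht₀⟩
    have h1 := blockBound_of_besov hlt
    rw [← hd] at h1
    have h2 := (HolB.of_blockBound (hc1.sub hc2) le_rfl zero_le_one hβ h1).bound x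
    rw [hd] at h2
    exact h2.trans_eq (by rw [hC]; ring)
  have hlim : Tendsto (fun t => C * (besov L β (fcoefR L (w t) - fcoefR L (w t₀))).toReal)
      (𝓝 t₀) (𝓝 0) := by
    simpa using ((ENNReal.tendsto_toReal ENNReal.zero_ne_top).comp (h.time_cont t₀ ht₀)).const_mul C
  rw [ContinuousAt, tendsto_iff_dist_tendsto_zero]
  have h3 : Tendsto (fun p : ℝ × Torus L => C * (besov L β (fcoefR L (w p.1) - fcoefR L (w t₀))).toReal
      + dist (w t₀ p.2) (w t₀ x₀)) (𝓝 (t₀, x₀)) (𝓝 (0 + 0)) := by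
    refine ((hlim.comp (continuous_fst.tendsto (t₀, x₀)))).add ?_
    exact tendsto_iff_dist_tendsto_zero.1
      (((h.cont t₀ ht₀).continuousAt (x := x₀)).tendsto.comp (continuous_snd.tendsto (t₀, x₀)))
  rw [add_zero] at h3
  refine squeeze_zero' (Eventually.of_forall fun _ => dist_nonneg) ?_ h3
  have hev : ∀ᶠ p : ℝ × Torus L in 𝓝 (t₀, x₀), s < p.1 :=
    continuous_fst.continuousAt.eventually (lt_mem_nhds ht₀)
  filter_upwards [hev] with p hp
  refine (dist_triangle _ (w t₀ p.2) _).trans (add_le_add_left ?_ _)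
  rw [Real.dist_eq]
  exact hsub p.1 hp p.2

end InClass

end Phi42

end

/-! ### Regularity of the remainder and of the linearization. -/

noncomputable section

namespace Phi42

section Regularity

variable {L : ℝ} [hL : Fact (0 < L)] {m β γ s : ℝ}

lemma ContPath.exists_blockBound {a : ℝ} (ha : 0 ≤ a) {u : ℝ → TDist} (h : ContPath L (-a) s u)
    (T : ℝ) : ∃ U, 0 ≤ U ∧ ∀ r, s ≤ r → r ≤ T → BlockBound L a U (u r) := by
  obtain ⟨U, hU⟩ := (isCompact_Icc (a := s) (b := T)).exists_bound_of_continuousOn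
    (h.continuousOn.mono Set.Icc_subset_Ici_self)
  refine ⟨max U 0, le_max_right _ _, fun r hr hrT => ?_⟩
  refine (blockBound_of_besov_neg ha (h.1 r hr).2).mono le_rfl ?_
  exact ((le_abs_self _).trans (hU r ⟨hr, hrT⟩)).trans (le_max_left _ _)

lemma exists_norm_three_mul_cInf_le (hm : 0 < m) (hγ : 0 < γ) (hγ' : γ ≤ 1) (s : ℝ) :
    ∃ D : ℝ, ∀ r, s < r → ‖(3 * cInf L m (r - s) : ℂ)‖ ≤ D * (r - s) ^ (-γ) := by
  obtain ⟨h0, -, D, -, hD⟩ := cInf_bound L hm hγ hγ'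
  refine ⟨3 * D, fun r hr => ?_⟩
  rw [norm_mul, Complex.norm_real, Real.norm_of_nonneg (h0 _ (sub_pos.2 hr))]
  have := hD (r - s) (sub_pos.2 hr)
  norm_num
  linarith

/-- Instantaneous `C¹` regularity of mild solutions. -/
lemma IsMild.isC_one {u₀ : TDist} {F : ℝ → TDist} {w : ℝ → Torus L → ℝ}
    (h : IsMild L m s u₀ F w) (hm : 0 < m) (hw : ∀ t, s < t → Continuous (w t)) {σ b θ U T q : ℝ}
    (hu : BlockBound L (-σ) U u₀) (hF : SingBlock L b s T θ F) (hθ : 0 ≤ θ) (hθ' : θ < 1)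
    (hb : 0 < b) (hb' : b < 1 / 2) (h1 : σ ≤ 1) (h2 : b - σ ≤ 1) (hq : (1 + b - σ) / 2 ≤ q)
    (hq' : b + θ - 1 / 2 ≤ q) (hq1 : q ≤ 1) :
    ∃ V, 0 ≤ V ∧ ∀ r, s < r → r ≤ T → IsC 1 (w r) ∧
      ∀ i x, |pderiv i (w r) x| ≤ V * (r - s) ^ (-q) := by
  obtain ⟨K, hK⟩ := hF
  have hU := hu.nonneg
  have hlip := lipConst_nonneg
  have hg := geo_nonneg b
  have hhc := heatConst_nonneg
  have hsc := singConst_nonneg (p := (1 + b + b) / 2) (θ := θ) (by linarith) hθ'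
  set D := max (T - s) 0
  have hD0 : 0 ≤ D := le_max_right _ _
  set R := U * (1 + D) + max K 0 * (singConst ((1 + b + b) / 2) θ * ((1 + D) * (1 + D)))
  refine ⟨lipConst * (heatConst * (1 + D) * R) * geo b, by positivity, fun r hr hrT => ?_⟩
  have hx : 0 < r - s := by linarith
  have hxD : r - s ≤ D := le_trans (by linarith) (le_max_left _ _)
  -- Regularity 1 + b yields C¹. From forcing of growth b this costs p = 1/2 + b < 1; the initial
  -- datum contributes the rate (1+b-σ)/2 and the Duhamel term the rate b + θ - 1/2.
  have h3 := h.blockBound (σ := σ) (ρ := 1 + b) hm.le hr hxD hu (fun r' hr' hr'' => hK r' hr' (by linarith)) hθ hθ'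
    (by linarith) (by linarith) (by linarith) (by linarith)
  have h4 : U * (r - s) ^ (-((1 + b - σ) / 2)) +
      K * (singConst ((1 + b + b) / 2) θ * (r - s) ^ (1 - (1 + b + b) / 2 - θ)) ≤
      R * (r - s) ^ (-q) := by
    have h5 := rpow_neg_le_of_le hx hxD hq (by linarith)
    have h6 : (r - s) ^ (1 - (1 + b + b) / 2 - θ) ≤ (1 + D) * (1 + D) * (r - s) ^ (-q) := by
      -- One application of `rpow_neg_le_of_le` raises the exponent by at most 1 and q may lie
      -- further away, so the comparison passes through an intermediate exponent.
      have h7 := rpow_neg_le_of_le hx hxD (p := b + θ - 1 / 2) (q := min q (b + θ + 1 / 2))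
        (le_min hq' (by linarith)) ((min_le_right _ _).trans (by linarith))
      have h8 := rpow_neg_le_of_le hx hxD (p := min q (b + θ + 1 / 2)) (q := q)
        (min_le_left _ _) (by rcases le_total q (b + θ + 1 / 2) with h | h
                              · rw [min_eq_left h]; linarith
                              · rw [min_eq_right h]; linarith)
      rw [show 1 - (1 + b + b) / 2 - θ = -(b + θ - 1 / 2) by ring]
      refine h7.trans ?_
      rw [mul_assoc]
      exact mul_le_mul_of_nonneg_left h8 (by linarith)
    calc _ ≤ U * ((1 + D) * (r - s) ^ (-q)) + max K 0 * (singConst ((1 + b + b) / 2) θ *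
          ((1 + D) * (1 + D) * (r - s) ^ (-q))) := by
          gcongr
          exact le_max_left _ _
      _ = _ := by simp only [R]; ring
  obtain ⟨hC, -, hp⟩ := isC_one_of_blockBound (hw r hr) hb
    (h3.mono le_rfl (mul_le_mul_of_nonneg_left h4 (by positivity)))
  refine ⟨hC, fun i x => (hp i x).trans_eq (by ring)⟩

/-- A uniform Hölder bound for mild solutions with regular initial data. -/
lemma IsMild.holB {u₀ : TDist} {F : ℝ → TDist} {w : ℝ → Torus L → ℝ}
    (h : IsMild L m s u₀ F w) (hm : 0 < m) (hw : ∀ t, s < t → Continuous (w t)) {b θ U T : ℝ}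
    (hu : BlockBound L (-(2 * b)) U u₀) (hF : SingBlock L b s T θ F) (hθ : 0 ≤ θ)
    (hb : 0 < b) (hb' : b < 1 / 2) (hbθ : 3 * b / 2 ≤ 1 - θ) :
    ∃ V, 0 ≤ V ∧ ∀ r, s < r → r ≤ T → HolB b V (w r) := by
  obtain ⟨K, hK⟩ := hF
  have hU := hu.nonneg
  have hlip := lipConst_nonneg
  have hg := geo_nonneg (2 * b - b)
  have hhc := heatConst_nonneg
  have hsc := singConst_nonneg (p := (2 * b + b) / 2) (θ := θ) (by linarith) (by linarith)
  set D := max (T - s) 0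
  have hD0 : 0 ≤ D := le_max_right _ _
  set R := U + max K 0 * (singConst ((2 * b + b) / 2) θ * (1 + D))
  refine ⟨(2 + lipConst) * (heatConst * (1 + D) * R) * geo (2 * b - b), by positivity,
    fun r hr hrT => ?_⟩
  have hx : 0 < r - s := by linarith
  have hxD : r - s ≤ D := le_trans (by linarith) (le_max_left _ _)
  -- The target regularity 2b is that of the datum, so there is no blow-up from the initial term;
  -- the Duhamel power 1 - 3b/2 - θ is nonnegative by `hbθ`. Going from 2b to Hölder exponent b then
  -- leaves room to sum the blocks.
  have h3 := h.blockBound (σ := 2 * b) (ρ := 2 * b) hm.le hr hxD hu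
    (fun r' hr' hr'' => hK r' hr' (by linarith)) hθ (by linarith) le_rfl (by linarith) (by linarith)
    (by linarith)
  have h4 : U * (r - s) ^ (-((2 * b - 2 * b) / 2)) +
      K * (singConst ((2 * b + b) / 2) θ * (r - s) ^ (1 - (2 * b + b) / 2 - θ)) ≤ R := by
    have h6 : (r - s) ^ (1 - (2 * b + b) / 2 - θ) ≤ 1 + D :=
      (rpow_le_one_add hx.le (by linarith) (by linarith)).trans (by linarith)
    rw [sub_self, zero_div, neg_zero, Real.rpow_zero, mul_one]
    calc _ ≤ U + max K 0 * (singConst ((2 * b + b) / 2) θ * (1 + D)) := by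
          gcongr
          exact le_max_left _ _
      _ = _ := rfl
  exact HolB.of_blockBound (hw r hr) hb.le (by linarith) (by linarith)
    (h3.mono le_rfl (mul_le_mul_of_nonneg_left h4 (by positivity)))

variable {one two three : ℝ → TDist} {v J : ℝ → Torus L → ℝ}

/-- The cube is the worst term of the forcing, of size (r-s)^{-3γ} with 3γ < 1. The rates (1+b+α₀)/2
and b + 3γ - 1/2 are both at most 1, which is all that the integrability of the error term requires.
-/
lemma IsRemainder.isC_one {u₀ : TDist} (h : IsRemainder L m β γ s one two three u₀ v) (hm : 0 < m)
    {α₀ b U U' T : ℝ} (hγ : 0 < γ) (hγ' : γ < 1 / 3) (hb : 0 < b) (hb' : b < 1 / 2) (hbβ : b < β)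
    (hbα : b + α₀ ≤ 1) (hα₀ : 0 ≤ α₀) (hu : BlockBound L α₀ U u₀)
    (h1 : ∀ r, s < r → r ≤ T → BlockBound L (b / 2) U' (one r))
    (h2 : ∀ r, s < r → r ≤ T → BlockBound L (b / 2) U' (two r))
    (h3 : ∀ r, s < r → r ≤ T → BlockBound L (b / 2) U' (three r)) :
    ∃ V, 0 ≤ V ∧ ∀ r, s < r → r ≤ T → IsC 1 (v r) ∧
      ∀ i x, |pderiv i (v r) x| ≤ V * (r - s) ^ (-1 : ℝ) := by
  have hv := h.inClass.singHol (b := b) hb.le (by linarith) hbβ hγ.le T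
  have hv2 : SingHol b s T (γ + γ) (fun r x => v r x ^ 2) := by
    simpa only [pow_two] using hv.mul hv
  have hv3 : SingHol b s T (γ + γ + γ) (fun r x => v r x ^ 3) := by
    simpa only [pow_succ, pow_zero, one_mul] using (hv.mul hv).mul hv
  obtain ⟨D, hD⟩ := exists_norm_three_mul_cInf_le (L := L) hm hγ (by linarith) s
  have hbb : b / 2 < b := by linarith
  have hF : SingBlock L b s T (γ + γ + γ) (fun r => - fcoefR L (fun x => v r x ^ 3)
      - (3 : ℂ) • mulDist L (one r) (fun x => v r x ^ 2)
      - (3 : ℂ) • mulDist L (two r) (v r) - three r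
      + (3 * cInf L m (r - s) : ℂ) • (one r + fcoefR L (v r))) := by
    have e1 := (hv3.singBlock hb.le).const_smul (-1)
    have e2 := ((hv2.mulDist h1 hbb hb.le (by linarith)).const_smul (-3)).mono
      (θ' := γ + γ + γ) (by linarith) (by linarith)
    have e3 := ((hv.mulDist h2 hbb hb.le (by linarith)).const_smul (-3)).mono
      (θ' := γ + γ + γ) (by linarith) (by linarith)
    have e4 := ((singBlock_of_forall (b := b) fun r hr hrT => (h3 r hr hrT).mono hbb.le
      le_rfl).const_smul (-1)).mono (θ' := γ + γ + γ) (by linarith) (by linarith)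
    have e5 := (((singBlock_of_forall (b := b) fun r hr hrT => (h1 r hr hrT).mono hbb.le
      le_rfl).mono (θ' := γ) (by linarith) (by linarith)).add (hv.singBlock hb.le)).smul hD
    have e6 := e5.mono (θ' := γ + γ + γ) (by linarith) (by linarith)
    have e7 := (((e1.add e2).add e3).add e4).add e6
    convert e7 using 2 with r
    module
  exact h.mild.isC_one hm h.inClass.cont (σ := -α₀) (by simpa using hu) hF (by linarith)
    (by linarith) hb hb' (by linarith) (by linarith) (by linarith) (by linarith) le_rfl

/-- The quadratic term v²J sets the exponent 2γ + θ. Every other coefficient is at most as singular,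
the renormalization constant being O((r-s)^{-γ}). -/
lemma singBlock_linearized (hm : 0 < m) {b U' T θ : ℝ} (hγ : 0 < γ) (hγ' : γ < 1 / 3) (hb : 0 < b) (hb' : b < 1 / 2)
    (hv : SingHol b s T γ v) (hJθ : SingHol b s T θ J)
    (h1 : ∀ r, s < r → r ≤ T → BlockBound L (b / 2) U' (one r))
    (h2 : ∀ r, s < r → r ≤ T → BlockBound L (b / 2) U' (two r)) :
    SingBlock L b s T (γ + γ + θ) (fun r => - (3 : ℂ) • (fcoefR L (fun x => v r x ^ 2 * J r x)
        + mulDist L (one r) (fun x => 2 * v r x * J r x) + mulDist L (two r) (J r))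
      + (3 * cInf L m (r - s) : ℂ) • fcoefR L (J r)) := by
  obtain ⟨D, hD⟩ := exists_norm_three_mul_cInf_le (L := L) hm hγ (by linarith) s
  have hbb : b / 2 < b := by linarith
  have hv2 : SingHol b s T (γ + γ + θ) (fun r x => v r x ^ 2 * J r x) := by
    simpa only [pow_two] using (hv.mul hv).mul hJθ
  have e1 := hv2.singBlock hb.le
  have e2 := (((hv.const_mul 2).mul hJθ).mulDist h1 hbb hb.le (by linarith)).mono
    (θ' := γ + γ + θ) (by linarith) (by linarith)
  have e3 := (hJθ.mulDist h2 hbb hb.le (by linarith)).mono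
    (θ' := γ + γ + θ) (by linarith) (by linarith)
  have e5 := ((hJθ.singBlock hb.le).smul hD).mono (θ' := γ + γ + θ) (by linarith) (by linarith)
  exact (((e1.add e2).add e3).const_smul (-(3 : ℂ))).add e5

/-- Because h is Lipschitz, J has a Hölder bound uniform down to time s, and the rate for the
gradient is max(b/2, b + 3γ - 1/2). Both entries are below 1/2 by the smallness of b, so ∇J is
square integrable in time. -/
lemma IsLinearized.regularity {h : Torus L → ℝ} (hJ : IsLinearized L m β γ s one two v h J)
    (hh : IsC 1 h) (hm : 0 < m) {b U' T : ℝ} (hγ : 0 < γ) (hb : 0 < b)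
    (hbβ : b < β) (hbγ : 3 * b / 2 < 1 - 3 * γ) (hb' : b < 1 / 2)
    (hv : SingHol b s T γ v)
    (h1 : ∀ r, s < r → r ≤ T → BlockBound L (b / 2) U' (one r))
    (h2 : ∀ r, s < r → r ≤ T → BlockBound L (b / 2) U' (two r)) :
    ∃ V q : ℝ, 0 ≤ V ∧ 0 ≤ q ∧ q < 1 / 2 ∧ ∀ r, s < r → r ≤ T → HolB b V (J r) ∧ IsC 1 (J r) ∧
      ∀ i x, |pderiv i (J r) x| ≤ V * (r - s) ^ (-q) := by
  obtain ⟨M, hM⟩ := hh.exists_holB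
  obtain ⟨C, -, hC⟩ := exists_blockBound_lipschitz
  have hh1 : BlockBound L (-1) (C * M) (fcoefR L h) := hC L h M hM
  have hJγ := hJ.inClass.singHol hb.le (by linarith) hbβ hγ.le T
  have hF := singBlock_linearized (one := one) (two := two) hm hγ (by linarith) hb hb' hv hJγ h1 h2
  obtain ⟨V, hV0, hV⟩ := hJ.mild.holB hm hJ.inClass.cont
    (hh1.mono (a' := -(2 * b)) (by linarith) le_rfl) hF (by linarith) hb hb' (by linarith)
  obtain ⟨V', hV0', hV'⟩ := hJ.mild.isC_one hm hJ.inClass.cont hh1 hF (by linarith) (by linarith)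
    hb hb' le_rfl (by linarith) (q := max (b / 2) (b + 3 * γ - 1 / 2))
    (le_trans (by linarith) (le_max_left _ _)) (le_trans (by linarith) (le_max_right _ _))
    (max_le (by linarith) (by linarith))
  refine ⟨max V V', max (b / 2) (b + 3 * γ - 1 / 2), hV0.trans (le_max_left _ _),
    le_trans (by linarith) (le_max_left _ _), max_lt (by linarith) (by linarith),
    fun r hr hrT => ⟨(hV r hr hrT).mono (le_max_left _ _), (hV' r hr hrT).1, fun i x => ?_⟩⟩
  refine ((hV' r hr hrT).2 i x).trans ?_
  have : 0 ≤ (r - s) ^ (-max (b / 2) (b + 3 * γ - 1 / 2)) := Real.rpow_nonneg (by linarith) _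
  gcongr
  exact le_max_right _ _

end Regularity

end Phi42

end

/-! ### Absolutely continuous functions of time and the integrating factor. -/

noncomputable section

namespace Phi42

section Primitive

/-- `f` is a primitive on `[a, b]` of the integrable function `f'`. -/
structure IsPrimitive (f f' : ℝ → ℝ) (a b : ℝ) : Prop where
  int : IntervalIntegrable f' volume a b
  eq : ∀ t ∈ Set.Icc a b, f t = f a + ∫ r in a..t, f' r

variable {f f' g g' : ℝ → ℝ} {a b : ℝ}

lemma IsPrimitive.sub_eq (h : IsPrimitive f f' a b) {c d : ℝ} (hac : a ≤ c) (hcd : c ≤ d)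
    (hdb : d ≤ b) : f d - f c = ∫ r in c..d, f' r := by
  rw [h.eq d ⟨hac.trans hcd, hdb⟩, h.eq c ⟨hac, hcd.trans hdb⟩]
  have h1 : IntervalIntegrable f' volume a c := h.int.mono_set (by
    rw [Set.uIcc_of_le hac, Set.uIcc_of_le (hac.trans (hcd.trans hdb))]
    exact Set.Icc_subset_Icc le_rfl (hcd.trans hdb))
  have h2 : IntervalIntegrable f' volume c d := h.int.mono_set (by
    rw [Set.uIcc_of_le hcd, Set.uIcc_of_le (hac.trans (hcd.trans hdb))]
    exact Set.Icc_subset_Icc hac hdb)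
  rw [← intervalIntegral.integral_add_adjacent_intervals h1 h2]
  ring

lemma IsPrimitive.continuousOn (h : IsPrimitive f f' a b) (hab : a ≤ b) :
    ContinuousOn f (Set.Icc a b) := by
  have h1 := intervalIntegral.continuousOn_primitive_interval
    ((intervalIntegrable_iff_integrableOn_Icc_of_le hab).1 h.int |>.mono_set
      (by rw [Set.uIcc_of_le hab]))
  rw [Set.uIcc_of_le hab] at h1
  exact (continuousOn_const.add h1).congr fun t ht => h.eq t ht

lemma IsPrimitive.absolutelyContinuous (h : IsPrimitive f f' a b) :
    AbsolutelyContinuousOnInterval (fun t => f a + ∫ r in a..t, f' r) a b :=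
  (LipschitzWith.const (f a)).lipschitzOnWith.absolutelyContinuousOnInterval.fun_add
    (h.int.absolutelyContinuousOnInterval_intervalIntegral (by simp))

lemma IsPrimitive.ae_hasDerivAt (h : IsPrimitive f f' a b) :
    ∀ᵐ x, x ∈ Set.uIcc a b → HasDerivAt (fun t => f a + ∫ r in a..t, f' r) (f' x) x := by
  filter_upwards [h.int.ae_hasDerivAt_integral] with x hx hxab
  exact (hx hxab a (by simp)).const_add _

/-- Integration by parts for absolutely continuous functions: the product rule holds almost
everywhere, which suffices since the densities are only integrable. -/
lemma IsPrimitive.mul (h : IsPrimitive f f' a b) (h' : IsPrimitive g g' a b) (hab : a ≤ b) :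
    IsPrimitive (fun t => f t * g t) (fun t => f' t * g t + f t * g' t) a b := by
  have hu := Set.uIcc_of_le hab
  refine ⟨?_, fun t ht => ?_⟩
  · refine (h.int.mul_continuousOn ?_).add (h'.int.continuousOn_mul ?_)
    · rw [hu]; exact h'.continuousOn hab
    · rw [hu]; exact h.continuousOn hab
  · have hsub : Set.uIcc a t ⊆ Set.uIcc a b := by
      rw [hu, Set.uIcc_of_le ht.1]; exact Set.Icc_subset_Icc le_rfl ht.2
    have h1 := (h.absolutelyContinuous.mono hsub).integral_deriv_mul_eq_sub
      (h'.absolutelyContinuous.mono hsub)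
    simp only [← h.eq t ht, ← h'.eq t ht, intervalIntegral.integral_same, add_zero] at h1
    rw [← sub_eq_iff_eq_add', ← h1]
    refine intervalIntegral.integral_congr_ae ?_
    filter_upwards [h.ae_hasDerivAt, h'.ae_hasDerivAt] with x hx hx' hxt
    have hxb : x ∈ Set.uIcc a b := hsub (Set.uIoc_subset_uIcc hxt)
    rw [(hx hxb).deriv, (hx' hxb).deriv, ← h.eq x (hu ▸ hxb), ← h'.eq x (hu ▸ hxb)]

/-- The primitive is bounded by some M on the compact interval and the exponential is Lipschitz on
(-∞, M], so the composition is again absolutely continuous and the chain rule holds almost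
everywhere. -/
lemma IsPrimitive.exp (h : IsPrimitive f f' a b) (hab : a ≤ b) :
    IsPrimitive (fun t => Real.exp (f t)) (fun t => Real.exp (f t) * f' t) a b := by
  have hu := Set.uIcc_of_le hab
  have hc := h.continuousOn hab
  refine ⟨h.int.continuousOn_mul (by rw [hu]; exact Real.continuous_exp.comp_continuousOn hc),
    fun t ht => ?_⟩
  have hsub : Set.uIcc a t ⊆ Set.uIcc a b := by
    rw [hu, Set.uIcc_of_le ht.1]; exact Set.Icc_subset_Icc le_rfl ht.2
  obtain ⟨M, hM⟩ := isCompact_Icc.exists_bound_of_continuousOn hc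
  have hac : AbsolutelyContinuousOnInterval
      (fun t => Real.exp (f a + ∫ r in a..t, f' r)) a b := by
    have h1 := h.absolutelyContinuous
    rw [AbsolutelyContinuousOnInterval] at h1 ⊢
    have h2 := h1.const_mul (Real.exp M)
    rw [mul_zero] at h2
    refine squeeze_zero' (Eventually.of_forall fun E => Finset.sum_nonneg fun _ _ => dist_nonneg)
      ?_ h2
    refine eventually_inf_principal.2 (Eventually.of_forall fun E hE => ?_)
    rw [Finset.mul_sum]
    refine Finset.sum_le_sum fun i hi => ?_
    obtain ⟨h3, h4⟩ := hE.1 i hi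
    rw [hu] at h3 h4
    rw [← h.eq _ h3, ← h.eq _ h4]
    have hLip := Convex.norm_image_sub_le_of_norm_deriv_le (𝕜 := ℝ) (f := Real.exp)
      (s := Set.Iic M) (C := Real.exp M) (fun x _ => Real.differentiableAt_exp) (fun x hx => by
        rw [Real.deriv_exp, Real.norm_of_nonneg (Real.exp_pos x).le]
        exact Real.exp_le_exp.2 hx) (convex_Iic M)
      ((le_abs_self _).trans (hM _ h4)) ((le_abs_self _).trans (hM _ h3))
    rw [dist_eq_norm, dist_eq_norm]
    exact hLip
  have h1 := (hac.mono hsub).integral_deriv_eq_sub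
  simp only [← h.eq t ht, intervalIntegral.integral_same, add_zero] at h1
  rw [← sub_eq_iff_eq_add', ← h1]
  refine intervalIntegral.integral_congr_ae ?_
  filter_upwards [h.ae_hasDerivAt] with x hx hxt
  have hxb : x ∈ Set.uIcc a b := hsub (Set.uIoc_subset_uIcc hxt)
  rw [(hx hxb).exp.deriv, ← h.eq x (hu ▸ hxb)]

lemma IsPrimitive.of_hasDerivAt (h : ∀ x, HasDerivAt f (f' x) x) (hf' : Continuous f') :
    IsPrimitive f f' a b :=
  ⟨hf'.intervalIntegrable _ _, fun t _ => by
    rw [intervalIntegral.integral_eq_sub_of_hasDerivAt (fun x _ => h x)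
      (hf'.intervalIntegrable _ _)]; ring⟩

lemma IsPrimitive.add (h : IsPrimitive f f' a b) (h' : IsPrimitive g g' a b) :
    IsPrimitive (fun t => f t + g t) (fun t => f' t + g' t) a b := by
  refine ⟨h.int.add h'.int, fun t ht => ?_⟩
  have hsub : Set.uIcc a t ⊆ Set.uIcc a b := by
    rw [Set.uIcc_of_le (ht.1.trans ht.2), Set.uIcc_of_le ht.1]
    exact Set.Icc_subset_Icc le_rfl ht.2
  rw [intervalIntegral.integral_add (h.int.mono_set hsub) (h'.int.mono_set hsub), h.eq t ht,
    h'.eq t ht]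
  ring

lemma IsPrimitive.const_mul (h : IsPrimitive f f' a b) (c : ℝ) :
    IsPrimitive (fun t => c * f t) (fun t => c * f' t) a b :=
  ⟨h.int.const_mul c, fun t ht => by
    rw [intervalIntegral.integral_const_mul, h.eq t ht]; ring⟩

lemma IsPrimitive.finsetSum {ι : Type*} {S : Finset ι} {f f' : ι → ℝ → ℝ}
    (h : ∀ i ∈ S, IsPrimitive (f i) (f' i) a b) :
    IsPrimitive (fun t => ∑ i ∈ S, f i t) (fun t => ∑ i ∈ S, f' i t) a b := by
  classical
  induction S using Finset.induction_on with
  | empty => exact ⟨by simp, fun t _ => by simp⟩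
  | insert i S hi ih =>
    simp only [Finset.sum_insert hi]
    exact (h i (Finset.mem_insert_self i S)).add
      (ih fun j hj => h j (Finset.mem_insert_of_mem hj))

lemma isPrimitive_expWeight {g : ℝ → ℝ} {m t : ℝ} (hat : a ≤ t)
    (hg : IntervalIntegrable g volume a t) :
    IsPrimitive (fun r => expWeight m g r t)
      (fun r => expWeight m g r t * (2 * m + (-2) * g r)) a t := by
  have hW : IsPrimitive (fun r => -2 * m * (t - r) + 2 * ∫ r' in r..t, g r')
      (fun r => 2 * m + (-2) * g r) a t := by
    refine ⟨intervalIntegrable_const.add (hg.const_mul _), fun r hr => ?_⟩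
    have hs1 : Set.uIcc a r ⊆ Set.uIcc a t := by
      rw [Set.uIcc_of_le hat, Set.uIcc_of_le hr.1]; exact Set.Icc_subset_Icc le_rfl hr.2
    have hs2 : Set.uIcc r t ⊆ Set.uIcc a t := by
      rw [Set.uIcc_of_le hat, Set.uIcc_of_le hr.2]; exact Set.Icc_subset_Icc hr.1 le_rfl
    rw [intervalIntegral.integral_add intervalIntegrable_const ((hg.mono_set hs1).const_mul _),
      intervalIntegral.integral_const_mul (-2) g, intervalIntegral.integral_const, smul_eq_mul,
      ← intervalIntegral.integral_add_adjacent_intervals (hg.mono_set hs1) (hg.mono_set hs2)]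
    ring
  exact hW.exp hat

/-- A differential identity with a Gronwall-type integrating factor. -/
lemma IsPrimitive.gronwall {y R g D : ℝ → ℝ} {m : ℝ} (hy : IsPrimitive y R a b)
    (hg : IntervalIntegrable g volume a b) (hD : IntervalIntegrable D volume a b)
    (hR : ∀ r ∈ Set.Ioc a b, R r ≤ -D r - 2 * m * y r + 2 * g r * y r)
    {t' t : ℝ} (h1 : a ≤ t') (h2 : t' ≤ t) (h3 : t ≤ b) :
    y t + ∫ r in t'..t, expWeight m g r t * D r ≤ expWeight m g t' t * y t' := by
  have hat : a ≤ t := h1.trans h2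
  have hsub : Set.uIcc a t ⊆ Set.uIcc a b := by
    rw [Set.uIcc_of_le (hat.trans h3), Set.uIcc_of_le hat]
    exact Set.Icc_subset_Icc le_rfl h3
  have hg' := hg.mono_set hsub
  have hy' : IsPrimitive y R a t := ⟨hy.int.mono_set hsub, fun r hr => hy.eq r ⟨hr.1, hr.2.trans h3⟩⟩
  -- The weight E, as a function of its lower endpoint r, has derivative E(2m - 2g). Hence (Ey)' =
  -- E(2m - 2g)y + ER ≤ -ED, and E = 1 at r = t.
  have hE := isPrimitive_expWeight (m := m) hat hg'
  have hP := hE.mul hy' hat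
  have h4 := hP.sub_eq h1 h2 le_rfl
  have h5 : expWeight m g t t = 1 := by simp [expWeight]
  have hst : Set.uIcc t' t ⊆ Set.uIcc a t := by
    rw [Set.uIcc_of_le hat, Set.uIcc_of_le h2]; exact Set.Icc_subset_Icc h1 le_rfl
  have hED : IntervalIntegrable (fun r => expWeight m g r t * D r) volume t' t := by
    refine ((hD.mono_set hsub).mono_set hst).continuousOn_mul ?_
    refine (hE.continuousOn hat).mono ?_
    rwa [Set.uIcc_of_le hat] at hst
  have h6 : ∫ r in t'..t, (expWeight m g r t * (2 * m + (-2) * g r) * y r + expWeight m g r t * R r)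
      ≤ ∫ r in t'..t, -(expWeight m g r t * D r) := by
    refine intervalIntegral.integral_mono_on_of_le_Ioo h2 (hP.int.mono_set hst) hED.neg
      fun r hr => ?_
    have h7 := hR r ⟨h1.trans_lt hr.1, hr.2.le.trans h3⟩
    have h8 : 0 < expWeight m g r t := Real.exp_pos _
    nlinarith
  rw [← h4, intervalIntegral.integral_neg, h5] at h6
  linarith

end Primitive

end Phi42

end

/-! ### Measurability in time and integrability near the initial time. -/

noncomputable section

namespace Phi42

section Measurability

variable {L : ℝ} [hL : Fact (0 < L)] {s : ℝ} {w z : ℝ → Torus L → ℝ}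

omit hL in
lemma measurableSet_after (s : ℝ) : MeasurableSet (Set.Ioi s ×ˢ (Set.univ : Set (Torus L))) :=
  measurableSet_Ioi.prod MeasurableSet.univ

omit hL in
lemma measurable_indicator_after
    (hc : ContinuousOn (fun p : ℝ × Torus L => w p.1 p.2) (Set.Ioi s ×ˢ Set.univ)) :
    Measurable ((Set.Ioi s ×ˢ Set.univ).indicator fun p : ℝ × Torus L => w p.1 p.2) := by
  classical
  rw [← Set.piecewise_eq_indicator]
  exact hc.measurable_piecewise continuousOn_const (measurableSet_after s)

omit hL in
lemma IsC.hasDerivAt_pderiv {w : Torus L → ℝ} (h : IsC 1 w) (i : Fin 2) (x : Torus L) :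
    HasDerivAt (fun τ : ℝ => w (x + Pi.single i (τ : AddCircle L))) (pderiv i w x) 0 := by
  have h1 := h.hasDerivAt x (EuclideanSpace.single i (1 : ℝ)) 0
  have h2 : (fun t : ℝ => w (x + proj L (t • EuclideanSpace.single i (1 : ℝ))))
      = fun t : ℝ => w (x + Pi.single i (t : AddCircle L)) := by
    ext t
    congr 2
    rw [← proj_single]
    congr 1
    ext j
    by_cases hj : j = i
    · subst hj; simp
    · simp [hj]
  rw [h2] at h1
  exact h1.differentiableAt.hasDerivAt

omit hL in
lemma IsC.tendsto_pderiv {w : Torus L → ℝ} (h : IsC 1 w) (i : Fin 2) (x : Torus L) :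
    Tendsto (fun n : ℕ => ((n : ℝ) + 1) *
      (w (x + Pi.single i ((((n : ℝ) + 1)⁻¹ : ℝ) : AddCircle L)) - w x)) atTop (𝓝 (pderiv i w x)) := by
  have h4 := h.hasDerivAt_pderiv i x
  have h5 : Tendsto (fun n : ℕ => ((n : ℝ) + 1)⁻¹) atTop (𝓝[≠] 0) := by
    refine tendsto_nhdsWithin_iff.2 ⟨?_, Eventually.of_forall fun n => ?_⟩
    · simpa [one_div] using tendsto_one_div_add_atTop_nhds_zero_nat (𝕜 := ℝ)
    · simp only [Set.mem_compl_iff, Set.mem_singleton_iff, inv_eq_zero]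
      positivity
  refine (h4.tendsto_slope_zero.comp h5).congr fun n => ?_
  simp

omit hL in
-- The derivative is a pointwise limit of difference quotients with step 1/(n+1), each jointly
-- measurable. The indicator restricts to times after s, where continuity is available.
lemma measurable_indicator_pderiv
    (hc : ContinuousOn (fun p : ℝ × Torus L => w p.1 p.2) (Set.Ioi s ×ˢ Set.univ))
    (hw : ∀ r, s < r → IsC 1 (w r)) (i : Fin 2) :
    Measurable ((Set.Ioi s ×ˢ Set.univ).indicator fun p : ℝ × Torus L => pderiv i (w p.1) p.2) := by
  refine measurable_of_tendsto_metrizable (f := fun (n : ℕ) (p : ℝ × Torus L) => ((n : ℝ) + 1) *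
    ((Set.Ioi s ×ˢ Set.univ).indicator (fun p : ℝ × Torus L => w p.1 p.2)
      (p.1, p.2 + Pi.single i ((((n : ℝ) + 1)⁻¹ : ℝ) : AddCircle L)) -
    (Set.Ioi s ×ˢ Set.univ).indicator (fun p : ℝ × Torus L => w p.1 p.2) p)) (fun n => ?_) ?_
  · have h1 := measurable_indicator_after hc
    refine measurable_const.mul ((h1.comp ?_).sub h1)
    exact measurable_fst.prodMk (measurable_snd.add_const _)
  · refine tendsto_pi_nhds.2 fun p => ?_
    by_cases hp : s < p.1
    · have h1 : ∀ y : Torus L, (p.1, y) ∈ Set.Ioi s ×ˢ (Set.univ : Set (Torus L)) := fun y =>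
        ⟨hp, trivial⟩
      simp only [Set.indicator_of_mem (h1 _)]
      exact (hw p.1 hp).tendsto_pderiv i p.2
    · have h1 : ∀ y : Torus L, (p.1, y) ∉ Set.Ioi s ×ˢ (Set.univ : Set (Torus L)) := fun y h =>
        hp h.1
      simp only [Set.indicator_of_notMem (h1 _)]
      simp

omit hL in
lemma measurable_indicator_gradSq
    (hc : ContinuousOn (fun p : ℝ × Torus L => w p.1 p.2) (Set.Ioi s ×ˢ Set.univ))
    (hw : ∀ r, s < r → IsC 1 (w r)) :
    Measurable ((Set.Ioi s ×ˢ Set.univ).indicator fun p : ℝ × Torus L => gradSq (w p.1) p.2) := by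
  have h1 : ((Set.Ioi s ×ˢ Set.univ).indicator fun p : ℝ × Torus L => gradSq (w p.1) p.2) =
      fun p => ∑ i, ((Set.Ioi s ×ˢ Set.univ).indicator
        (fun p : ℝ × Torus L => pderiv i (w p.1) p.2) p) ^ 2 := by
    ext p
    by_cases hp : p ∈ Set.Ioi s ×ˢ (Set.univ : Set (Torus L))
    · simp only [Set.indicator_of_mem hp, gradSq]
    · simp [Set.indicator_of_notMem hp]
  rw [h1]
  exact Finset.measurable_fun_sum _ fun i _ => (measurable_indicator_pderiv hc hw i).pow_const 2

/-- Space integrals of functions that are measurable after time `s`. -/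
lemma aestronglyMeasurable_integral {E : Type*} [NormedAddCommGroup E] [NormedSpace ℝ E]
    [MeasurableSpace E] [BorelSpace E] [SecondCountableTopology E] {f : ℝ × Torus L → E} (t : ℝ)
    (hf : Measurable ((Set.Ioi s ×ˢ Set.univ).indicator f)) :
    AEStronglyMeasurable (fun r => ∫ x, f (r, x)) (volume.restrict (Set.Ioc s t)) := by
  have h1 := hf.stronglyMeasurable.integral_prod_right' (ν := (volume : Measure (Torus L)))
  refine h1.aestronglyMeasurable.congr ?_
  refine (ae_restrict_iff' measurableSet_Ioc).2 (Eventually.of_forall fun r hr => ?_)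
  refine integral_congr_ae (Eventually.of_forall fun x => ?_)
  exact Set.indicator_of_mem
    (show (r, x) ∈ Set.Ioi s ×ˢ (Set.univ : Set (Torus L)) from ⟨hr.1, trivial⟩) _

omit hL in
-- By continuity in space the supremum may be taken over a countable dense set.
lemma aestronglyMeasurable_supGrad
    (hc : ContinuousOn (fun p : ℝ × Torus L => w p.1 p.2) (Set.Ioi s ×ˢ Set.univ))
    (hw : ∀ r, s < r → IsC 1 (w r)) (t : ℝ) :
    AEStronglyMeasurable (fun r => supGrad (w r)) (volume.restrict (Set.Ioc s t)) := by
  obtain ⟨S, hSc, hS⟩ := TopologicalSpace.exists_countable_dense (Torus L)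
  have := hSc.to_subtype
  have hm := measurable_indicator_gradSq hc hw
  have h1 : Measurable fun r => ⨆ x : S, Real.sqrt ((Set.Ioi s ×ˢ Set.univ).indicator
      (fun p : ℝ × Torus L => gradSq (w p.1) p.2) (r, (x : Torus L))) :=
    Measurable.iSup fun x => Real.continuous_sqrt.measurable.comp (hm.comp measurable_prodMk_right)
  refine h1.aestronglyMeasurable.congr ?_
  refine (ae_restrict_iff' measurableSet_Ioc).2 (Eventually.of_forall fun r hr => ?_)
  have h2 : ∀ x : Torus L, (r, x) ∈ Set.Ioi s ×ˢ (Set.univ : Set (Torus L)) := fun x =>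
    ⟨hr.1, trivial⟩
  simp only [Set.indicator_of_mem (h2 _)]
  rw [supGrad, ← hS.ciSup' (hw r hr.1).continuous_gradSq.sqrt]

/-- Integrability of functions with an integrable singularity at the initial time. -/
lemma intervalIntegrable_of_singular {E : Type*} [NormedAddCommGroup E] {f : ℝ → E} {t C q : ℝ}
    (hst : s ≤ t) (hq : q < 1)
    (hf : AEStronglyMeasurable f (volume.restrict (Set.Ioc s t)))
    (hb : ∀ r, s < r → r ≤ t → ‖f r‖ ≤ C * (r - s) ^ (-q)) : IntervalIntegrable f volume s t := by
  have h1 := (intervalIntegrable_sub_rpow (s := s) (t := t) hq).const_mul C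
  rw [intervalIntegrable_iff_integrableOn_Ioc_of_le hst] at h1 ⊢
  exact Integrable.mono' h1 hf ((ae_restrict_iff' measurableSet_Ioc).2
    (Eventually.of_forall fun r hr => hb r hr.1 hr.2))

end Measurability

section SupGrad

variable {L : ℝ} [hL : Fact (0 < L)] {w : Torus L → ℝ}

lemma IsC.bddAbove_gradSq (h : IsC 1 w) : BddAbove (Set.range fun x => Real.sqrt (gradSq w x)) :=
  isCompact_range h.continuous_gradSq.sqrt |>.bddAbove

lemma IsC.sqrt_gradSq_le (h : IsC 1 w) (x : Torus L) : Real.sqrt (gradSq w x) ≤ supGrad w :=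
  le_ciSup h.bddAbove_gradSq x

omit hL in
lemma supGrad_nonneg (w : Torus L → ℝ) : 0 ≤ supGrad w :=
  Real.iSup_nonneg fun _ => Real.sqrt_nonneg _

omit hL in
lemma gradSq_le_of_pderiv {M : ℝ} (hM : ∀ i x, |pderiv i w x| ≤ M) (x : Torus L) :
    gradSq w x ≤ 2 * M ^ 2 := by
  simp only [gradSq, Fin.sum_univ_two]
  have h0 := sq_le_sq' (by linarith [neg_abs_le (pderiv 0 w x), hM 0 x])
    ((le_abs_self _).trans (hM 0 x))
  have h1 := sq_le_sq' (by linarith [neg_abs_le (pderiv 1 w x), hM 1 x])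
    ((le_abs_self _).trans (hM 1 x))
  linarith

omit hL in
lemma supGrad_le_of_pderiv {M : ℝ} (hM : ∀ i x, |pderiv i w x| ≤ M) : supGrad w ≤ 2 * M := by
  have hM0 : 0 ≤ M := (abs_nonneg _).trans (hM 0 0)
  refine ciSup_le fun x => ?_
  rw [Real.sqrt_le_left (by positivity)]
  nlinarith [gradSq_le_of_pderiv hM x, sq_nonneg M]

end SupGrad

end Phi42

end

/-! ### Truncated Parseval identities. -/

noncomputable section

namespace Phi42

section LowModes

variable (L : ℝ) [hL : Fact (0 < L)]

/-- The frequencies kept by the mollification at scale `2^{-N}`. -/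
def lowModes (N : ℕ) : Finset Freq :=
  (finite_cutoff L (by positivity : (0 : ℝ) < 2⁻¹ ^ N) 1).toFinset

/-- The Fourier multiplier of the mollification at scale `2^{-N}`. -/
def lowWeight (L : ℝ) (N : ℕ) (k : Freq) : ℝ := cutoff ((2 : ℝ)⁻¹ ^ N * ‖fvec L k‖)

lemma mollify_eq_sum (N : ℕ) (u : TDist) (x : Torus L) :
    mollify L ((2 : ℝ)⁻¹ ^ N) u x
      = ∑ k ∈ lowModes L N, ((lowWeight L N k : ℂ) * u k) * torusChar L k x := by
  rw [mollify_eq_tp, tp_eq_sum L]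
  · rfl
  · intro k hk
    have : cutoff ((2 : ℝ)⁻¹ ^ N * ‖fvec L k‖) = 0 := by simpa [lowModes] using hk
    simp only [this]
    simp

lemma conj_mollify_eq_sum (N : ℕ) (u : TDist) (x : Torus L) :
    (starRingEnd ℂ) (mollify L ((2 : ℝ)⁻¹ ^ N) u x)
      = ∑ k ∈ lowModes L N, ((lowWeight L N k : ℂ) * (starRingEnd ℂ) (u k)) *
        (starRingEnd ℂ) (torusChar L k x) := by
  rw [mollify_eq_sum, map_sum]
  simp only [map_mul, Complex.conj_ofReal]

lemma continuous_conj_mollify (N : ℕ) (u : TDist) :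
    Continuous fun x => (starRingEnd ℂ) (mollify L ((2 : ℝ)⁻¹ ^ N) u x) :=
  Complex.continuous_conj.comp (continuous_mollify L (by positivity) u)

variable {L}

/-- A truncated Parseval identity. -/
lemma sum_lowModes_mul_fcoef (N : ℕ) (u : TDist) {W : Torus L → ℂ} (hW : Continuous W) :
    ∑ k ∈ lowModes L N, ((lowWeight L N k : ℂ) * (starRingEnd ℂ) (u k)) *
        (((L ^ 2 : ℝ) : ℂ) * fcoef L W k)
      = ∫ x, W x * (starRingEnd ℂ) (mollify L ((2 : ℝ)⁻¹ ^ N) u x) := by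
  have hL' : (L : ℂ) ≠ 0 := by exact_mod_cast hL.out.ne'
  simp only [conj_mollify_eq_sum, Finset.mul_sum]
  rw [integral_finsetSum]
  · refine Finset.sum_congr rfl fun k _ => ?_
    simp only [mul_left_comm (W _)]
    rw [integral_const_mul, fcoef]
    push_cast
    field_simp
  · intro k _
    exact integrable_of_cont L (hW.mul (continuous_const.mul
      (Complex.continuous_conj.comp (continuous_torusChar L k))))

/-- Mollification averages translates against a kernel of total variation `lowConst`, so it
preserves Hölder bounds uniformly in N. The truncation uses a smooth cutoff because such uniform
bounds are what dominates the limit N → ∞. -/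
lemma HolB.l1Hol_conj_mollify {b V : ℝ} {G : Torus L → ℝ} (hG : HolB b V G) (N : ℕ) :
    L1Hol b (lowConst * V * L ^ 2) (lowConst * V * L ^ 2)
      (fun x => (starRingEnd ℂ) (mollify L ((2 : ℝ)⁻¹ ^ N) (fcoefR L G) x)) := by
  have hδ : (0 : ℝ) < 2⁻¹ ^ N := by positivity
  have hc := continuous_conj_mollify L N (fcoefR L G)
  have hGc : Continuous fun x => (G x : ℂ) := Complex.continuous_ofReal.comp hG.cont
  have hGb : ∀ x, ‖(G x : ℂ)‖ ≤ V := fun x => by simpa using hG.bound x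
  refine ⟨hc, integral_le_of_le hc.norm fun x => ?_, fun y => ?_⟩
  · rw [RCLike.norm_conj]
    exact norm_mollify_fcoef_le L hδ hGc hGb x
  · have hcs : Continuous fun x => (starRingEnd ℂ) (mollify L ((2 : ℝ)⁻¹ ^ N) (fcoefR L G)
        (x + proj L y)) := hc.comp (continuous_id.add continuous_const)
    refine (integral_le_of_le (hcs.sub hc).norm (M := lowConst * V * ‖y‖ ^ b) fun x => ?_).trans_eq
      (by ring)
    have h1 : mollify L ((2 : ℝ)⁻¹ ^ N) (fcoefR L G) (x + proj L y)
        - mollify L ((2 : ℝ)⁻¹ ^ N) (fcoefR L G) x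
        = conv L lowKer ((2 : ℝ)⁻¹ ^ N) (fun x => (G (x + proj L y) : ℂ) - G x) x := by
      rw [fcoefR, mollify_fcoef L hδ hGc, mollify_fcoef L hδ hGc, conv, conv, conv,
        ← integral_sub (integrable_conv isKernel_lowKer.int hGc hGb _ _)
          (integrable_conv isKernel_lowKer.int hGc hGb _ _)]
      congr 1
      ext z
      rw [mul_sub, add_right_comm]
    rw [Pi.sub_apply, ← map_sub, RCLike.norm_conj, h1, mul_assoc]
    refine norm_conv_le isKernel_lowKer.int (fun z => ?_) _ x
    rw [← Complex.ofReal_sub, Complex.norm_real]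
    exact hG.hol z y

/-- Bounded convergence for truncated Parseval sums. -/
lemma tendsto_integral_mul_conj_mollify {W : Torus L → ℂ} (hW : Continuous W) {G : Torus L → ℂ}
    (hG : Continuous G) :
    Tendsto (fun N : ℕ => ∫ x, W x * (starRingEnd ℂ) (mollify L ((2 : ℝ)⁻¹ ^ N) (fcoef L G) x))
      atTop (𝓝 (∫ x, W x * (starRingEnd ℂ) (G x))) := by
  obtain ⟨A, hA0, hA⟩ := exists_norm_bound hW
  obtain ⟨B, hB0, hB⟩ := exists_norm_bound hG
  refine tendsto_integral_of_dominated_convergence (fun _ => A * (lowConst * B))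
    (fun N => (hW.mul (continuous_conj_mollify L N _)).aestronglyMeasurable)
    (integrable_const _) (fun N => Eventually.of_forall fun x => ?_)
    (Eventually.of_forall fun x => ?_)
  · rw [norm_mul, RCLike.norm_conj]
    exact mul_le_mul (hA x) (norm_mollify_fcoef_le L (by positivity) hG hB x) (norm_nonneg _) hA0
  · exact ((Complex.continuous_conj.tendsto _).comp (tendsto_mollify_fcoef L hG x)).const_mul _

lemma norm_integral_mul_conj_mollify_le {W : Torus L → ℂ} (hW : Continuous W) {G : Torus L → ℂ}
    (hG : Continuous G) {A B : ℝ} (hA : ∀ x, ‖W x‖ ≤ A) (hB : ∀ x, ‖G x‖ ≤ B) (N : ℕ) :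
    ‖∫ x, W x * (starRingEnd ℂ) (mollify L ((2 : ℝ)⁻¹ ^ N) (fcoef L G) x)‖
      ≤ A * (lowConst * B) * L ^ 2 := by
  have hA0 : 0 ≤ A := (norm_nonneg _).trans (hA 0)
  refine (norm_integral_le_integral_norm _).trans
    (integral_le_of_le (hW.mul (continuous_conj_mollify L N _)).norm fun x => ?_)
  rw [Pi.mul_apply, norm_mul, RCLike.norm_conj]
  exact mul_le_mul (hA x) (norm_mollify_fcoef_le L (by positivity) hG hB x) (norm_nonneg _) hA0

/-- Parseval's identity, as a limit of truncated sums. -/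
lemma tendsto_sum_normSq_fcoef {W : Torus L → ℂ} (hW : Continuous W) :
    Tendsto (fun N => ∑ k ∈ lowModes L N, lowWeight L N k * L ^ 2 * ‖fcoef L W k‖ ^ 2) atTop
      (𝓝 (∫ x, ‖W x‖ ^ 2)) ∧
    ∀ A, (∀ x, ‖W x‖ ≤ A) → ∀ N, |∑ k ∈ lowModes L N, lowWeight L N k * L ^ 2 * ‖fcoef L W k‖ ^ 2|
      ≤ A * (lowConst * A) * L ^ 2 := by
  have h1 : ∀ N, ((∑ k ∈ lowModes L N, lowWeight L N k * L ^ 2 * ‖fcoef L W k‖ ^ 2 : ℝ) : ℂ)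
      = ∫ x, W x * (starRingEnd ℂ) (mollify L ((2 : ℝ)⁻¹ ^ N) (fcoef L W) x) := by
    intro N
    rw [← sum_lowModes_mul_fcoef N (fcoef L W) hW]
    push_cast
    refine Finset.sum_congr rfl fun k _ => ?_
    rw [← Complex.mul_conj']
    ring
  have h2 : ((∫ x, ‖W x‖ ^ 2 : ℝ) : ℂ) = ∫ x, W x * (starRingEnd ℂ) (W x) := by
    rw [← integral_complex_ofReal]
    refine integral_congr_ae (Eventually.of_forall fun x => ?_)
    simp only
    rw [Complex.mul_conj']
    push_cast; rfl
  refine ⟨?_, fun A hA N => ?_⟩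
  · have h3 := tendsto_integral_mul_conj_mollify hW hW
    rw [← h2] at h3
    simp only [← h1] at h3
    have h4 := (Complex.continuous_re.tendsto _).comp h3
    simpa only [Function.comp_def, Complex.ofReal_re] using h4
  · have h3 := norm_integral_mul_conj_mollify_le hW hW hA hA N
    rw [← h1, Complex.norm_real] at h3
    exact h3

/-- Convergence of truncated pairings with a distribution. -/
lemma tendsto_pairing_mul_conj_mollify {u : TDist} {a U b M V : ℝ} {w G : Torus L → ℝ}
    (hu : BlockBound L a U u) (hab : a < b) (hb : 0 ≤ b) (hb' : b ≤ 1) (hw : HolB b M w)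
    (hG : HolB b V G) :
    Tendsto (fun N : ℕ => pairing u fun x => (w x : ℂ) *
      (starRingEnd ℂ) (mollify L ((2 : ℝ)⁻¹ ^ N) (fcoefR L G) x)) atTop
      (𝓝 (pairing u fun x => ((w x * G x : ℝ) : ℂ))) := by
  have hGc : Continuous fun x => (G x : ℂ) := Complex.continuous_ofReal.comp hG.cont
  have hwc : Continuous fun x => (w x : ℂ) := Complex.continuous_ofReal.comp hw.cont
  refine tendsto_tsum_of_dominated_convergence ((summable_geo (sub_pos.2 hab)).mul_left
    (pairConst * U * (M * (lowConst * V * L ^ 2) + M * (lowConst * V * L ^ 2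
      + lowConst * V * L ^ 2)))) (fun n => ?_) (Eventually.of_forall fun N n =>
      norm_lpBlock_pairing_le hu hb hb' (hw.mul_l1Hol (hG.l1Hol_conj_mollify N)) n)
  have h1 := tendsto_integral_mul_conj_mollify ((continuous_lpBlock L n u).mul hwc) hGc
  simp only [Complex.conj_ofReal, Pi.mul_apply] at h1
  simp only [Complex.ofReal_mul]
  simpa only [mul_assoc, fcoefR] using h1

/-- Uniform bounds for truncated pairings. -/
lemma norm_pairing_mul_conj_mollify_le {u : TDist} {a U b M V : ℝ} {w G : Torus L → ℝ}
    (hu : BlockBound L a U u) (hab : a < b) (hb : 0 ≤ b) (hb' : b ≤ 1) (hw : HolB b M w)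
    (hG : HolB b V G) (N : ℕ) :
    ‖pairing u fun x => (w x : ℂ) *
      (starRingEnd ℂ) (mollify L ((2 : ℝ)⁻¹ ^ N) (fcoefR L G) x)‖ ≤
      pairConst * U * (3 * (lowConst * V * L ^ 2)) * geo (b - a) * M := by
  refine (norm_pairing_le hu hab hb hb'
    (hw.mul_l1Hol (hG.l1Hol_conj_mollify N))).trans_eq ?_
  ring

end LowModes

end Phi42

end

/-! ### Duhamel's formula for a single Fourier mode. -/

noncomputable section

namespace Phi42

section Duhamel

variable {a b : ℝ}

lemma IsPrimitive.congr {f f' g g' : ℝ → ℝ} (h : IsPrimitive f f' a b) (hab : a ≤ b)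
    (hf : ∀ t ∈ Set.Icc a b, g t = f t) (hf' : ∀ t ∈ Set.Ioc a b, g' t = f' t) :
    IsPrimitive g g' a b := by
  refine ⟨h.int.congr fun t ht => (hf' t (by rwa [Set.uIoc_of_le hab] at ht)).symm, fun t ht => ?_⟩
  rw [hf t ht, hf a ⟨le_rfl, hab⟩, h.eq t ht]
  congr 1
  refine intervalIntegral.integral_congr_ae (Eventually.of_forall fun r hr => ?_)
  rw [Set.uIoc_of_le ht.1] at hr
  exact (hf' r ⟨hr.1, hr.2.trans ht.2⟩).symm

/-- Dominated convergence in the integral identity; measurability of the limiting density comes from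
the approximations. -/
lemma IsPrimitive.of_tendsto {f f' : ℕ → ℝ → ℝ} {F F' bound : ℝ → ℝ} (hab : a ≤ b)
    (h : ∀ N, IsPrimitive (f N) (f' N) a b)
    (hf : ∀ t ∈ Set.Icc a b, Tendsto (fun N => f N t) atTop (𝓝 (F t)))
    (hf' : ∀ t ∈ Set.Ioc a b, Tendsto (fun N => f' N t) atTop (𝓝 (F' t)))
    (hb : ∀ N, ∀ t ∈ Set.Ioc a b, |f' N t| ≤ bound t) (hbi : IntervalIntegrable bound volume a b) :
    IsPrimitive F F' a b := by
  have hlim : ∀ᵐ r ∂(volume.restrict (Set.Ioc a b)), Tendsto (fun N => f' N r) atTop (𝓝 (F' r)) :=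
    (ae_restrict_iff' measurableSet_Ioc).2 (Eventually.of_forall hf')
  have hi : ∀ N, IntegrableOn (f' N) (Set.Ioc a b) := fun N =>
    (intervalIntegrable_iff_integrableOn_Ioc_of_le hab).1 (h N).int
  have hbi' := (intervalIntegrable_iff_integrableOn_Ioc_of_le hab).1 hbi
  refine ⟨(intervalIntegrable_iff_integrableOn_Ioc_of_le hab).2 ?_, fun t ht => ?_⟩
  · refine Integrable.mono' hbi' (aestronglyMeasurable_of_tendsto_ae atTop
      (fun N => (hi N).aestronglyMeasurable) hlim) ?_
    refine (ae_restrict_iff' measurableSet_Ioc).2 (Eventually.of_forall fun r hr => ?_)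
    exact le_of_tendsto (hf' r hr).norm (Eventually.of_forall fun N => hb N r hr)
  · have hsub : Set.uIoc a t ⊆ Set.Ioc a b := by
      rw [Set.uIoc_of_le ht.1]; exact Set.Ioc_subset_Ioc le_rfl ht.2
    have h1 : Tendsto (fun N => ∫ r in a..t, f' N r) atTop (𝓝 (∫ r in a..t, F' r)) := by
      refine intervalIntegral.tendsto_integral_filter_of_dominated_convergence bound
        (Eventually.of_forall fun N => ((hi N).mono_set hsub).aestronglyMeasurable)
        (Eventually.of_forall fun N => Eventually.of_forall fun r hr => hb N r (hsub hr))
        (hbi.mono_set ?_) (Eventually.of_forall fun r hr => hf' r (hsub hr))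
      rw [Set.uIcc_of_le hab, Set.uIcc_of_le ht.1]
      exact Set.Icc_subset_Icc le_rfl ht.2
    have h2 := (hf a ⟨le_rfl, hab⟩).add h1
    exact tendsto_nhds_unique ((hf t ht)) (h2.congr fun N => ((h N).eq t ht).symm)

/-- Variation of constants: the solution is exp(-(t-a)λ) times a primitive, and the product rule
recovers the differential equation. The functional Φ, later the real or imaginary part, reduces the
matter to real functions. -/
lemma isPrimitive_duhamel {z F : ℝ → ℂ} {lam : ℝ} (hab : a ≤ b)
    (hF : IntervalIntegrable F volume a b)
    (hz : ∀ t ∈ Set.Icc a b, z t = (Real.exp (-(t - a) * lam) : ℂ) * z a +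
      ∫ r in a..t, (Real.exp (-(t - r) * lam) : ℂ) * F r) (Φ : ℂ →L[ℝ] ℝ) :
    IsPrimitive (fun t => Φ (z t)) (fun r => -lam * Φ (z r) + Φ (F r)) a b := by
  have hΦ : IntervalIntegrable (fun r => Φ (F r)) volume a b := by
    rw [intervalIntegrable_iff_integrableOn_Ioc_of_le hab] at hF ⊢
    exact Φ.integrable_comp hF
  have hmul : ∀ (c : ℝ) (x : ℂ), Φ ((c : ℂ) * x) = c * Φ x := fun c x => by
    rw [← Complex.real_smul, map_smul, smul_eq_mul]
  have hE : IsPrimitive (fun t => Real.exp (-(t - a) * lam))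
      (fun t => -lam * Real.exp (-(t - a) * lam)) a b := by
    refine IsPrimitive.of_hasDerivAt (fun t => ?_) (by fun_prop)
    have h1 : HasDerivAt (fun t : ℝ => -(t - a) * lam) (-1 * lam) t :=
      (((hasDerivAt_id t).sub_const a).neg).mul_const lam
    convert h1.exp using 1
    ring
  have hP : IsPrimitive (fun t => Φ (z a) + ∫ r in a..t, Real.exp ((r - a) * lam) * Φ (F r))
      (fun r => Real.exp ((r - a) * lam) * Φ (F r)) a b :=
    ⟨hΦ.continuousOn_mul (by fun_prop), fun t _ => by simp⟩
  have hzt : ∀ t ∈ Set.Icc a b, Φ (z t) = Real.exp (-(t - a) * lam) *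
      (Φ (z a) + ∫ r in a..t, Real.exp ((r - a) * lam) * Φ (F r)) := by
    intro t ht
    have hsub : Set.uIcc a t ⊆ Set.uIcc a b := by
      rw [Set.uIcc_of_le hab, Set.uIcc_of_le ht.1]; exact Set.Icc_subset_Icc le_rfl ht.2
    have hi : IntervalIntegrable (fun r => (Real.exp (-(t - r) * lam) : ℂ) * F r) volume a t :=
      (hF.mono_set hsub).continuousOn_mul (by fun_prop)
    rw [hz t ht, map_add, hmul, ← Φ.intervalIntegral_comp_comm hi, mul_add,
      ← intervalIntegral.integral_const_mul]
    congr 1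
    refine intervalIntegral.integral_congr fun r _ => ?_
    simp only [hmul]
    rw [← mul_assoc, ← Real.exp_add]
    ring_nf
  refine (hE.mul hP hab).congr hab hzt fun t ht => ?_
  rw [hzt t ⟨ht.1.le, ht.2⟩, ← mul_assoc (Real.exp _) (Real.exp _), ← Real.exp_add]
  ring_nf
  simp

/-- The squares of the real and imaginary parts obey the product rule; their sum is the squared
modulus. -/
lemma isPrimitive_normSq_duhamel {z F : ℝ → ℂ} {lam : ℝ} (hab : a ≤ b)
    (hF : IntervalIntegrable F volume a b)
    (hz : ∀ t ∈ Set.Icc a b, z t = (Real.exp (-(t - a) * lam) : ℂ) * z a +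
      ∫ r in a..t, (Real.exp (-(t - r) * lam) : ℂ) * F r) :
    IsPrimitive (fun t => ‖z t‖ ^ 2)
      (fun r => -2 * lam * ‖z r‖ ^ 2 + 2 * ((starRingEnd ℂ) (z r) * F r).re) a b := by
  have h1 := isPrimitive_duhamel hab hF hz Complex.reCLM
  have h2 := isPrimitive_duhamel hab hF hz Complex.imCLM
  refine ((h1.mul h1 hab).add (h2.mul h2 hab)).congr hab (fun t _ => ?_) fun t _ => ?_
  · rw [← Complex.normSq_eq_norm_sq, Complex.normSq_apply]
    rfl
  · rw [← Complex.normSq_eq_norm_sq, Complex.normSq_apply]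
    simp only [Complex.reCLM_apply, Complex.imCLM_apply, Complex.mul_re, Complex.conj_re,
      Complex.conj_im]
    ring

end Duhamel

end Phi42

end

/-! ### The energy balance of the linearized equation. -/

noncomputable section

namespace Phi42

section Energy

variable {L : ℝ} [hL : Fact (0 < L)]

/-- The contribution of the zeroth order terms of the linearized equation to the energy balance. -/
def reaction (one two : TDist) (cc : ℝ) (v J : Torus L → ℝ) : ℝ :=
  -3 * ((∫ x, v x ^ 2 * J x * J x) + (pairing one fun x => ((2 * v x * J x * J x : ℝ) : ℂ)).re
    + (pairing two fun x => ((J x * J x : ℝ) : ℂ)).re) + 3 * cc * ∫ x, J x * J x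

/-- The zeroth order terms of the linearized equation. -/
def reactionF (L : ℝ) [Fact (0 < L)] (one two : TDist) (cc : ℝ) (v J : Torus L → ℝ) : TDist :=
  - (3 : ℂ) • (fcoefR L (fun x => v x ^ 2 * J x) + mulDist L one (fun x => 2 * v x * J x)
    + mulDist L two J) + (3 * cc : ℂ) • fcoefR L J

lemma sum_lowModes_mul_mulDist {u : TDist} {a U b M : ℝ} {w : Torus L → ℝ}
    (hu : BlockBound L a U u) (hab : a < b) (hb : 0 ≤ b) (hb' : b ≤ 1) (hw : HolB b M w) (N : ℕ)
    (z : TDist) :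
    ∑ k ∈ lowModes L N, ((lowWeight L N k : ℂ) * (starRingEnd ℂ) (z k)) *
        (((L ^ 2 : ℝ) : ℂ) * mulDist L u w k)
      = pairing u fun x => (w x : ℂ) * (starRingEnd ℂ) (mollify L ((2 : ℝ)⁻¹ ^ N) z x) := by
  rw [hw.sum_mulDist hu hab hb hb']
  simp only [conj_mollify_eq_sum]

variable {one two : TDist} {a U b M V cc : ℝ} {v J : Torus L → ℝ}

/-- Truncated Parseval, term by term: the work of the forcing on the kept modes is the reaction in
physical space with one copy of J replaced by its mollification. -/
lemma sum_lowModes_reactionF (h1 : BlockBound L a U one) (h2 : BlockBound L a U two) (hab : a < b)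
    (hb : 0 ≤ b) (hb' : b ≤ 1) (hv : HolB b M v) (hJ : HolB b V J) (N : ℕ) :
    ∑ k ∈ lowModes L N, ((lowWeight L N k : ℂ) * (starRingEnd ℂ) (fcoefR L J k)) *
        (((L ^ 2 : ℝ) : ℂ) * reactionF L one two cc v J k)
      = -3 * ((∫ x, ((v x ^ 2 * J x : ℝ) : ℂ) *
            (starRingEnd ℂ) (mollify L ((2 : ℝ)⁻¹ ^ N) (fcoefR L J) x))
          + (pairing one fun x => ((2 * v x * J x : ℝ) : ℂ) *
            (starRingEnd ℂ) (mollify L ((2 : ℝ)⁻¹ ^ N) (fcoefR L J) x))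
          + pairing two fun x => (J x : ℂ) *
            (starRingEnd ℂ) (mollify L ((2 : ℝ)⁻¹ ^ N) (fcoefR L J) x))
        + 3 * cc * ∫ x, (J x : ℂ) *
            (starRingEnd ℂ) (mollify L ((2 : ℝ)⁻¹ ^ N) (fcoefR L J) x) := by
  have e1 := sum_lowModes_mul_fcoef N (fcoefR L J) (W := fun x => ((v x ^ 2 * J x : ℝ) : ℂ))
    (Complex.continuous_ofReal.comp ((hv.cont.pow 2).mul hJ.cont))
  have e2 := sum_lowModes_mul_fcoef N (fcoefR L J) (W := fun x => (J x : ℂ))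
    (Complex.continuous_ofReal.comp hJ.cont)
  have e3 := sum_lowModes_mul_mulDist h1 hab hb hb' ((hv.const_mul 2).mul hJ) N (fcoefR L J)
  have e4 := sum_lowModes_mul_mulDist h2 hab hb hb' hJ N (fcoefR L J)
  rw [← e1, ← e2, ← e3, ← e4, ← Finset.sum_add_distrib, ← Finset.sum_add_distrib, Finset.mul_sum,
    Finset.mul_sum, ← Finset.sum_add_distrib]
  refine Finset.sum_congr rfl fun k _ => ?_
  simp only [reactionF, Pi.add_apply, Pi.smul_apply, smul_eq_mul, fcoefR]
  ring

lemma tendsto_reaction (h1 : BlockBound L a U one) (h2 : BlockBound L a U two) (hab : a < b)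
    (hb : 0 ≤ b) (hb' : b ≤ 1) (hv : HolB b M v) (hJ : HolB b V J) :
    Tendsto (fun N => (∑ k ∈ lowModes L N, ((lowWeight L N k : ℂ) *
      (starRingEnd ℂ) (fcoefR L J k)) * (((L ^ 2 : ℝ) : ℂ) * reactionF L one two cc v J k)).re)
      atTop (𝓝 (reaction one two cc v J)) := by
  have hJc : Continuous fun x => (J x : ℂ) := Complex.continuous_ofReal.comp hJ.cont
  have e1 := tendsto_integral_mul_conj_mollify (W := fun x => ((v x ^ 2 * J x : ℝ) : ℂ))
    (Complex.continuous_ofReal.comp ((hv.cont.pow 2).mul hJ.cont)) hJc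
  have e2 := tendsto_integral_mul_conj_mollify hJc hJc
  have e3 := tendsto_pairing_mul_conj_mollify h1 hab hb hb' ((hv.const_mul 2).mul hJ) hJ
  have e4 := tendsto_pairing_mul_conj_mollify h2 hab hb hb' hJ hJ
  have e5 := (((e1.add e3).add e4).const_mul (-3)).add (e2.const_mul (3 * (cc : ℂ)))
  have e6 := (Complex.continuous_re.tendsto _).comp e5
  simp only [sum_lowModes_reactionF h1 h2 hab hb hb' hv hJ]
  have e7 : (-3 * ((∫ x, ((v x ^ 2 * J x : ℝ) : ℂ) * (starRingEnd ℂ) (J x : ℂ))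
      + (pairing one fun x => ((2 * v x * J x * J x : ℝ) : ℂ))
      + pairing two fun x => ((J x * J x : ℝ) : ℂ))
      + 3 * cc * ∫ x, (J x : ℂ) * (starRingEnd ℂ) (J x : ℂ)).re = reaction one two cc v J := by
    simp only [Complex.conj_ofReal, ← Complex.ofReal_mul]
    rw [integral_complex_ofReal, integral_complex_ofReal, reaction]
    simp
  rw [← e7]
  exact e6

/-- The constant in the uniform bound for the truncated reaction terms. -/
def reactionConst (L a U b V : ℝ) : ℝ :=
  12 * ((lowConst * V * L ^ 2) * V + pairConst * U * (3 * (lowConst * V * L ^ 2)) * geo (b - a) * V)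

/-- The dominating bound, uniform in N. When M is of order (r-s)^{-γ} it is integrable in time,
since 2γ < 1 and cc is at most of order (r-s)^{-γ}. -/
lemma abs_reaction_le (h1 : BlockBound L a U one) (h2 : BlockBound L a U two) (hab : a < b)
    (hb : 0 ≤ b) (hb' : b ≤ 1) (hv : HolB b M v) (hJ : HolB b V J) (N : ℕ) :
    |(∑ k ∈ lowModes L N, ((lowWeight L N k : ℂ) * (starRingEnd ℂ) (fcoefR L J k)) *
      (((L ^ 2 : ℝ) : ℂ) * reactionF L one two cc v J k)).re|
      ≤ reactionConst L a U b V * (M ^ 2 + M + 1 + |cc|) := by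
  refine (Complex.abs_re_le_norm _).trans ?_
  rw [sum_lowModes_reactionF h1 h2 hab hb hb' hv hJ]
  have hJc : Continuous fun x => (J x : ℂ) := Complex.continuous_ofReal.comp hJ.cont
  have hM := hv.nonneg
  have hV := hJ.nonneg
  have hU := h1.nonneg
  have hlow := lowConst_nonneg
  have hpc := one_le_pairConst
  have hg := geo_nonneg (b - a)
  have hJb : ∀ x, ‖(J x : ℂ)‖ ≤ V := fun x => by simpa using hJ.bound x
  have e1 := norm_integral_mul_conj_mollify_le (W := fun x => ((v x ^ 2 * J x : ℝ) : ℂ))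
    (Complex.continuous_ofReal.comp ((hv.cont.pow 2).mul hJ.cont)) hJc (A := M ^ 2 * V) (fun x => by
      rw [Complex.norm_real, norm_mul, norm_pow]
      exact mul_le_mul (pow_le_pow_left₀ (norm_nonneg _) (hv.bound x) 2) (hJ.bound x)
        (norm_nonneg _) (by positivity)) hJb N
  have e2 := norm_integral_mul_conj_mollify_le hJc hJc hJb hJb N
  have e3 := norm_pairing_mul_conj_mollify_le h1 hab hb hb' ((hv.const_mul 2).mul hJ) hJ N
  have e4 := norm_pairing_mul_conj_mollify_le h2 hab hb hb' hJ hJ N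
  rw [abs_two] at e3
  set K := lowConst * V * L ^ 2 with hK
  set G := pairConst * U * (3 * K) * geo (b - a) with hG
  have hK0 : 0 ≤ K := by positivity
  have hG0 : 0 ≤ G := by positivity
  refine (norm_add_le _ _).trans ?_
  rw [norm_mul, norm_mul, norm_mul, Complex.norm_real, norm_neg, Complex.norm_ofNat]
  have e5 := norm_add₃_le (a := ∫ x, ((v x ^ 2 * J x : ℝ) : ℂ) *
            (starRingEnd ℂ) (mollify L ((2 : ℝ)⁻¹ ^ N) (fcoefR L J) x))
    (b := pairing one fun x => ((2 * v x * J x : ℝ) : ℂ) *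
            (starRingEnd ℂ) (mollify L ((2 : ℝ)⁻¹ ^ N) (fcoefR L J) x))
    (c := pairing two fun x => (J x : ℂ) *
            (starRingEnd ℂ) (mollify L ((2 : ℝ)⁻¹ ^ N) (fcoefR L J) x))
  have e6 : reactionConst L a U b V = 12 * (K * V + G * V) := rfl
  rw [e6, Real.norm_eq_abs]
  have e7 : 3 * |cc| * ‖∫ x, (J x : ℂ) *
      (starRingEnd ℂ) (mollify L ((2 : ℝ)⁻¹ ^ N) (fcoefR L J) x)‖ ≤ 3 * |cc| * (K * V) :=
    mul_le_mul_of_nonneg_left (e2.trans_eq (by rw [hK]; ring)) (by positivity)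
  have e8 : 0 ≤ K * V := by positivity
  have e9 : 0 ≤ G * V := by positivity
  have e10 : 0 ≤ |cc| := abs_nonneg cc
  have e1' : ‖∫ x, ((v x ^ 2 * J x : ℝ) : ℂ) *
      (starRingEnd ℂ) (mollify L ((2 : ℝ)⁻¹ ^ N) (fcoefR L J) x)‖ ≤ M ^ 2 * (K * V) :=
    e1.trans_eq (by rw [hK]; ring)
  have p1 : 0 ≤ M ^ 2 * (K * V) := by positivity
  have p2 : 0 ≤ M ^ 2 * (G * V) := by positivity
  have p3 : 0 ≤ M * (K * V) := by positivity
  have p4 : 0 ≤ M * (G * V) := by positivity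
  have p5 : 0 ≤ |cc| * (K * V) := by positivity
  have p6 : 0 ≤ |cc| * (G * V) := by positivity
  nlinarith

end Energy

section EnergyBalance

variable {L : ℝ} [hL : Fact (0 < L)]

lemma sum_gradient_modes {J : Torus L → ℝ} (hJ : IsC 1 J) (N : ℕ) :
    ∑ k ∈ lowModes L N, lowWeight L N k * L ^ 2 * (freqSq L k * ‖fcoefR L J k‖ ^ 2)
      = ∑ i, ∑ k ∈ lowModes L N, lowWeight L N k * L ^ 2 *
          ‖fcoef L (fun x => (pderiv i J x : ℂ)) k‖ ^ 2 := by
  rw [Finset.sum_comm]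
  refine Finset.sum_congr rfl fun k _ => ?_
  rw [← Finset.mul_sum]
  congr 1
  have h1 : ∀ i, ‖fcoef L (fun x => (pderiv i J x : ℂ)) k‖ ^ 2
      = fvec L k i ^ 2 * ‖fcoefR L J k‖ ^ 2 := fun i => by
    have := hJ.fcoefR_pderiv i k
    rw [fcoefR] at this
    rw [this, norm_mul, norm_mul, Complex.norm_I, one_mul, Complex.norm_real, mul_pow,
      Real.norm_eq_abs, sq_abs]
  simp only [h1]
  rw [← Finset.sum_mul, freqSq_eq, EuclideanSpace.norm_sq_eq]
  simp

lemma integral_sum_pderiv_sq {J : Torus L → ℝ} (hJ : IsC 1 J) :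
    ∑ i, ∫ x, ‖(pderiv i J x : ℂ)‖ ^ 2 = l2GradSq J := by
  rw [l2GradSq]
  simp only [gradSq]
  rw [integral_finsetSum]
  · simp
  · intro i _
    exact integrable_of_cont L ((hJ.continuous_pderiv i).pow 2)

/-- The energy balance of the linearized equation. -/
lemma IsLinearized.isPrimitive_l2Sq {m β γ s T : ℝ} {one two : ℝ → TDist}
    {v J : ℝ → Torus L → ℝ} {h : Torus L → ℝ} (hJ : IsLinearized L m β γ s one two v h J)
    (hm : 0 < m) (hh : Continuous h) (hsT : s < T) {b U V q : ℝ} (hγ : 0 < γ) (hγ' : 2 * γ < 1)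
    (hb : 0 < b) (hb' : b ≤ 1) (hq : 2 * q < 1) (hv : SingHol b s T γ v)
    (h1 : ∀ r, s < r → r ≤ T → BlockBound L (b / 2) U (one r))
    (h2 : ∀ r, s < r → r ≤ T → BlockBound L (b / 2) U (two r))
    (hreg : ∀ r, s < r → r ≤ T → HolB b V (J r) ∧ IsC 1 (J r) ∧
      ∀ i x, |pderiv i (J r) x| ≤ V * (r - s) ^ (-q)) :
    IsPrimitive (fun t => l2Sq (J t)) (fun r => -2 * l2GradSq (J r) - 2 * m * l2Sq (J r)
      + 2 * reaction (one r) (two r) (cInf L m (r - s)) (v r) (J r)) s T := by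
  obtain ⟨Vv, hVv⟩ := hv
  obtain ⟨hc0, -, D, hD0, hD⟩ := cInf_bound L hm hγ (by linarith)
  have hbb : b / 2 < b := by linarith
  have hlow := lowConst_nonneg
  have hJcont : ∀ t ∈ Set.Icc s T, Continuous fun x => (J t x : ℂ) := fun t ht => by
    refine Complex.continuous_ofReal.comp ?_
    rcases ht.1.eq_or_lt with rfl | hlt
    · rwa [hJ.initial]
    · exact hJ.inClass.cont t hlt
  have hsq : ∀ t, ∫ x, ‖(J t x : ℂ)‖ ^ 2 = l2Sq (J t) := fun t => by simp [l2Sq]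
  set F : ℝ → TDist := fun r => reactionF L (one r) (two r) (cInf L m (r - s)) (v r) (J r) with hF
  -- Duhamel's formula holds from time s itself, because J s = h; so each mode is absolutely
  -- continuous on the closed interval.
  have hmode : ∀ k, IsPrimitive (fun t => ‖fcoefR L (J t) k‖ ^ 2)
      (fun r => -2 * (m + freqSq L k) * ‖fcoefR L (J r) k‖ ^ 2
        + 2 * ((starRingEnd ℂ) (fcoefR L (J r) k) * F r k).re) s T := by
    intro k
    refine isPrimitive_normSq_duhamel hsT.le (hJ.mild T hsT k).1 fun t ht => ?_
    rcases ht.1.eq_or_lt with rfl | hlt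
    · simp
    · rw [hJ.initial]
      exact (hJ.mild t hlt k).2
  have hsum : ∀ N, IsPrimitive
      (fun t => ∑ k ∈ lowModes L N, lowWeight L N k * L ^ 2 * ‖fcoef L (fun x => (J t x : ℂ)) k‖ ^ 2)
      (fun r => ∑ k ∈ lowModes L N, lowWeight L N k * L ^ 2 *
        (-2 * (m + freqSq L k) * ‖fcoefR L (J r) k‖ ^ 2
        + 2 * ((starRingEnd ℂ) (fcoefR L (J r) k) * F r k).re)) s T := fun N =>
    IsPrimitive.finsetSum fun k _ => (hmode k).const_mul _
  have hsplit : ∀ N, ∀ r ∈ Set.Ioc s T, ∑ k ∈ lowModes L N, lowWeight L N k * L ^ 2 *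
        (-2 * (m + freqSq L k) * ‖fcoefR L (J r) k‖ ^ 2
        + 2 * ((starRingEnd ℂ) (fcoefR L (J r) k) * F r k).re)
      = -2 * (∑ i, ∑ k ∈ lowModes L N, lowWeight L N k * L ^ 2 *
          ‖fcoef L (fun x => (pderiv i (J r) x : ℂ)) k‖ ^ 2)
        - 2 * m * (∑ k ∈ lowModes L N, lowWeight L N k * L ^ 2 *
          ‖fcoef L (fun x => (J r x : ℂ)) k‖ ^ 2)
        + 2 * (∑ k ∈ lowModes L N, ((lowWeight L N k : ℂ) * (starRingEnd ℂ) (fcoefR L (J r) k)) *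
          (((L ^ 2 : ℝ) : ℂ) * F r k)).re := by
    intro N r hr
    rw [← sum_gradient_modes (hreg r hr.1 hr.2).2.1 N, Complex.re_sum, Finset.mul_sum,
      Finset.mul_sum, Finset.mul_sum, ← Finset.sum_sub_distrib, ← Finset.sum_add_distrib]
    refine Finset.sum_congr rfl fun k _ => ?_
    have e : ((lowWeight L N k : ℂ) * (starRingEnd ℂ) (fcoefR L (J r) k)) *
        (((L ^ 2 : ℝ) : ℂ) * F r k) = ((lowWeight L N k * L ^ 2 : ℝ) : ℂ) *
        ((starRingEnd ℂ) (fcoefR L (J r) k) * F r k) := by push_cast; ring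
    rw [e, Complex.re_ofReal_mul, fcoefR]
    ring
  -- Passage to the limit N → ∞. The dominating function collects |∇J|², of order (r-s)^{-2q} with
  -- 2q < 1, the mass term, and the reaction bound.
  refine IsPrimitive.of_tendsto hsT.le hsum (fun t ht => ?_) (fun r hr => ?_)
    (bound := fun r => 2 * (2 * (V * (lowConst * V) * L ^ 2 * (r - s) ^ (-(2 * q))))
      + 2 * m * (V * (lowConst * V) * L ^ 2) + 2 * (reactionConst L (b / 2) U b V *
      (Vv ^ 2 * (r - s) ^ (-(2 * γ)) + Vv * (r - s) ^ (-γ) + 1 + D * (r - s) ^ (-γ))))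
    (fun N r hr => ?_) ?_
  · rw [← hsq]
    exact (tendsto_sum_normSq_fcoef (hJcont t ht)).1
  · simp only [hsplit _ r hr]
    obtain ⟨hH, hC, -⟩ := hreg r hr.1 hr.2
    refine ((Tendsto.const_mul _ ?_).sub (Tendsto.const_mul _ ?_)).add (Tendsto.const_mul _ ?_)
    · rw [← integral_sum_pderiv_sq hC]
      exact tendsto_finsetSum _ fun i _ => (tendsto_sum_normSq_fcoef
        (Complex.continuous_ofReal.comp (hC.continuous_pderiv i))).1
    · rw [← hsq]
      exact (tendsto_sum_normSq_fcoef (hJcont r ⟨hr.1.le, hr.2⟩)).1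
    · exact tendsto_reaction (h1 r hr.1 hr.2) (h2 r hr.1 hr.2) hbb hb.le hb' (hVv r hr.1 hr.2) hH
  · rw [hsplit N r hr]
    obtain ⟨hH, hC, hP⟩ := hreg r hr.1 hr.2
    have hx : 0 < r - s := sub_pos.2 hr.1
    have b1 : ∀ i, |∑ k ∈ lowModes L N, lowWeight L N k * L ^ 2 *
          ‖fcoef L (fun x => (pderiv i (J r) x : ℂ)) k‖ ^ 2|
        ≤ V * (lowConst * V) * L ^ 2 * (r - s) ^ (-(2 * q)) := fun i => by
      refine ((tendsto_sum_normSq_fcoef (Complex.continuous_ofReal.comp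
        (hC.continuous_pderiv i))).2 (V * (r - s) ^ (-q)) (fun x => by simpa using hP i x)
        N).trans_eq ?_
      rw [show -(2 * q) = -q + -q by ring, Real.rpow_add hx]
      ring
    have b2 := (tendsto_sum_normSq_fcoef (hJcont r ⟨hr.1.le, hr.2⟩)).2 V
      (fun x => by simpa using hH.bound x) N
    have b3 := abs_reaction_le (cc := cInf L m (r - s)) (h1 r hr.1 hr.2) (h2 r hr.1 hr.2) hbb hb.le
      hb' (hVv r hr.1 hr.2) hH N
    have hRC : 0 ≤ reactionConst L (b / 2) U b V := by
      have hV := hH.nonneg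
      have hU := (h1 r hr.1 hr.2).nonneg
      have hg := geo_nonneg (b - b / 2)
      have hpc := one_le_pairConst
      unfold reactionConst
      positivity
    have b4 : (Vv * (r - s) ^ (-γ)) ^ 2 = Vv ^ 2 * (r - s) ^ (-(2 * γ)) := by
      rw [show -(2 * γ) = -γ + -γ by ring, Real.rpow_add hx]
      ring
    have b5 : |cInf L m (r - s)| ≤ D * (r - s) ^ (-γ) := by
      rw [abs_of_nonneg (hc0 _ hx)]
      exact hD _ hx
    rw [b4] at b3
    have b6 := b3.trans (mul_le_mul_of_nonneg_left (add_le_add_right b5 _) hRC)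
    refine (abs_add_le _ _).trans (add_le_add ((abs_sub _ _).trans (add_le_add ?_ ?_)) ?_)
    · rw [abs_mul, abs_neg, abs_two]
      refine mul_le_mul_of_nonneg_left ((Finset.abs_sum_le_sum_abs _ _).trans ?_) zero_le_two
      rw [Fin.sum_univ_two, two_mul]
      exact add_le_add (b1 0) (b1 1)
    · rw [abs_mul, abs_of_nonneg (by positivity : 0 ≤ 2 * m)]
      exact mul_le_mul_of_nonneg_left b2 (by positivity)
    · rw [abs_mul, abs_two]
      exact mul_le_mul_of_nonneg_left b6 zero_le_two
  · have i1 := intervalIntegrable_sub_rpow (s := s) (t := T) hq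
    have i2 := intervalIntegrable_sub_rpow (s := s) (t := T) hγ'
    have i3 := intervalIntegrable_sub_rpow (s := s) (t := T) (by linarith : γ < 1)
    exact (((i1.const_mul _).const_mul 2).const_mul 2 |>.add intervalIntegrable_const).add
      ((((((i2.const_mul _).add (i3.const_mul _)).add intervalIntegrable_const).add
        (i3.const_mul _)).const_mul _).const_mul 2)

end EnergyBalance

end Phi42

end

/-! ### Dyadic interpolation and Young's inequality. -/

noncomputable section

namespace Phi42

section Interpolation

/-- A dyadic sum interpolating between two bounds. -/
lemma tsum_min_le {α : ℝ} (hα : 0 < α) (hα' : α < 1) {A B : ℝ} (hA : 0 ≤ A) (hB : 0 ≤ B) :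
    (Summable fun n : ℕ => (2 : ℝ) ^ (α * n) * min A (B * (2 : ℝ) ^ (-(1 * n : ℝ)))) ∧
    ∑' n : ℕ, (2 : ℝ) ^ (α * n) * min A (B * (2 : ℝ) ^ (-(1 * n : ℝ)))
      ≤ (geo α + geo (1 - α)) * (A + A ^ (1 - α) * B ^ α) := by
  set f : ℕ → ℝ := fun n => (2 : ℝ) ^ (α * n) * min A (B * (2 : ℝ) ^ (-(1 * n : ℝ))) with hf
  have hg1 := geo_nonneg α
  have hg2 := geo_nonneg (1 - α)
  have h1α : 0 < 1 - α := by linarith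
  have hs2 := summable_geo h1α
  have hf0 : ∀ n, 0 ≤ f n := fun n => mul_nonneg (by positivity) (le_min hA (by positivity))
  have hfB : ∀ n, f n ≤ B * (2 : ℝ) ^ (-((1 - α) * n)) := by
    intro n
    calc f n ≤ (2 : ℝ) ^ (α * n) * (B * (2 : ℝ) ^ (-(1 * n : ℝ))) := by
          simp only [hf]; gcongr; exact min_le_right _ _
      _ = _ := by
          rw [show -((1 - α) * (n : ℝ)) = α * n + -(1 * n) by ring, Real.rpow_add (by norm_num)]
          ring
  have hfA : ∀ n, f n ≤ (2 : ℝ) ^ (α * n) * A := fun n => by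
    simp only [hf]; gcongr; exact min_le_left _ _
  have hsf : Summable f := Summable.of_nonneg_of_le hf0 hfB (hs2.mul_left B)
  refine ⟨hsf, ?_⟩
  have hAB : 0 ≤ A ^ (1 - α) * B ^ α := by positivity
  -- If B ≤ A the second bound alone is summable with total at most a multiple of A. Otherwise the
  -- sum is split where the two bounds cross.
  rcases le_or_gt B A with hBA | hAB'
  · calc ∑' n, f n ≤ ∑' n : ℕ, B * (2 : ℝ) ^ (-((1 - α) * n)) :=
          hsf.tsum_le_tsum hfB (hs2.mul_left B)
      _ = B * geo (1 - α) := by rw [tsum_mul_left, geo]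
      _ ≤ A * geo (1 - α) := by gcongr
      _ ≤ _ := by nlinarith
  rcases hA.eq_or_lt with rfl | hA0
  · have : ∀ n, f n = 0 := fun n => le_antisymm (by simpa using hfA n) (hf0 n)
    rw [tsum_congr this, tsum_zero]
    positivity
  have hB0 : 0 < B := hA0.trans hAB'
  -- The crossover is 2^N ≈ B/A. Up to N the terms are at most 2^{αn}A, beyond N at most
  -- 2^{-(1-α)n}B; both are geometric away from the crossover, where they have size P = A^{1-α}B^α.
  obtain ⟨N, hN1, hN2⟩ := exists_nat_pow_near (x := B / A) (y := 2)
    ((one_le_div hA0).2 hAB'.le) (by norm_num)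
  set P := A ^ (1 - α) * B ^ α with hP
  have hP1 : A * (B / A) ^ α = P := by
    rw [Real.div_rpow hB0.le hA0.le, hP, Real.rpow_sub hA0, Real.rpow_one]
    field_simp
  have hP2 : B * (B / A) ^ (-(1 - α)) = P := by
    rw [Real.rpow_neg (by positivity), Real.div_rpow hB0.le hA0.le, hP, inv_div,
      Real.rpow_sub hB0, Real.rpow_one]
    field_simp
  have hfirst : ∑ n ∈ Finset.range (N + 1), f n ≤ P * geo α := by
    calc ∑ n ∈ Finset.range (N + 1), f n
        ≤ ∑ n ∈ Finset.range (N + 1), P * (2 : ℝ) ^ (-(α * ((N + 1 - 1 - n : ℕ) : ℝ))) := by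
          refine Finset.sum_le_sum fun n hn => ?_
          have hnN : n ≤ N := by simpa [Nat.lt_succ_iff] using hn
          refine (hfA n).trans ?_
          have e : (2 : ℝ) ^ (α * n)
              = ((2 : ℝ) ^ N) ^ α * (2 : ℝ) ^ (-(α * ((N + 1 - 1 - n : ℕ) : ℝ))) := by
            rw [two_pow_rpow, ← Real.rpow_add (by norm_num), Nat.add_sub_cancel, Nat.cast_sub hnN]
            ring_nf
          rw [e, ← hP1]
          have : ((2 : ℝ) ^ N) ^ α ≤ (B / A) ^ α := Real.rpow_le_rpow (by positivity) hN1 hα.le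
          calc _ ≤ (B / A) ^ α * (2 : ℝ) ^ (-(α * ((N + 1 - 1 - n : ℕ) : ℝ))) * A := by gcongr
            _ = _ := by ring
      _ = P * ∑ n ∈ Finset.range (N + 1), (2 : ℝ) ^ (-(α * (n : ℝ))) := by
          rw [← Finset.mul_sum, Finset.sum_range_reflect (fun n => (2 : ℝ) ^ (-(α * (n : ℝ))))]
      _ ≤ P * geo α := by
          refine mul_le_mul_of_nonneg_left ?_ hAB
          exact (summable_geo hα).sum_le_tsum _ fun _ _ => by positivity
  have hsecond : ∑' n, f (n + (N + 1)) ≤ P * geo (1 - α) := by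
    rw [geo, ← tsum_mul_left]
    refine ((summable_nat_add_iff (N + 1)).2 hsf).tsum_le_tsum (fun n => ?_) (hs2.mul_left P)
    refine (hfB _).trans ?_
    have e : (2 : ℝ) ^ (-((1 - α) * ((n + (N + 1) : ℕ) : ℝ)))
        = ((2 : ℝ) ^ (N + 1)) ^ (-(1 - α)) * (2 : ℝ) ^ (-((1 - α) * n)) := by
      rw [two_pow_rpow, ← Real.rpow_add (by norm_num)]
      push_cast
      ring_nf
    rw [e, ← hP2, ← mul_assoc]
    have : ((2 : ℝ) ^ (N + 1)) ^ (-(1 - α)) ≤ (B / A) ^ (-(1 - α)) :=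
      Real.rpow_le_rpow_of_nonpos (by positivity) hN2.le (by linarith)
    gcongr
  rw [← hsf.sum_add_tsum_nat_add (N + 1)]
  nlinarith

end Interpolation

section Young

/-- Weighted AM-GM for εx and Cy; the constant C is tuned so that the factors ε^θ cancel and exactly
K remains. -/
lemma exists_weighted_young {θ : ℝ} (hθ : 0 < θ) (hθ' : θ < 1) {K ε : ℝ} (hK : 0 ≤ K) (hε : 0 < ε) :
    ∃ C, 0 ≤ C ∧ ∀ x y : ℝ, 0 ≤ x → 0 ≤ y → K * (x ^ θ * y ^ (1 - θ)) ≤ ε * x + C * y := by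
  have h1 : 0 < 1 - θ := by linarith
  refine ⟨(K * ε ^ (-θ)) ^ (1 - θ)⁻¹, by positivity, fun x y hx hy => ?_⟩
  have hD : 0 ≤ K * ε ^ (-θ) := by positivity
  have h2 := Real.geom_mean_le_arith_mean2_weighted hθ.le h1.le (mul_nonneg hε.le hx)
    (mul_nonneg (Real.rpow_nonneg hD (1 - θ)⁻¹) hy) (by ring)
  rw [Real.mul_rpow hε.le hx, Real.mul_rpow (by positivity) hy, ← Real.rpow_mul hD,
    inv_mul_cancel₀ h1.ne', Real.rpow_one, Real.rpow_neg hε.le] at h2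
  have h3 : 0 < ε ^ θ := by positivity
  have h4 : ε ^ θ * x ^ θ * (K * (ε ^ θ)⁻¹ * y ^ (1 - θ)) = K * (x ^ θ * y ^ (1 - θ)) := by
    field_simp
  rw [h4] at h2
  refine h2.trans ?_
  rw [Real.rpow_neg hε.le]
  have h5 : 0 ≤ ε * x := by positivity
  have h6 : 0 ≤ (K * (ε ^ θ)⁻¹) ^ (1 - θ)⁻¹ * y := by positivity
  nlinarith

/-- The absorption of the interpolated terms into the dissipation. -/
lemma exists_absorption {α : ℝ} (hα : 0 < α) (hα' : α < 1) {K : ℝ} (hK : 0 ≤ K) :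
    ∃ c, 0 < c ∧ ∀ a d G X Y Z : ℝ, 0 ≤ a → 0 ≤ d → 0 ≤ G → 0 ≤ X → 0 ≤ Y → 0 ≤ Z →
      K * a * (2 * (Z * Y) + (2 * (Z * Y)) ^ (1 - α) * (2 * (G * Y ^ 2 + 2 * (Z * X))) ^ α)
        + K * d * (Y ^ 2 + (Y ^ 2) ^ (1 - α) * (2 * (Y * X)) ^ α)
      ≤ X ^ 2 + 5 * Z ^ 2 + c * (a ^ (2 : ℝ) + a ^ (2 / (1 + α)) * G ^ (2 * α / (1 + α))
        + a ^ (2 / (1 - α)) + d + d ^ (2 / (2 - α))) * Y ^ 2 := by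
  have h1α : 0 < 1 - α := by linarith
  set K' := 8 * K with hK'
  have hK'0 : 0 ≤ K' := by positivity
  obtain ⟨C2, hC2, hY2⟩ := exists_weighted_young (θ := (1 - α) / 2) (by linarith) (by linarith)
    hK'0 one_pos
  obtain ⟨C3, hC3, hY3⟩ := exists_weighted_young (θ := α) hα hα' (by positivity : 0 ≤ K' ^ 2 / 4)
    (by norm_num : (0 : ℝ) < 1 / 2)
  obtain ⟨C5, hC5, hY5⟩ := exists_weighted_young (θ := α / 2) (by linarith) (by linarith)
    hK'0 (by norm_num : (0 : ℝ) < 1 / 2)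
  refine ⟨1 + K' ^ 2 / 4 + C2 + C3 + K' + C5, by positivity,
    fun a d G X Y Z ha hd hG hX hY hZ => ?_⟩
  have two_le : ∀ p : ℝ, 0 ≤ p → p ≤ 1 → (2 : ℝ) ^ p ≤ 2 := fun p _ hp =>
    (Real.rpow_le_rpow_of_exponent_le (by norm_num) hp).trans_eq (Real.rpow_one 2)
  have e1 : (2 * (Z * Y)) ^ (1 - α) ≤ 2 * (Z * Y) ^ (1 - α) := by
    rw [Real.mul_rpow (by norm_num) (by positivity)]
    exact mul_le_mul_of_nonneg_right (two_le _ h1α.le (by linarith)) (by positivity)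
  have e2 : (2 * (G * Y ^ 2 + 2 * (Z * X))) ^ α ≤ 4 * ((G * Y ^ 2) ^ α + (Z * X) ^ α) := by
    have h1 : (2 * (G * Y ^ 2 + 2 * (Z * X))) ^ α ≤ (4 * (G * Y ^ 2 + Z * X)) ^ α := by
      refine Real.rpow_le_rpow (by positivity) ?_ hα.le
      have : 0 ≤ G * Y ^ 2 := by positivity
      linarith
    have h2 : (4 : ℝ) ^ α ≤ 4 :=
      (Real.rpow_le_rpow_of_exponent_le (by norm_num) hα'.le).trans_eq (Real.rpow_one 4)
    have h3 := Real.rpow_add_le_add_rpow (a := G * Y ^ 2) (b := Z * X) (by positivity)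
      (by positivity) hα.le hα'.le
    have h4 : (4 * (G * Y ^ 2 + Z * X)) ^ α = 4 ^ α * (G * Y ^ 2 + Z * X) ^ α :=
      Real.mul_rpow (by norm_num) (by positivity)
    rw [h4] at h1
    exact h1.trans (mul_le_mul h2 h3 (by positivity) (by norm_num))
  have e3 : (2 * (Y * X)) ^ α ≤ 2 * (Y * X) ^ α := by
    rw [Real.mul_rpow (by norm_num) (by positivity)]
    exact mul_le_mul_of_nonneg_right (two_le _ hα.le hα'.le) (by positivity)
  have sq : ∀ x : ℝ, x ^ 2 = x ^ (2 : ℝ) := fun x => (Real.rpow_two x).symm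
  -- Homogeneity fixes the exponents: after a power of Z² is isolated, what remains is a power of
  -- the second contribution to the error term times Y².
  have i2 : a * ((Z * Y) ^ (1 - α) * (G * Y ^ 2) ^ α) = (Z ^ 2) ^ ((1 - α) / 2) *
      (a ^ (2 / (1 + α)) * G ^ (2 * α / (1 + α)) * Y ^ 2) ^ (1 - (1 - α) / 2) := by
    rw [Real.mul_rpow hZ hY, Real.mul_rpow hG (by positivity),
      Real.mul_rpow (by positivity) (by positivity), Real.mul_rpow (by positivity) (by positivity),
      sq Z, sq Y, ← Real.rpow_mul hZ, ← Real.rpow_mul hY, ← Real.rpow_mul hY, ← Real.rpow_mul ha,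
      ← Real.rpow_mul hG]
    have a1 : 2 * ((1 - α) / 2) = 1 - α := by ring
    have a2 : 2 / (1 + α) * (1 - (1 - α) / 2) = 1 := by field_simp; ring
    have a3 : 2 * α / (1 + α) * (1 - (1 - α) / 2) = α := by field_simp; ring
    have a4 : 2 * (1 - (1 - α) / 2) = (1 - α) + 2 * α := by ring
    rw [a1, a2, a3, a4, Real.rpow_one, Real.rpow_add_of_nonneg hY (by linarith) (by linarith)]
    ring
  -- This term is linear in Z. Once Z is split off by completing the square, the remaining square
  -- factors into X² and the contribution a^{2/(1-α)}Y².
  have i3 : (a * (Y ^ (1 - α) * X ^ α)) ^ 2 = (X ^ 2) ^ α * (a ^ (2 / (1 - α)) * Y ^ 2) ^ (1 - α) := by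
    rw [Real.mul_rpow (by positivity) (by positivity), mul_pow, mul_pow, sq a, sq X, sq Y,
      sq (Y ^ (1 - α)), sq (X ^ α), ← Real.rpow_mul hY, ← Real.rpow_mul hY, ← Real.rpow_mul hX,
      ← Real.rpow_mul hX, ← Real.rpow_mul ha]
    have a1 : 2 / (1 - α) * (1 - α) = 2 := by field_simp
    rw [a1, mul_comm α 2, mul_comm (1 - α) 2]
    ring
  have i3' : (Z * Y) ^ (1 - α) * (Z * X) ^ α = Z * (Y ^ (1 - α) * X ^ α) := by
    rw [Real.mul_rpow hZ hY, Real.mul_rpow hZ hX]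
    have : Z ^ (1 - α) * Z ^ α = Z := by
      rw [← Real.rpow_add_of_nonneg hZ h1α.le hα.le, sub_add_cancel, Real.rpow_one]
    calc _ = (Z ^ (1 - α) * Z ^ α) * (Y ^ (1 - α) * X ^ α) := by ring
      _ = _ := by rw [this]
  -- The interpolated part of the second Wick power, factored into X² and d^{2/(2-α)}Y².
  have i5 : d * ((Y ^ 2) ^ (1 - α) * (Y * X) ^ α)
      = (X ^ 2) ^ (α / 2) * (d ^ (2 / (2 - α)) * Y ^ 2) ^ (1 - α / 2) := by
    rw [Real.mul_rpow hY hX, Real.mul_rpow (by positivity) (by positivity), sq X, sq Y,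
      ← Real.rpow_mul hY, ← Real.rpow_mul hY, ← Real.rpow_mul hX, ← Real.rpow_mul hd]
    have h2α : 2 - α ≠ 0 := by linarith
    have a1 : 2 / (2 - α) * (1 - α / 2) = 1 := by field_simp
    have a2 : 2 * (1 - α / 2) = 2 * (1 - α) + α := by ring
    have a3 : 2 * (α / 2) = α := by ring
    rw [a1, a2, a3, Real.rpow_one, Real.rpow_add_of_nonneg hY (by linarith) hα.le]
    ring
  have t1 : K' * (a * (Z * Y)) ≤ Z ^ 2 + K' ^ 2 / 4 * (a ^ (2 : ℝ) * Y ^ 2) := by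
    rw [Real.rpow_two]
    nlinarith [sq_nonneg (Z - K' / 2 * (a * Y))]
  have t2 := hY2 (Z ^ 2) (a ^ (2 / (1 + α)) * G ^ (2 * α / (1 + α)) * Y ^ 2) (by positivity)
    (by positivity)
  rw [← i2, one_mul] at t2
  have t3 := hY3 (X ^ 2) (a ^ (2 / (1 - α)) * Y ^ 2) (by positivity) (by positivity)
  rw [← i3] at t3
  have t3' : K' * (a * ((Z * Y) ^ (1 - α) * (Z * X) ^ α)) ≤
      Z ^ 2 + K' ^ 2 / 4 * (a * (Y ^ (1 - α) * X ^ α)) ^ 2 := by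
    rw [i3']
    nlinarith [sq_nonneg (Z - K' / 2 * (a * (Y ^ (1 - α) * X ^ α)))]
  have t5 := hY5 (X ^ 2) (d ^ (2 / (2 - α)) * Y ^ 2) (by positivity) (by positivity)
  rw [← i5] at t5
  -- Expanding the powers of sums costs at most 2 · 4 = 8, the factor in K'. The splittings above
  -- spend Z² three times and X²/2 twice, within the budget X² + 5Z².
  have s1 : K * a * (2 * (Z * Y) + (2 * (Z * Y)) ^ (1 - α) * (2 * (G * Y ^ 2 + 2 * (Z * X))) ^ α)
      ≤ K' * (a * (Z * Y)) + K' * (a * ((Z * Y) ^ (1 - α) * (G * Y ^ 2) ^ α))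
        + K' * (a * ((Z * Y) ^ (1 - α) * (Z * X) ^ α)) := by
    calc _ ≤ K * a * (8 * (Z * Y) + (2 * (Z * Y) ^ (1 - α)) *
          (4 * ((G * Y ^ 2) ^ α + (Z * X) ^ α))) := by
          have : 0 ≤ Z * Y := by positivity
          gcongr
          norm_num
      _ = _ := by rw [hK']; ring
  have s2 : K * d * (Y ^ 2 + (Y ^ 2) ^ (1 - α) * (2 * (Y * X)) ^ α)
      ≤ K' * (d * Y ^ 2) + K' * (d * ((Y ^ 2) ^ (1 - α) * (Y * X) ^ α)) := by
    calc _ ≤ K * d * (8 * Y ^ 2 + (Y ^ 2) ^ (1 - α) * (8 * (Y * X) ^ α)) := by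
          have h1 : 0 ≤ Y ^ 2 := by positivity
          have h2 : 0 ≤ (Y * X) ^ α := by positivity
          refine mul_le_mul_of_nonneg_left (add_le_add (by linarith)
            (mul_le_mul_of_nonneg_left (by linarith) (by positivity))) (by positivity)
      _ = _ := by rw [hK']; ring
  set p1 := a ^ (2 : ℝ) * Y ^ 2 with hp1
  set p2 := a ^ (2 / (1 + α)) * G ^ (2 * α / (1 + α)) * Y ^ 2 with hp2
  set p3 := a ^ (2 / (1 - α)) * Y ^ 2 with hp3
  set p4 := d * Y ^ 2 with hp4
  set p5 := d ^ (2 / (2 - α)) * Y ^ 2 with hp5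
  have q1 : 0 ≤ p1 := by positivity
  have q2 : 0 ≤ p2 := by positivity
  have q3 : 0 ≤ p3 := by positivity
  have q4 : 0 ≤ p4 := by positivity
  have q5 : 0 ≤ p5 := by positivity
  set c := 1 + K' ^ 2 / 4 + C2 + C3 + K' + C5 with hc
  have r1 : K' ^ 2 / 4 * p1 ≤ c * p1 := mul_le_mul_of_nonneg_right (by rw [hc]; linarith) q1
  have hKK : 0 ≤ K' ^ 2 / 4 := by positivity
  have r2 : C2 * p2 ≤ c * p2 := mul_le_mul_of_nonneg_right (by rw [hc]; linarith) q2
  have r3 : C3 * p3 ≤ c * p3 := mul_le_mul_of_nonneg_right (by rw [hc]; linarith) q3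
  have r4 : K' * p4 ≤ c * p4 := mul_le_mul_of_nonneg_right (by rw [hc]; linarith) q4
  have r5 : C5 * p5 ≤ c * p5 := mul_le_mul_of_nonneg_right (by rw [hc]; linarith) q5
  have fin : c * (a ^ (2 : ℝ) + a ^ (2 / (1 + α)) * G ^ (2 * α / (1 + α))
        + a ^ (2 / (1 - α)) + d + d ^ (2 / (2 - α))) * Y ^ 2
      = c * p1 + c * p2 + c * p3 + c * p4 + c * p5 := by
    rw [hp1, hp2, hp3, hp4, hp5]; ring
  rw [fin]
  have hZ2 : 0 ≤ Z ^ 2 := by positivity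
  linarith

end Young

end Phi42

end

/-! ### Duality with gradients and the bound on the reaction terms. -/

noncomputable section

namespace Phi42

section Products

variable {L : ℝ} {w z : Torus L → ℝ}

lemma IsC.mul {n : WithTop ℕ∞} (hw : IsC n w) (hz : IsC n z) : IsC n (fun x => w x * z x) :=
  ContDiff.mul (f := torusLift w) (g := torusLift z) hw hz

lemma IsC.const_mul {n : WithTop ℕ∞} (c : ℝ) (hw : IsC n w) : IsC n (fun x => c * w x) :=
  ContDiff.mul (f := fun _ => c) (g := torusLift w) contDiff_const hw

lemma IsC.pderiv_mul (hw : IsC 1 w) (hz : IsC 1 z) (i : Fin 2) (x : Torus L) :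
    pderiv i (fun x => w x * z x) x = pderiv i w x * z x + w x * pderiv i z x := by
  have h := ((hw.hasDerivAt_pderiv i x).mul (hz.hasDerivAt_pderiv i x)).deriv
  simp only [AddCircle.coe_zero, Pi.single_zero, add_zero] at h
  exact h

lemma IsC.sqrt_gradSq_mul_le (hw : IsC 1 w) (hz : IsC 1 z) (x : Torus L) :
    Real.sqrt (gradSq (fun x => w x * z x) x)
      ≤ |z x| * Real.sqrt (gradSq w x) + |w x| * Real.sqrt (gradSq z x) := by
  have h : ∀ f : Torus L → ℝ, Real.sqrt (gradSq f x) = ‖(WithLp.toLp 2 fun i => pderiv i f x : Pln)‖ := by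
    intro f
    rw [EuclideanSpace.norm_eq]
    simp [gradSq]
  have e : (WithLp.toLp 2 fun i => pderiv i (fun x => w x * z x) x : Pln)
      = z x • (WithLp.toLp 2 fun i => pderiv i w x : Pln)
        + w x • (WithLp.toLp 2 fun i => pderiv i z x : Pln) := by
    ext i
    simp only [hw.pderiv_mul hz, PiLp.add_apply, PiLp.smul_apply, smul_eq_mul]
    ring
  rw [h, h, h, e]
  refine (norm_add_le _ _).trans_eq ?_
  rw [norm_smul, norm_smul, Real.norm_eq_abs, Real.norm_eq_abs]

lemma IsC.sqrt_gradSq_const_mul (hw : IsC 1 w) {c : ℝ} (hc : 0 ≤ c) (x : Torus L) :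
    Real.sqrt (gradSq (fun x => c * w x) x) = c * Real.sqrt (gradSq w x) := by
  have h1 : ∀ i, pderiv i (fun x => c * w x) x = c * pderiv i w x := fun i =>
    ((hw.hasDerivAt_pderiv i x).const_mul c).deriv
  have h2 : gradSq (fun x => c * w x) x = c ^ 2 * gradSq w x := by
    simp only [gradSq, h1, mul_pow, Finset.mul_sum]
  rw [h2, Real.sqrt_mul (sq_nonneg c), Real.sqrt_sq hc]

variable [hL : Fact (0 < L)]

/-- The Cauchy-Schwarz inequality for continuous functions on the torus. -/
lemma integral_mul_le_sqrt (hw : Continuous w) (hz : Continuous z) :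
    ∫ x, w x * z x ≤ Real.sqrt (∫ x, w x ^ 2) * Real.sqrt (∫ x, z x ^ 2) := by
  have i1 : Integrable fun x => w x ^ 2 := integrable_of_cont L (hw.pow 2)
  have i2 : Integrable fun x => z x ^ 2 := integrable_of_cont L (hz.pow 2)
  have i3 : Integrable fun x => w x * z x := integrable_of_cont L (hw.mul hz)
  -- The quadratic polynomial ∫(w + tz)² in t is nonnegative, hence has nonpositive discriminant.
  have h : ∀ t : ℝ, 0 ≤ (∫ x, z x ^ 2) * (t * t) + (2 * ∫ x, w x * z x) * t + ∫ x, w x ^ 2 := by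
    intro t
    have h1 : 0 ≤ ∫ x, (w x + t * z x) ^ 2 := integral_nonneg fun x => sq_nonneg _
    have h2 : ∫ x, (w x + t * z x) ^ 2
        = ∫ x, ((t * t) * z x ^ 2 + (2 * t) * (w x * z x) + w x ^ 2) := by
      congr 1; ext x; ring
    have i4 : Integrable fun x => (t * t) * z x ^ 2 + (2 * t) * (w x * z x) :=
      (i2.const_mul _).add (i3.const_mul _)
    rw [h2, integral_add i4 i1,
      integral_add (i2.const_mul _) (i3.const_mul _), integral_const_mul, integral_const_mul] at h1
    linarith
  have h3 := discrim_le_zero h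
  rw [discrim] at h3
  rw [← Real.sqrt_mul (integral_nonneg fun x => sq_nonneg _)]
  refine Real.le_sqrt_of_sq_le ?_
  linarith

end Products

section Duality

/-- Duality between negative Besov spaces and Sobolev functions, with interpolation. The constant
does not depend on the torus. -/
lemma exists_pairing_le {α : ℝ} (hα : 0 < α) (hα' : α < 1) : ∃ C, 0 ≤ C ∧
    ∀ (L : ℝ) [Fact (0 < L)] (u : TDist) (U : ℝ) (W : Torus L → ℝ) (A B : ℝ), BlockBound L α U u →
      IsC 1 W → ∫ x, |W x| ≤ A → ∫ x, Real.sqrt (gradSq W x) ≤ B →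
      ‖pairing u fun x => (W x : ℂ)‖ ≤ C * U * (A + A ^ (1 - α) * B ^ α) := by
  have hpc := one_le_pairConst
  have hg1 := geo_nonneg α
  have hg2 := geo_nonneg (1 - α)
  refine ⟨1 + pairConst * (geo α + geo (1 - α)), by positivity,
    fun L _ u U W A B hu hW hA hB => ?_⟩
  have hU := hu.nonneg
  have hA0 : 0 ≤ A := (integral_nonneg fun _ => abs_nonneg _).trans hA
  have hB0 : 0 ≤ B := (integral_nonneg fun _ => Real.sqrt_nonneg _).trans hB
  have hWc : Continuous fun x => (W x : ℂ) := Complex.continuous_ofReal.comp hW.continuous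
  -- The L¹ norm of the gradient is a mean Lipschitz constant, so the dyadic pairing estimate
  -- applies with b = 1.
  have hH : L1Hol 1 A B (fun x => (W x : ℂ)) := by
    refine ⟨hWc, by simpa using hA, fun y => ?_⟩
    simp only [← Complex.ofReal_sub, Complex.norm_real, Real.norm_eq_abs, Real.rpow_one]
    refine (hW.integral_shift_sub_le y).trans ?_
    rw [mul_comm]
    gcongr
  obtain ⟨hs, hle⟩ := tsum_min_le hα hα' hA0 hB0
  -- For n ≥ 1 a block is bounded both by its supremum times A and by the gain 2^{-n}B, and the
  -- smaller bound is kept; block 0 only has the first. The series of minima is summed by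
  -- `tsum_min_le`.
  have hbd : ∀ n : ℕ, ‖∫ x, lpBlock L n u x * (W x : ℂ)‖ ≤ (if n = 0 then U * A else 0) +
      pairConst * U * ((2 : ℝ) ^ (α * n) * min A (B * (2 : ℝ) ^ (-(1 * n : ℝ)))) := by
    intro n
    have h1 : ‖∫ x, lpBlock L n u x * (W x : ℂ)‖ ≤ U * (2 : ℝ) ^ (α * n) * A :=
      (norm_integral_mul_le hWc (hu n)).trans
        (mul_le_mul_of_nonneg_left hH.l1 (by positivity))
    have hmin : 0 ≤ min A (B * (2 : ℝ) ^ (-(1 * n : ℝ))) := le_min hA0 (by positivity)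
    rcases eq_or_ne n 0 with rfl | hn
    · simp only [if_true]
      refine le_add_of_le_of_nonneg (h1.trans_eq ?_) (by positivity)
      simp
    · rw [if_neg hn, zero_add]
      have h2 : ‖∫ x, lpBlock L n u x * (W x : ℂ)‖
          ≤ pairConst * (U * (2 : ℝ) ^ (α * n)) * B * (2 : ℝ) ^ (-(1 * n : ℝ)) := by
        simp only [lpBlock_eq_tp]
        exact exists_block_pairing.choose_spec.2 L n _ 1 A B _ _ (annSupp_lpMul L n u)
          (fun x => by rw [← lpBlock_eq_tp]; exact hu n x) hn zero_le_one le_rfl hH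
      rcases le_total A (B * (2 : ℝ) ^ (-(1 * n : ℝ))) with h | h
      · rw [min_eq_left h]
        have : 0 ≤ U * (2 : ℝ) ^ (α * n) * A := by positivity
        nlinarith
      · rw [min_eq_right h]
        exact h2.trans_eq (by ring)
  have h3 := tsum_of_norm_bounded (((hasSum_ite_eq (0 : ℕ) (U * A))).add
    (hs.mul_left (pairConst * U)).hasSum) hbd
  rw [tsum_mul_left] at h3
  have h4 : 0 ≤ A ^ (1 - α) * B ^ α := by positivity
  have h5 : pairConst * U * ∑' n : ℕ, (2 : ℝ) ^ (α * n) * min A (B * (2 : ℝ) ^ (-(1 * n : ℝ)))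
      ≤ pairConst * U * ((geo α + geo (1 - α)) * (A + A ^ (1 - α) * B ^ α)) :=
    mul_le_mul_of_nonneg_left hle (by positivity)
  have h6 : 0 ≤ U * (A ^ (1 - α) * B ^ α) := by positivity
  calc _ ≤ _ := h3
    _ ≤ U * A + pairConst * U * ((geo α + geo (1 - α)) * (A + A ^ (1 - α) * B ^ α)) := by linarith
    _ ≤ _ := by nlinarith

/-- The reaction terms are controlled by the dissipation and the error term. -/
lemma exists_reaction_le {α : ℝ} (hα : 0 < α) (hα' : α < 1) : ∃ c, 0 < c ∧
    ∀ (L : ℝ) [Fact (0 < L)] (one two : TDist) (cc : ℝ) (v J : Torus L → ℝ), 0 ≤ cc →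
      besov L (-α) one < ⊤ → besov L (-α) two < ⊤ → IsC 1 v → IsC 1 J →
      2 * reaction one two cc v J ≤ l2GradSq J - l2Sq (fun x => v x * J x)
        + 2 * errorTerm L c α one two v cc * l2Sq J := by
  obtain ⟨C, hC, hpair⟩ := exists_pairing_le hα hα'
  -- The factor 6 is the 3 of `reaction` times the 2 of twice the reaction. In -6Z² + 5Z² one copy
  -- of Z² survives as dissipation.
  obtain ⟨c, hc, habs⟩ := exists_absorption hα hα' (by positivity : 0 ≤ 6 * C)
  -- The added 3 pays for the renormalization term: 6 cc Y² = 2 · 3 cc Y².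
  refine ⟨c + 3, by positivity, fun L _ one two cc v J hcc hone htwo hv hJ => ?_⟩
  have h1 := blockBound_of_besov_neg hα.le hone
  have h2 := blockBound_of_besov_neg hα.le htwo
  have ha := h1.nonneg
  have hd := h2.nonneg
  have hvJ : Continuous fun x => v x * J x := hv.continuous.mul hJ.continuous
  set a := (besov L (-α) one).toReal with ha_def
  set d := (besov L (-α) two).toReal with hd_def
  set X := Real.sqrt (l2GradSq J) with hX
  set Y := Real.sqrt (l2Sq J) with hY
  set Z := Real.sqrt (l2Sq fun x => v x * J x) with hZ
  set G := supGrad v with hG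
  have hG0 : 0 ≤ G := supGrad_nonneg v
  have hX0 : 0 ≤ X := Real.sqrt_nonneg _
  have hY0 : 0 ≤ Y := Real.sqrt_nonneg _
  have hZ0 : 0 ≤ Z := Real.sqrt_nonneg _
  have hX2 : X ^ 2 = l2GradSq J := Real.sq_sqrt (integral_nonneg fun x => gradSq_nonneg J x)
  have hY2 : Y ^ 2 = l2Sq J := Real.sq_sqrt (integral_nonneg fun x => sq_nonneg _)
  have hZ2 : Z ^ 2 = l2Sq (fun x => v x * J x) :=
    Real.sq_sqrt (integral_nonneg fun x => sq_nonneg _)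
  have hgJ : Continuous fun x => Real.sqrt (gradSq J x) := hJ.continuous_gradSq.sqrt
  have hgJ2 : ∫ x, Real.sqrt (gradSq J x) ^ 2 = l2GradSq J := by
    rw [l2GradSq]
    congr 1; ext x
    exact Real.sq_sqrt (gradSq_nonneg J x)
  have habs2 : ∀ f : Torus L → ℝ, ∫ x, |f x| ^ 2 = l2Sq f := fun f => by simp [l2Sq]
  have cZY : ∫ x, |v x * J x| * |J x| ≤ Z * Y := by
    have := integral_mul_le_sqrt hvJ.abs hJ.continuous.abs
    rwa [habs2 fun x => v x * J x, habs2 J] at this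
  have cZX : ∫ x, |v x * J x| * Real.sqrt (gradSq J x) ≤ Z * X := by
    have := integral_mul_le_sqrt hvJ.abs hgJ
    rwa [habs2 fun x => v x * J x, hgJ2] at this
  have cYX : ∫ x, |J x| * Real.sqrt (gradSq J x) ≤ Y * X := by
    have := integral_mul_le_sqrt hJ.continuous.abs hgJ
    rwa [habs2 J, hgJ2] at this
  have cYY : ∫ x, J x ^ 2 = Y ^ 2 := hY2.symm
  have hJJ : IsC 1 fun x => J x * J x := hJ.mul hJ
  have gJJ : ∀ x, Real.sqrt (gradSq (fun x => J x * J x) x) ≤ 2 * (|J x| * Real.sqrt (gradSq J x)) :=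
    fun x => (hJ.sqrt_gradSq_mul_le hJ x).trans_eq (by ring)
  have p2 : ‖pairing two fun x => ((J x * J x : ℝ) : ℂ)‖
      ≤ C * d * (Y ^ 2 + (Y ^ 2) ^ (1 - α) * (2 * (Y * X)) ^ α) := by
    refine hpair L two d (fun x => J x * J x) _ _ h2 hJJ (le_of_eq ?_) ?_
    · rw [← cYY]
      congr 1; ext x
      rw [abs_mul_self, pow_two]
    · calc _ ≤ ∫ x, 2 * (|J x| * Real.sqrt (gradSq J x)) :=
            integral_mono (integrable_of_cont L hJJ.continuous_gradSq.sqrt)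
              (integrable_of_cont L (continuous_const.mul (hJ.continuous.abs.mul hgJ))) gJJ
        _ ≤ _ := by rw [integral_const_mul]; linarith
  have hW : IsC 1 fun x => 2 * v x * J x * J x := ((hv.const_mul 2).mul hJ).mul hJ
  have p1 : ‖pairing one fun x => ((2 * v x * J x * J x : ℝ) : ℂ)‖ ≤ C * a * (2 * (Z * Y) +
      (2 * (Z * Y)) ^ (1 - α) * (2 * (G * Y ^ 2 + 2 * (Z * X))) ^ α) := by
    refine hpair L one a (fun x => 2 * v x * J x * J x) _ _ h1 hW ?_ ?_
    · calc _ = ∫ x, 2 * (|v x * J x| * |J x|) := by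
            congr 1; ext x
            simp only [abs_mul, abs_two]
            ring
        _ ≤ _ := by rw [integral_const_mul]; linarith
    · have hpt : ∀ x, Real.sqrt (gradSq (fun x => 2 * v x * J x * J x) x)
          ≤ 2 * (G * J x ^ 2 + 2 * (|v x * J x| * Real.sqrt (gradSq J x))) := by
        intro x
        have e : (fun x => 2 * v x * J x * J x) = fun x => 2 * (v x * (J x * J x)) := by
          ext x; ring
        rw [e, (hv.mul hJJ).sqrt_gradSq_const_mul zero_le_two]
        refine mul_le_mul_of_nonneg_left ?_ zero_le_two
        refine (hv.sqrt_gradSq_mul_le hJJ x).trans ?_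
        refine add_le_add ?_ ?_
        · rw [abs_mul_self, ← pow_two, mul_comm]
          exact mul_le_mul_of_nonneg_right (hv.sqrt_gradSq_le x) (sq_nonneg _)
        · refine (mul_le_mul_of_nonneg_left (gJJ x) (abs_nonneg _)).trans_eq ?_
          rw [abs_mul]; ring
      calc _ ≤ ∫ x, 2 * (G * J x ^ 2 + 2 * (|v x * J x| * Real.sqrt (gradSq J x))) :=
            integral_mono (integrable_of_cont L hW.continuous_gradSq.sqrt)
              (integrable_of_cont L (continuous_const.mul
                ((continuous_const.mul (hJ.continuous.pow 2)).add
                  (continuous_const.mul (hvJ.abs.mul hgJ))))) hpt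
        _ = 2 * (G * (∫ x, J x ^ 2) + 2 * ∫ x, |v x * J x| * Real.sqrt (gradSq J x)) := by
            rw [integral_const_mul, integral_add, integral_const_mul, integral_const_mul]
            · exact integrable_of_cont L (continuous_const.mul (hJ.continuous.pow 2))
            · exact integrable_of_cont L (continuous_const.mul (hvJ.abs.mul hgJ))
        _ ≤ _ := by rw [cYY]; linarith
  have r1 := (Complex.abs_re_le_norm _).trans p1
  have r2 := (Complex.abs_re_le_norm _).trans p2
  have hab := habs a d G X Y Z ha hd hG0 hX0 hY0 hZ0
  have e1 : ∫ x, v x ^ 2 * J x * J x = Z ^ 2 := by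
    rw [hZ2, l2Sq]
    congr 1; ext x; ring
  have e2 : ∫ x, J x * J x = Y ^ 2 := by
    rw [← cYY]
    congr 1; ext x; ring
  rw [reaction, e1, e2, ← hX2, ← hY2, ← hZ2, errorTerm]
  have hsum : 0 ≤ a ^ (2 : ℝ) + a ^ (2 / (1 + α)) * G ^ (2 * α / (1 + α))
        + a ^ (2 / (1 - α)) + d + d ^ (2 / (2 - α)) := by positivity
  set S := a ^ (2 : ℝ) + a ^ (2 / (1 + α)) * G ^ (2 * α / (1 + α))
        + a ^ (2 / (1 - α)) + d + d ^ (2 / (2 - α)) with hS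
  have hn1 := neg_abs_le (pairing one fun x => ((2 * v x * J x * J x : ℝ) : ℂ)).re
  have hn2 := neg_abs_le (pairing two fun x => ((J x * J x : ℝ) : ℂ)).re
  have q1 : 0 ≤ S * Y ^ 2 := by positivity
  have q2 : 0 ≤ c * (S * Y ^ 2) := by positivity
  have q3 : 0 ≤ cc * Y ^ 2 := by positivity
  have q4 : 0 ≤ c * (cc * Y ^ 2) := by positivity
  nlinarith

end Duality

end Phi42

end

/-! ### Integrability in time, and the regularity statements combined. -/

noncomputable section

namespace Phi42

section Integrability

variable {L : ℝ} [hL : Fact (0 < L)] {s t : ℝ}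

/-- The Besov norms are continuous on the closed interval, so only two terms are singular at s:
‖∇v‖_∞^{2α/(1+α)}, of order (r-s)^{-2α/(1+α)} with exponent below 1 because α < 1, and the
renormalization constant, at most of order (r-s)^{-1/2}. -/
lemma intervalIntegrable_errorTerm {α m V c : ℝ} {one two : ℝ → TDist} {v : ℝ → Torus L → ℝ}
    (hα : 0 < α) (hα' : α < 1) (hm : 0 < m) (hst : s ≤ t) (h1 : ContPath L (-α) s one)
    (h2 : ContPath L (-α) s two)
    (hc : ContinuousOn (fun p : ℝ × Torus L => v p.1 p.2) (Set.Ioi s ×ˢ Set.univ))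
    (hv : ∀ r, s < r → IsC 1 (v r)) (hV0 : 0 ≤ V)
    (hV : ∀ r, s < r → r ≤ t → ∀ i x, |pderiv i (v r) x| ≤ V * (r - s) ^ (-1 : ℝ)) :
    IntervalIntegrable (fun r => errorTerm L c α (one r) (two r) (v r) (cInf L m (r - s)))
      volume s t := by
  have hα1 : 0 < 1 + α := by linarith
  have hα2 : 0 < 1 - α := by linarith
  have hα3 : 0 < 2 - α := by linarith
  have hsub : Set.uIcc s t ⊆ Set.Ici s := by
    rw [Set.uIcc_of_le hst]; exact Set.Icc_subset_Ici_self
  have ca : ∀ p : ℝ, 0 ≤ p → ContinuousOn (fun r => (besov L (-α) (one r)).toReal ^ p)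
      (Set.uIcc s t) := fun p hp =>
    (h1.continuousOn.mono hsub).rpow_const fun _ _ => Or.inr hp
  have cd : ∀ p : ℝ, 0 ≤ p → ContinuousOn (fun r => (besov L (-α) (two r)).toReal ^ p)
      (Set.uIcc s t) := fun p hp =>
    (h2.continuousOn.mono hsub).rpow_const fun _ _ => Or.inr hp
  have hq : 2 * α / (1 + α) < 1 := by rw [div_lt_one hα1]; linarith
  have hq0 : 0 ≤ 2 * α / (1 + α) := by positivity
  have hG : IntervalIntegrable (fun r => supGrad (v r) ^ (2 * α / (1 + α))) volume s t := by
    refine intervalIntegrable_of_singular (C := (2 * V) ^ (2 * α / (1 + α))) hst hq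
      ((aestronglyMeasurable_supGrad hc hv t).aemeasurable.pow_const _).aestronglyMeasurable
      fun r hr hrt => ?_
    have hx : 0 < r - s := sub_pos.2 hr
    rw [Real.norm_of_nonneg (Real.rpow_nonneg (supGrad_nonneg _) _)]
    refine (Real.rpow_le_rpow (supGrad_nonneg _) (supGrad_le_of_pderiv (hV r hr hrt))
      hq0).trans_eq ?_
    rw [← mul_assoc, Real.mul_rpow (by positivity) (by positivity), ← Real.rpow_mul hx.le]
    ring_nf
  have hcc : IntervalIntegrable (fun r => cInf L m (r - s)) volume s t := by
    obtain ⟨h0, hanti, D, hD0, hD⟩ := cInf_bound L hm (ε := 1 / 2) (by norm_num) (by norm_num)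
    refine intervalIntegrable_of_singular (C := D) (q := 1 / 2) hst (by norm_num) ?_
      fun r hr _ => ?_
    · refine (aemeasurable_restrict_of_antitoneOn measurableSet_Ioc
        fun r hr r' hr' hrr' => ?_).aestronglyMeasurable
      exact hanti (sub_pos.2 hr.1) (sub_pos.2 hr'.1) (by linarith)
    · rw [Real.norm_of_nonneg (h0 _ (sub_pos.2 hr))]
      exact hD _ (sub_pos.2 hr)
  have i1 := (ca 2 (by norm_num)).intervalIntegrable (μ := volume)
  have i2 := hG.continuousOn_mul (ca (2 / (1 + α)) (by positivity))
  have i3 := (ca (2 / (1 - α)) (by positivity)).intervalIntegrable (μ := volume)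
  have i4 := (h2.continuousOn.mono hsub).intervalIntegrable (μ := volume)
  have i5 := (cd (2 / (2 - α)) (by positivity)).intervalIntegrable (μ := volume)
  exact (((((i1.add i2).add i3).add i4).add i5).add hcc).const_mul c

lemma intervalIntegrable_l2GradSq {J : ℝ → Torus L → ℝ} {V q : ℝ} (hst : s ≤ t)
    (hc : ContinuousOn (fun p : ℝ × Torus L => J p.1 p.2) (Set.Ioi s ×ˢ Set.univ))
    (hJ : ∀ r, s < r → IsC 1 (J r)) (hq : q < 1 / 2)
    (hV : ∀ r, s < r → r ≤ t → ∀ i x, |pderiv i (J r) x| ≤ V * (r - s) ^ (-q)) :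
    IntervalIntegrable (fun r => l2GradSq (J r)) volume s t := by
  refine intervalIntegrable_of_singular (C := 2 * V ^ 2 * L ^ 2) (q := 2 * q) hst (by linarith)
    (aestronglyMeasurable_integral t (measurable_indicator_gradSq hc hJ)) fun r hr hrt => ?_
  have hx : 0 < r - s := sub_pos.2 hr
  rw [l2GradSq, Real.norm_of_nonneg (integral_nonneg fun x => gradSq_nonneg _ x)]
  refine (integral_le_of_le (hJ r hr).continuous_gradSq
    (gradSq_le_of_pderiv (hV r hr hrt))).trans_eq ?_
  rw [show -(2 * q) = -q + -q by ring, Real.rpow_add hx]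
  ring

lemma intervalIntegrable_l2Sq_mul {v J : ℝ → Torus L → ℝ} {b V γ : ℝ} (hst : s ≤ t)
    (hvc : ContinuousOn (fun p : ℝ × Torus L => v p.1 p.2) (Set.Ioi s ×ˢ Set.univ))
    (hJc : ContinuousOn (fun p : ℝ × Torus L => J p.1 p.2) (Set.Ioi s ×ˢ Set.univ))
    (hγ : 2 * γ < 1) (hv : SingHol b s t γ v) (hJ : ∀ r, s < r → r ≤ t → HolB b V (J r)) :
    IntervalIntegrable (fun r => l2Sq (fun x => v r x * J r x)) volume s t := by
  obtain ⟨M, hM⟩ := hv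
  refine intervalIntegrable_of_singular (C := M ^ 2 * V ^ 2 * L ^ 2) (q := 2 * γ) hst hγ
    (aestronglyMeasurable_integral t (measurable_indicator_after
      (w := fun r x => (v r x * J r x) ^ 2) ((hvc.mul hJc).pow 2))) fun r hr hrt => ?_
  have hx : 0 < r - s := sub_pos.2 hr
  have h1 := hM r hr hrt
  have h2 := hJ r hr hrt
  rw [l2Sq, Real.norm_of_nonneg (integral_nonneg fun x => sq_nonneg _)]
  refine (integral_le_of_le (M := (M * (r - s) ^ (-γ) * V) ^ 2) ((h1.cont.mul h2.cont).pow 2)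
    fun x => ?_).trans_eq ?_
  · change (v r x * J r x) ^ 2 ≤ _
    rw [← sq_abs, abs_mul]
    exact pow_le_pow_left₀ (by positivity)
      (mul_le_mul (h1.bound x) (h2.bound x) (abs_nonneg _) h1.nonneg) 2
  · rw [show -(2 * γ) = -γ + -γ by ring, Real.rpow_add hx]
    ring

end Integrability

section Regularity

variable {L : ℝ} [hL : Fact (0 < L)] {m α₀ β γ : ℝ} {one two three : ℝ → ℝ → TDist} {f : TDist}
  {v : ℝ → ℝ → Torus L → ℝ}

/-- The initial data `u_s` are distributions of regularity `-α₀`. -/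
lemma exists_blockBound_uAt (hα₀ : 0 < α₀) (hβ : 0 < β)
    (hone : ∀ t, 0 ≤ t → MemC L (-α₀) (one 0 t)) (hf : MemC L (-α₀) f)
    (hv : InClass L β γ 0 (v 0)) {s : ℝ} (hs : 0 ≤ s) :
    ∃ U, BlockBound L α₀ U (uAt L one f v s) := by
  rw [uAt]
  split_ifs with h
  · exact ⟨_, blockBound_of_besov_neg hα₀.le hf.2⟩
  · have hs' : 0 < s := lt_of_le_of_ne hs (Ne.symm h)
    exact ⟨_, (blockBound_of_besov_neg hα₀.le (hone s hs).2).add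
      ((blockBound_of_besov (hv.besov_lt_top hs')).mono (by linarith) le_rfl)⟩

/-- Regularity of the remainder and of the linearization, with the blow-up rates at the initial
time. -/
lemma exists_regularity (hm : 0 < m) (hα₀ : 0 < α₀) (hβ : 0 < β) (hγ : (α₀ + β) / 2 < γ)
    (hγ' : γ < 1 / 3)
    (hpath : ∀ a : ℝ, 0 < a → ∀ s, 0 ≤ s → ContPath L (-a) s (one s) ∧ ContPath L (-a) s (two s) ∧
      ContPath L (-a) s (three s)) (hf : MemC L (-α₀) f)
    (hrem : ∀ s, 0 ≤ s → IsRemainder L m β γ s (one s) (two s) (three s) (uAt L one f v s) (v s))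
    {s : ℝ} (hs : 0 ≤ s) {h : Torus L → ℝ} {J : ℝ → Torus L → ℝ} (hh : IsC 1 h)
    (hJ : IsLinearized L m β γ s (one s) (two s) (v s) h J) (T : ℝ) :
    ∃ b U V q : ℝ, 0 < b ∧ b ≤ 1 ∧ 0 ≤ V ∧ q < 1 / 2 ∧ SingHol b s T γ (v s) ∧
      (∀ r, s < r → r ≤ T → BlockBound L (b / 2) U (one s r) ∧ BlockBound L (b / 2) U (two s r)) ∧
      (∀ r, s < r → r ≤ T → IsC 1 (v s r) ∧
        ∀ i x, |pderiv i (v s r) x| ≤ V * (r - s) ^ (-1 : ℝ)) ∧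
      ∀ r, s < r → r ≤ T → HolB b V (J r) ∧ IsC 1 (J r) ∧
        ∀ i x, |pderiv i (J r) x| ≤ V * (r - s) ^ (-q) := by
  -- A single small exponent meets all constraints: b < β to use the solution class, 3b/2 < 1 - 3γ
  -- for the Duhamel terms, and b + α₀ ≤ 1 since α₀ + β < 2γ < 2/3. The Wick data are measured at
  -- regularity -b/2 so that they can be multiplied by b-Hölder functions.
  set b := min (β / 2) ((1 - 3 * γ) / 2) with hb
  have hb1 : b ≤ β / 2 := min_le_left _ _
  have hb2 : b ≤ (1 - 3 * γ) / 2 := min_le_right _ _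
  have hb0 : 0 < b := lt_min (by linarith) (by linarith)
  obtain ⟨p1, p2, p3⟩ := hpath (b / 2) (by linarith) s hs
  obtain ⟨U1, -, h1⟩ := p1.exists_blockBound (by linarith) T
  obtain ⟨U2, -, h2⟩ := p2.exists_blockBound (by linarith) T
  obtain ⟨U3, -, h3⟩ := p3.exists_blockBound (by linarith) T
  set U := max U1 (max U2 U3)
  have h1' : ∀ r, s < r → r ≤ T → BlockBound L (b / 2) U (one s r) := fun r hr hrT =>
    (h1 r hr.le hrT).mono le_rfl (le_max_left _ _)
  have h2' : ∀ r, s < r → r ≤ T → BlockBound L (b / 2) U (two s r) := fun r hr hrT =>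
    (h2 r hr.le hrT).mono le_rfl ((le_max_left _ _).trans (le_max_right _ _))
  have h3' : ∀ r, s < r → r ≤ T → BlockBound L (b / 2) U (three s r) := fun r hr hrT =>
    (h3 r hr.le hrT).mono le_rfl ((le_max_right _ _).trans (le_max_right _ _))
  obtain ⟨U0, hU0⟩ := exists_blockBound_uAt hα₀ hβ
    (fun t ht => (hpath α₀ hα₀ 0 le_rfl).1.1 t ht) hf (hrem 0 le_rfl).inClass hs
  have hvH := (hrem s hs).inClass.singHol (b := b) hb0.le (by linarith) (by linarith)
    (by linarith) T
  obtain ⟨V1, hV10, hV1⟩ := (hrem s hs).isC_one hm (by linarith) hγ' hb0 (by linarith) (by linarith)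
    (by linarith) hα₀.le hU0 h1' h2' h3'
  obtain ⟨V2, q, hV20, -, hq, hV2⟩ := hJ.regularity hh hm (by linarith) hb0 (by linarith)
    (by linarith) (by linarith) hvH h1' h2'
  refine ⟨b, U, max V1 V2, q, hb0, by linarith, hV10.trans (le_max_left _ _), hq, hvH,
    fun r hr hrT => ⟨h1' r hr hrT, h2' r hr hrT⟩, fun r hr hrT => ⟨(hV1 r hr hrT).1, fun i x => ?_⟩,
    fun r hr hrT => ⟨(hV2 r hr hrT).1.mono (le_max_right _ _), (hV2 r hr hrT).2.1, fun i x => ?_⟩⟩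
  · have : 0 ≤ (r - s) ^ (-1 : ℝ) := Real.rpow_nonneg (by linarith) _
    exact ((hV1 r hr hrT).2 i x).trans (mul_le_mul_of_nonneg_right (le_max_left _ _) this)
  · have : 0 ≤ (r - s) ^ (-q) := Real.rpow_nonneg (by linarith) _
    exact ((hV2 r hr hrT).2.2 i x).trans (mul_le_mul_of_nonneg_right (le_max_right _ _) this)

end Regularity

end Phi42

end

/-! ### Proof of the proposition. -/

theorem proposition3p1 (α : ℝ) (hα : 0 < α) (hα' : α < 1) :
    ∃ c : ℝ, 0 < c ∧
      ∀ (L : ℝ) [Fact (0 < L)] (m : ℝ), 0 < m →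
      ∀ (α₀ β γ : ℝ), 0 < α₀ → 0 < β → (α₀ + β) / 2 < γ → γ < 1 / 3 →
      ∀ (Ω : Type*) [MeasurableSpace Ω] (P : Measure Ω) [IsProbabilityMeasure P]
        (ξ : (ℝ × Torus L → ℝ) → Ω → ℝ) (one two three : ℝ → ℝ → Ω → TDist),
      IsWhiteNoise L P ξ → IsWickSystem L m P ξ one two three →
      ∀ᵐ ω ∂P, ∀ (f : TDist) (v : ℝ → ℝ → Torus L → ℝ), MemC L (-α₀) f →
        (∀ s, 0 ≤ s → IsRemainder L m β γ s (fun r => one s r ω) (fun r => two s r ω)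
          (fun r => three s r ω) (uAt L (fun a b => one a b ω) f v s) (v s)) →
        ∀ (s : ℝ), 0 ≤ s → ∀ (h : Torus L → ℝ) (J : ℝ → Torus L → ℝ), IsC ((⊤ : ℕ∞) : WithTop ℕ∞) h →
          IsLinearized L m β γ s (fun r => one s r ω) (fun r => two s r ω) (v s) h J →
          let g : ℝ → ℝ := fun r =>
            errorTerm L c α (one s r ω) (two s r ω) (v s r) (cInf L m (r - s))
          (∀ r, s < r → IsC 1 (v s r) ∧ IsC 1 (J r)) ∧
          (∀ t, s ≤ t → IntervalIntegrable g volume s t ∧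
            IntervalIntegrable (fun r => l2GradSq (J r)) volume s t ∧
            IntervalIntegrable (fun r => l2Sq (fun x => v s r x * J r x)) volume s t) ∧
          (∀ t' t, s ≤ t' → t' ≤ t →
            l2Sq (J t)
              + (∫ r in t'..t, expWeight m g r t * l2GradSq (J r))
              + (∫ r in t'..t, expWeight m g r t * l2Sq (fun x => v s r x * J r x))
              ≤ expWeight m g t' t * l2Sq (J t')) ∧
          (∀ t, s ≤ t → l2Sq (J t) ≤ expWeight m g s t * l2Sq h) := by
  obtain ⟨c, hc, hreact⟩ := exists_reaction_le hα hα'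
  refine ⟨c, hc, fun L _ m hm α₀ β γ hα₀ hβ hγ hγ' Ω _ P _ ξ one two three _ hW => ?_⟩
  -- From here the argument is deterministic, on the event where all paths are continuous; this
  -- event does not depend on f, h, s or t.
  filter_upwards [hW.paths] with ω hpath f v hf hrem s hs h J hh hJ g
  have hγ0 : 0 < γ := by linarith
  have hh1 : IsC 1 h := ContDiff.of_le hh (by exact_mod_cast le_top)
  have hreg := exists_regularity (one := fun a b => one a b ω) (two := fun a b => two a b ω)
    (three := fun a b => three a b ω) hm hα₀ hβ hγ hγ' hpath hf hrem hs hh1 hJ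
  have hC1 : ∀ r, s < r → IsC 1 (v s r) ∧ IsC 1 (J r) := fun r hr => by
    obtain ⟨b, U, V, q, -, -, -, -, -, -, hv, hJr⟩ := hreg r
    exact ⟨(hv r hr le_rfl).1, (hJr r hr le_rfl).2.1⟩
  have hvc := (hrem s hs).inClass.continuousOn_uncurry hβ
  have hJc := hJ.inClass.continuousOn_uncurry hβ
  obtain ⟨pα1, pα2, -⟩ := hpath α hα s hs
  have hint : ∀ t, s ≤ t → IntervalIntegrable g volume s t ∧
      IntervalIntegrable (fun r => l2GradSq (J r)) volume s t ∧
      IntervalIntegrable (fun r => l2Sq (fun x => v s r x * J r x)) volume s t := fun t hst => by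
    obtain ⟨b, U, V, q, hb, hb1, hV0, hq, hvH, -, hv, hJr⟩ := hreg t
    exact ⟨intervalIntegrable_errorTerm hα hα' hm hst pα1 pα2 hvc (fun r hr => (hC1 r hr).1) hV0
        fun r hr hrt => (hv r hr hrt).2,
      intervalIntegrable_l2GradSq hst hJc (fun r hr => (hC1 r hr).2) hq
        fun r hr hrt => (hJr r hr hrt).2.2,
      intervalIntegrable_l2Sq_mul hst hvc hJc (by linarith) hvH fun r hr hrt => (hJr r hr hrt).1⟩
  have hmain : ∀ t' t, s ≤ t' → t' ≤ t → l2Sq (J t)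
      + (∫ r in t'..t, expWeight m g r t * l2GradSq (J r))
      + (∫ r in t'..t, expWeight m g r t * l2Sq (fun x => v s r x * J r x))
      ≤ expWeight m g t' t * l2Sq (J t') := by
    intro t' t hst' htt'
    have hst := hst'.trans htt'
    -- The energy balance is set up on [s, t + 1], which is nondegenerate even when t = s.
    obtain ⟨b, U, V, q, hb, hb1, hV0, hq, hvH, h12, hv, hJr⟩ := hreg (t + 1)
    have hprim := hJ.isPrimitive_l2Sq hm hh1.continuous (by linarith : s < t + 1) hγ0 (by linarith)
      hb hb1 (by linarith : 2 * q < 1) hvH (fun r hr hrt => (h12 r hr hrt).1)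
      (fun r hr hrt => (h12 r hr hrt).2) hJr
    obtain ⟨ig, iD, iE⟩ := hint (t + 1) (by linarith)
    -- Twice the reaction is at most X² - Z² + 2gY², so the balance -2X² - 2mY² + 2·reaction leaves
    -- the dissipation D = X² + Z².
    have hgron := hprim.gronwall (m := m) ig (iD.add iE) (fun r hr => by
      have h0 := (cInf_bound L hm (ε := 1) one_pos le_rfl).1 (r - s) (sub_pos.2 hr.1)
      have h1 := hreact L (one s r ω) (two s r ω) (cInf L m (r - s)) (v s r) (J r) h0
        (pα1.1 r hr.1.le).2 (pα2.1 r hr.1.le).2 (hC1 r hr.1).1 (hC1 r hr.1).2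
      simp only [g]
      linarith) hst' htt' (by linarith)
    obtain ⟨ig', iD', iE'⟩ := hint t hst
    have hw := (isPrimitive_expWeight (m := m) hst ig').continuousOn hst
    have hsub : Set.uIcc t' t ⊆ Set.uIcc s t := by
      rw [Set.uIcc_of_le htt', Set.uIcc_of_le hst]; exact Set.Icc_subset_Icc hst' le_rfl
    have hw' : ContinuousOn (fun r => expWeight m g r t) (Set.uIcc t' t) :=
      hw.mono (by rwa [Set.uIcc_of_le hst] at hsub)
    simp only [mul_add] at hgron
    rw [intervalIntegral.integral_add ((iD'.mono_set hsub).continuousOn_mul hw')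
      ((iE'.mono_set hsub).continuousOn_mul hw')] at hgron
    linarith
  refine ⟨hC1, hint, hmain, fun t hst => ?_⟩
  have h1 := hmain s t le_rfl hst
  rw [hJ.initial] at h1
  have h2 : 0 ≤ ∫ r in s..t, expWeight m g r t * l2GradSq (J r) :=
    intervalIntegral.integral_nonneg hst fun r _ =>
      mul_nonneg (Real.exp_pos _).le (integral_nonneg fun x => gradSq_nonneg _ x)
  have h3 : 0 ≤ ∫ r in s..t, expWeight m g r t * l2Sq (fun x => v s r x * J r x) :=
    intervalIntegral.integral_nonneg hst fun r _ =>
      mul_nonneg (Real.exp_pos _).le (integral_nonneg fun x => sq_nonneg _)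
  linarith
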